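/- **Setting.** Let $S$ be a string of length $n$ over a linearly ordered alphabet and let $w=S[s\ldots e]$, $s\le e$, be a non-empty factor of $S$ with (least) period $p$; positions and array entries are counted from $0$. Let $A_w$ be the array of all starting positions of occurrences of $w$ in $S$, sorted by the lexicographic order of the suffixes of $S$ starting there. A cluster $C=(a,b,p)$ is an arithmetic progression $a,a+p,\ldots,b$ of starting positions of occurrences of $w$ that is maximal, i.e. $w$ occurs neither at $a-p$ nor at $b+p$; $C$ implies these occurrences. The periodic occurrence representation $POR_w$ is the set of all clusters. Let $w_s$ be the suffix of $w$ of length $p$. The period rank of an occurrence of $w$ is the largest $x$ such that $x$ consecutive copies of $w_s$ follow it. The tail of $C$ is the suffix $S[b+|w|\ldots n-1]$; $C$ is increasing if its tail is lexicographically larger than $w_s$ and decreasing if it is smaller. For $r\ge 0$ let $D_r$ (resp. $I_r$) be the array of the occurrences of period rank $r$ implied by decreasing (resp. increasing) clusters, sorted by the lexicographic order of the tails of their clusters; for an occurrence of period rank $r$ implied by a cluster $C$, $T_r$ denotes $D_r$ if $C$ is decreasing and $I_r$ if $C$ is increasing. **Theorem.** (1) $A_w$ is the concatenation $$A_w=D_0\,D_1\cdots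 D_m\;I_{t}\,I_{t-1}\cdots I_0,$$ where $m$ and $t$ are the maximal period ranks of an occurrence implied by a decreasing, respectively increasing, cluster ($0$ if there is no such cluster). (2) Work on a word RAM with words of $O(\log n)$ bits and unit-cost instructions, where the text $S$ is accessed through longest-common-extension queries (the longest common prefix of two suffixes of $S$, the longest common suffix of two prefixes of $S$) and comparisons of two symbols of $S$, at a cost of $O(\log n)$ each. There are a preprocessing algorithm and a query algorithm such that, for all $S$ and $w$ as above, given $n$, $s$, $e$ and a list of the clusters of $POR_w$ in any order, the preprocessing takes $O(|POR_w|\log^{k} n)$ time for some absolute constant $k$ (that is, $\tilde{\mathcal O}(|POR_w|)$), and after it any sequence of look-up queries can be answered, each in $O(\log^3 n)$ time: given $i$ with $0\le i<|A_w|$, the query returns $A_w[i]$, its period rank $r$, an index $i'$ with $A_w[i]=T_r[i']$, and the cluster $C\in POR_w$ that implies the occurrence at $A_w[i]$. -/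

import Mathlib

/-! ## Strings

A string is a `List` over a linearly ordered alphabet; positions and array entries are counted
from `0`.  The lexicographic order is the order `<` of `List` (a proper prefix is smaller). The
suffix of `S` that starts at position `i` is `S.drop i`. -/

/-- `p` is a period of `w`. -/
def IsPeriod {α : Type*} (w : List α) (p : ℕ) : Prop :=
  ∀ i, i + p < w.length → w[i]? = w[i + p]?

theorem exists_isPeriod {α : Type*} (w : List α) : ∃ p, 0 < p ∧ IsPeriod w p :=
  ⟨w.length + 1, Nat.succ_pos _, fun _ h => absurd h (by omega)⟩

open Classical in
/-- The period of `w`: its least positive period. -/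
noncomputable def per {α : Type*} (w : List α) : ℕ := Nat.find (exists_isPeriod w)

/-- The factor of `S` between positions `s` and `e`, both included. -/
def factor {α : Type*} (S : List α) (s e : ℕ) : List α := (S.drop s).take (e + 1 - s)

/-- `w` occurs in `S` at position `i`. -/
def Occurs {α : Type*} (S w : List α) (i : ℕ) : Prop := w <+: S.drop i

/-- Length of the longest common prefix of two strings. -/
def lcpLen {α : Type*} [DecidableEq α] : List α → List α → ℕ
  | x :: u, y :: v => if x = y then lcpLen u v + 1 else 0
  | _, _ => 0

/-- Length of the longest common suffix of two strings. -/
def lcsLen {α : Type*} [DecidableEq α] (u v : List α) : ℕ := lcpLen u.reverse v.reverse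

/-- The array `A_w` of all starting positions of occurrences of `w` in `S`, sorted by the
lexicographic order of the suffixes of `S` that start there. -/
def sortedOcc {α : Type*} [LinearOrder α] (S w : List α) : List ℕ :=
  ((List.range S.length).filter fun i => w.isPrefixOf (S.drop i)).mergeSort
    fun i j => decide (S.drop i ≤ S.drop j)

/-! ## Clusters of occurrences -/

/-- The cluster `(a, b, p)`, that is the arithmetic progression `a, a + p, a + 2p, …, b`. -/
structure Cluster where
  a : ℕ
  b : ℕ
  p : ℕ

/-- The number `(b - a) / p + 1` of occurrences that a cluster represents. -/
def Cluster.size (C : Cluster) : ℕ := (C.b - C.a) / C.p + 1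

/-- The positions `a, a + p, …, b` implied by a cluster. -/
def Cluster.positions (C : Cluster) : List ℕ := (List.range C.size).map fun t => C.a + t * C.p

/-- `C` is a cluster of occurrences of `w` in `S`: an arithmetic progression of occurrences of `w`
whose difference is the period of `w`, which cannot be prolonged to the left or to the right.
(Equivalently: it consists of all the occurrences of `w` inside one maximal factor of `S` that has
the period `per w`.) -/
structure IsCluster {α : Type*} (S w : List α) (C : Cluster) : Prop where
  diff : C.p = per w
  le : C.a ≤ C.b
  dvd : C.p ∣ C.b - C.a
  occurs : ∀ i ∈ C.positions, Occurs S w i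
  left_maximal : ∀ i, i + C.p = C.a → ¬ Occurs S w i
  right_maximal : ¬ Occurs S w (C.b + C.p)

/-- `P` lists, in any order and without repetition, the periodic occurrence representation
`POR_w` of `w` in `S`. -/
def IsPOR {α : Type*} (S w : List α) (P : List Cluster) : Prop :=
  P.Nodup ∧ ∀ C, C ∈ P ↔ IsCluster S w C

/-- The suffix `w_s` of `w` whose length is the period of `w`. -/
noncomputable def perSuffix {α : Type*} (w : List α) : List α := w.drop (w.length - per w)

open Classical in
/-- The period rank of the occurrence of `w` at position `i`: the largest `x` such that `x`
consecutive copies of `w_s` follow the occurrence.  (As `w_s` is not empty, `x ≤ S.length`.) -/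
noncomputable def periodRank {α : Type*} (S w : List α) (i : ℕ) : ℕ :=
  Nat.findGreatest
    (fun x => (List.replicate x (perSuffix w)).flatten <+: S.drop (i + w.length)) S.length

/-- The tail of a cluster: the suffix of `S` after the rightmost occurrence of the cluster. -/
def Cluster.tail {α : Type*} (S w : List α) (C : Cluster) : List α := S.drop (C.b + w.length)

/-- The increasing clusters in `P`: those with `w_s < tail`. -/
noncomputable def incClusters {α : Type*} [LinearOrder α] (S w : List α) (P : List Cluster) :
    List Cluster :=
  P.filter fun C => decide (perSuffix w < C.tail S w)

/-- The decreasing clusters in `P`: those with `tail < w_s`. -/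
noncomputable def decClusters {α : Type*} [LinearOrder α] (S w : List α) (P : List Cluster) :
    List Cluster :=
  P.filter fun C => decide (C.tail S w < perSuffix w)

/-- The array `T_r` of a list `Q` of clusters: the occurrences of period rank `r` that are implied
by the clusters in `Q`, sorted by the lexicographic order of the tails of their clusters. -/
noncomputable def rankArray {α : Type*} [LinearOrder α] (S w : List α) (Q : List Cluster)
    (r : ℕ) : List ℕ :=
  (Q.mergeSort fun C C' => decide (C.tail S w ≤ C'.tail S w)).flatMap fun C =>
    C.positions.filter fun i => periodRank S w i = r

/-- The largest period rank of an occurrence implied by a cluster in `Q` (`0` if `Q` is empty). -/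
noncomputable def maxRank {α : Type*} (S w : List α) (Q : List Cluster) : ℕ :=
  ((Q.flatMap Cluster.positions).map (periodRank S w)).foldr max 0

/-! ## The machine model: a word RAM with longest-common-extension queries -/

/-- Arithmetic and comparison operations on words. -/
inductive BinOp where
  | add | sub | mul | div | mod | lt | eq

/-- Subtraction is truncated at `0`, division rounds down; truth values are `1` and `0`. -/
def BinOp.eval : BinOp → ℕ → ℕ → ℕ
  | .add, u, v => u + v
  | .sub, u, v => u - v
  | .mul, u, v => u * v
  | .div, u, v => u / v
  | .mod, u, v => u % v
  | .lt, u, v => if u < v then 1 else 0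
  | .eq, u, v => if u = v then 1 else 0

/-- Programs. The arguments `x y z` are names of registers; a program mentions only finitely many
registers, and all other storage is in the memory. The text is accessible only through
`lcp`, `lcs` and `symLt`. -/
inductive Cmd where
  /-- do nothing -/
  | skip
  /-- `x := v` for a constant `v` -/
  | const (x v : ℕ)
  /-- `x := y ∘ z` -/
  | op (o : BinOp) (x y z : ℕ)
  /-- `x := mem[y]` -/
  | load (x y : ℕ)
  /-- `mem[x] := y` -/
  | store (x y : ℕ)
  /-- `x :=` longest common prefix of the suffixes of the text that start at `y` and at `z` -/
  | lcp (x y z : ℕ)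
  /-- `x :=` longest common suffix of the prefixes of the text that end at `y` and at `z` -/
  | lcs (x y z : ℕ)
  /-- `x := 1` if the symbol at `y` is smaller than the symbol at `z`, otherwise `x := 0` -/
  | symLt (x y z : ℕ)
  | seq (c d : Cmd)
  /-- `if x ≠ 0 then c else d` -/
  | ite (x : ℕ) (c d : Cmd)
  /-- `while x ≠ 0 do c` -/
  | loop (x : ℕ) (c : Cmd)

/-- The contents of the registers and of the memory. -/
structure State where
  reg : ℕ → ℕ
  mem : ℕ → ℕ

/-- The state after the assignment of `v` to register `x`. -/
def State.setReg (σ : State) (x v : ℕ) : State := ⟨Function.update σ.reg x v, σ.mem⟩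

/-- The state after the assignment of `v` to the memory cell `x`. -/
def State.setMem (σ : State) (x v : ℕ) : State := ⟨σ.reg, Function.update σ.mem x v⟩

open Classical in
/-- The result of the comparison of the symbols of `S` at positions `i` and `j`
(`0` if one of them is outside `S`). -/
noncomputable def symLtVal {α : Type*} [LinearOrder α] (S : List α) (i j : ℕ) : ℕ :=
  if ∃ x y, S[i]? = some x ∧ S[j]? = some y ∧ x < y then 1 else 0

/-- `Exec S B L c σ σ' t`: started in the state `σ` on the text `S`, the program `c` halts in the
state `σ'` after `t` time units. Every instruction and every test takes one time unit, except that
an access to the text takes `L` time units. A word holds a number below `B`: a program that computes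
a larger number is stuck, so that it has no execution. -/
inductive Exec {α : Type*} [LinearOrder α] (S : List α) (B L : ℕ) :
    Cmd → State → State → ℕ → Prop
  | skip (σ : State) : Exec S B L .skip σ σ 1
  | const (σ : State) (x v : ℕ) (h : v < B) : Exec S B L (.const x v) σ (σ.setReg x v) 1
  | op (σ : State) (o : BinOp) (x y z : ℕ) (h : o.eval (σ.reg y) (σ.reg z) < B) :
      Exec S B L (.op o x y z) σ (σ.setReg x (o.eval (σ.reg y) (σ.reg z))) 1
  | load (σ : State) (x y : ℕ) :
      Exec S B L (.load x y) σ (σ.setReg x (σ.mem (σ.reg y))) 1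
  | store (σ : State) (x y : ℕ) :
      Exec S B L (.store x y) σ (σ.setMem (σ.reg x) (σ.reg y)) 1
  | lcp (σ : State) (x y z : ℕ) :
      Exec S B L (.lcp x y z) σ
        (σ.setReg x (lcpLen (S.drop (σ.reg y)) (S.drop (σ.reg z)))) L
  | lcs (σ : State) (x y z : ℕ) :
      Exec S B L (.lcs x y z) σ
        (σ.setReg x (lcsLen (S.take (σ.reg y + 1)) (S.take (σ.reg z + 1)))) L
  | symLt (σ : State) (x y z : ℕ) :
      Exec S B L (.symLt x y z) σ (σ.setReg x (symLtVal S (σ.reg y) (σ.reg z))) L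
  | seq {c d : Cmd} {σ σ' σ'' : State} {t t' : ℕ} (h : Exec S B L c σ σ' t)
      (h' : Exec S B L d σ' σ'' t') : Exec S B L (.seq c d) σ σ'' (t + t')
  | ite_true {x : ℕ} {c d : Cmd} {σ σ' : State} {t : ℕ} (hx : σ.reg x ≠ 0)
      (h : Exec S B L c σ σ' t) : Exec S B L (.ite x c d) σ σ' (t + 1)
  | ite_false {x : ℕ} {c d : Cmd} {σ σ' : State} {t : ℕ} (hx : σ.reg x = 0)
      (h : Exec S B L d σ σ' t) : Exec S B L (.ite x c d) σ σ' (t + 1)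
  | loop_done {x : ℕ} {c : Cmd} {σ : State} (hx : σ.reg x = 0) :
      Exec S B L (.loop x c) σ σ 1
  | loop_step {x : ℕ} {c : Cmd} {σ σ' σ'' : State} {t t' : ℕ} (hx : σ.reg x ≠ 0)
      (h : Exec S B L c σ σ' t) (h' : Exec S B L (.loop x c) σ' σ'' t') :
      Exec S B L (.loop x c) σ σ'' (t + t' + 1)

/-- The initial state for the preprocessing: registers `0, 1, 2, 3` hold the length `n` of the text,
the two ends `s` and `e` of the word, and the number of clusters; the memory holds the clusters one
after the other, three cells each; everything else is `0`. -/
def initState (n s e : ℕ) (P : List Cluster) : State where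
  reg := fun x => [n, s, e, P.length].getD x 0
  mem := fun x => (P.flatMap fun C => [C.a, C.b, C.p]).getD x 0

/-- In the state `σ`, register `0` holds the `i`-th entry `v` of the array `A_w`, register `1` its
period rank `r`, register `2` an index `i'`, and registers `3, 4, 5` the cluster `C` in `POR_w` that
implies the occurrence at `v`, where `v` is the entry with index `i'` of the array `T_r` of
the increasing clusters if `C` is increasing, and of the decreasing clusters if `C` is
decreasing. -/
def IsAnswer {α : Type*} [LinearOrder α] (S w : List α) (P : List Cluster) (i : ℕ)
    (σ : State) : Prop :=
  (sortedOcc S w)[i]? = some (σ.reg 0) ∧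
  σ.reg 1 = periodRank S w (σ.reg 0) ∧
  ∃ C : Cluster, C.a = σ.reg 3 ∧ C.b = σ.reg 4 ∧ C.p = σ.reg 5 ∧
    C ∈ P ∧ σ.reg 0 ∈ C.positions ∧
    ((C ∈ incClusters S w P ∧
        (rankArray S w (incClusters S w P) (σ.reg 1))[σ.reg 2]? = some (σ.reg 0)) ∨
      (C ∈ decClusters S w P ∧
        (rankArray S w (decClusters S w P) (σ.reg 1))[σ.reg 2]? = some (σ.reg 0)))

/-! ## Periods and occurrences -/

section Strings

variable {α : Type*} {S w : List α} {C : Cluster}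

/-! Write `p` for the period of `w`. The suffix of `S` at an occurrence of rank `r` in a cluster `C`
is `w · w_s^r · tail(C)`. Indeed, after an occurrence of `w`, one more copy of `w_s` is the same as
one more occurrence, `p` further right (`occurs_add_per_iff`). So a cluster of size `q` has exactly
one occurrence of each rank `0, …, q - 1`, the one of rank `r` being `b - r * p`
(`IsCluster.rank_b_sub`, `IsCluster.drop_b_sub`), and right maximality says that `w_s` is not a
prefix of the tail.

Order. For ranks `r < r'`, behind the common `w · w_s^r` the first suffix continues with its tail
and the second with `w_s`. Since `w_s` is not a prefix of that tail, comparing the tail with `w_s`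
alone decides: decreasing clusters put the smaller rank first, increasing ones put it last. Equal
ranks are decided by the tails. Every occurrence lies in exactly one cluster, so the concatenation
is a sorted arrangement of all occurrences (`sortedOcc_eq`).

Data structure. Sort the `m` clusters by their tails. Let `f j` be the size of the `j`-th cluster if
it is decreasing and `0` otherwise, and define `g` likewise for increasing clusters. Then `D_r`
lists the indices with `r < f j` in order (`rankArray_filter`), and `D_0, …, D_(r-1)` have `∑ min (f
j) r` entries together, which is `rankSum f m r`. A query in the decreasing half finds `r` with
`rankSum f m r ≤ i < rankSum f m (r + 1)` by binary search and then selects the index `j` with `r <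
f j` that is preceded by `i - rankSum f m r` such indices; the increasing half is read from the end
with `g`. One value of `rankSum` takes one binary search in the sorted values and a prefix sum. The
selection descends through the stored levels of a merge sort of the values and counts in each left
half by binary search. Both parts take `O(log² n)` time and do not access the text.

Preprocessing consists of three merge sorts: of the tails, of `f` and of `g`. A merge places each
item on its own, by a binary search in the sibling block (`blockPos_succ_even`,
`blockPos_succ_odd`), so sorting the tails takes `O(m log² n)` comparisons of cost `O(log n)` each.
The comparison with `w_s` is replaced by one with the suffix of `S` that starts at the last `p`
letters of `w` (`IsCluster.tail_lt_drop_iff`). -/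

theorem per_pos (w : List α) : 0 < per w := by
  classical exact (Nat.find_spec (exists_isPeriod w)).1

theorem isPeriod_per (w : List α) : IsPeriod w (per w) := by
  classical exact (Nat.find_spec (exists_isPeriod w)).2

theorem per_le_length (hw : w ≠ []) : per w ≤ w.length := by
  classical
  exact Nat.find_min' (exists_isPeriod w)
    ⟨List.length_pos_iff.2 hw, fun i h => absurd h (by omega)⟩

theorem length_perSuffix (hw : w ≠ []) : (perSuffix w).length = per w := by
  have := per_le_length hw
  simp only [perSuffix, List.length_drop]; omega

theorem perSuffix_getElem? (w : List α) (k : ℕ) :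
    (perSuffix w)[k]? = w[w.length - per w + k]? := by
  simp [perSuffix]

theorem prefix_iff_getElem?_eq {u l : List α} :
    u <+: l ↔ ∀ k < u.length, l[k]? = u[k]? := by
  rw [List.prefix_iff_getElem?]
  constructor
  · intro h k hk; rw [h k hk, List.getElem?_eq_getElem hk]
  · intro h k hk; rw [h k hk, List.getElem?_eq_getElem hk]

theorem append_prefix_iff_drop {u v l : List α} :
    u ++ v <+: l ↔ u <+: l ∧ v <+: l.drop u.length := by
  constructor
  · rintro ⟨x, rfl⟩
    exact ⟨⟨v ++ x, by simp⟩, ⟨x, by simp⟩⟩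
  · rintro ⟨⟨x, rfl⟩, y, hy⟩
    refine ⟨y, ?_⟩
    simp at hy
    simp [hy]

theorem occurs_iff {i : ℕ} : Occurs S w i ↔ ∀ k < w.length, S[i + k]? = w[k]? := by
  simp [Occurs, prefix_iff_getElem?_eq]

theorem Occurs.add_length_le {i : ℕ} (hw : w ≠ []) (h : Occurs S w i) :
    i + w.length ≤ S.length := by
  have h1 := List.IsPrefix.length_le h
  have := List.length_pos_iff.2 hw
  simp at h1; omega

/-- In the occurrence shifted by the period, the first `|w| - per w` letters overlap the given
occurrence and are right by periodicity. Only the last `per w` letters are a new condition, and they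
spell `w_s`. -/
theorem occurs_add_per_iff {i : ℕ} (hw : w ≠ []) (h : Occurs S w i) :
    Occurs S w (i + per w) ↔ perSuffix w <+: S.drop (i + w.length) := by
  have hle := per_le_length hw
  rw [prefix_iff_getElem?_eq, occurs_iff]
  rw [occurs_iff] at h
  simp only [length_perSuffix hw, perSuffix_getElem?, List.getElem?_drop]
  constructor
  · intro h' k hk
    rw [← h' _ (by omega)]
    congr 1; omega
  · intro h' k hk
    by_cases hk' : k + per w < w.length
    · rw [isPeriod_per w k hk', ← h _ hk']
      congr 1; omega
    · have := h' (k + per w - w.length) (by omega)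
      rw [show w.length - per w + (k + per w - w.length) = k by omega] at this
      rw [← this]; congr 1; omega

theorem replicate_perSuffix_prefix_iff (hw : w ≠ []) (x : ℕ) {i : ℕ} (h : Occurs S w i) :
    (List.replicate x (perSuffix w)).flatten <+: S.drop (i + w.length) ↔
      ∀ t ≤ x, Occurs S w (i + t * per w) := by
  induction x generalizing i with
  | zero => simp [h]
  | succ x ih =>
    rw [List.replicate_succ, List.flatten_cons, append_prefix_iff_drop,
      ← occurs_add_per_iff hw h, length_perSuffix hw, List.drop_drop,
      show i + w.length + per w = i + per w + w.length by omega]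
    constructor
    · rintro ⟨h1, h2⟩ t ht
      rw [ih h1] at h2
      rcases t with _ | t
      · simpa using h
      · have := h2 t (by omega)
        rwa [show i + (t + 1) * per w = i + per w + t * per w by ring]
    · intro h'
      have h1 : Occurs S w (i + per w) := by simpa using h' 1 (by omega)
      refine ⟨h1, (ih h1).2 fun t ht => ?_⟩
      have := h' (t + 1) (by omega)
      rwa [show i + (t + 1) * per w = i + per w + t * per w by ring] at this

theorem periodRank_eq (hw : w ≠ []) {i x : ℕ} (h : ∀ t ≤ x, Occurs S w (i + t * per w))
    (h' : ¬ Occurs S w (i + (x + 1) * per w)) : periodRank S w i = x := by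
  classical
  have h0 : Occurs S w i := by simpa using h 0 (by omega)
  have hp := per_pos w
  unfold periodRank
  rw [Nat.findGreatest_eq_iff]
  refine ⟨?_, fun _ => (replicate_perSuffix_prefix_iff hw x h0).2 h, ?_⟩
  -- The occurrence shifted `x` times by a positive period still fits into `S`, so the cutoff
  -- `S.length` in `periodRank` does no harm.
  · have := (h x le_rfl).add_length_le hw
    nlinarith
  · intro n hn _ hc
    exact h' ((replicate_perSuffix_prefix_iff hw n h0).1 hc (x + 1) hn)

/-! ## Clusters -/

theorem Cluster.mem_positions {i : ℕ} : i ∈ C.positions ↔ ∃ t < C.size, C.a + t * C.p = i := by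
  simp [Cluster.positions]

theorem Cluster.size_pos (C : Cluster) : 0 < C.size := Nat.succ_pos _

namespace IsCluster

variable (hC : IsCluster S w C)
include hC

theorem b_eq : C.b = C.a + (C.size - 1) * per w := by
  have h1 := Nat.div_mul_cancel hC.dvd
  have h2 := hC.le
  have h3 := hC.diff
  simp only [Cluster.size, Nat.add_sub_cancel, ← h3]
  omega

theorem occurs_add {t : ℕ} (ht : t < C.size) : Occurs S w (C.a + t * per w) :=
  hC.occurs _ (Cluster.mem_positions.2 ⟨t, ht, by rw [hC.diff]⟩)

theorem not_occurs : ¬ Occurs S w (C.a + C.size * per w) := by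
  have h := hC.right_maximal
  rw [hC.b_eq, hC.diff] at h
  have := C.size_pos
  obtain ⟨k, hk⟩ := Nat.exists_eq_succ_of_ne_zero this.ne'
  rw [hk] at h ⊢
  simpa [Nat.succ_mul, add_assoc] using h

theorem occurs_b : Occurs S w C.b := by
  rw [hC.b_eq]; exact hC.occurs_add (by have := C.size_pos; omega)

theorem rank_add (hw : w ≠ []) {t : ℕ} (ht : t < C.size) :
    periodRank S w (C.a + t * per w) = C.size - 1 - t := by
  apply periodRank_eq hw
  · intro t' ht'
    rw [add_assoc, ← add_mul]
    exact hC.occurs_add (by omega)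
  · rw [add_assoc, ← add_mul, show t + (C.size - 1 - t + 1) = C.size by omega]
    exact hC.not_occurs

theorem b_sub {t : ℕ} (ht : t < C.size) :
    C.b - t * per w = C.a + (C.size - 1 - t) * per w := by
  rw [hC.b_eq, Nat.sub_mul (C.size - 1) t]
  have : t * per w ≤ (C.size - 1) * per w := Nat.mul_le_mul_right _ (by omega)
  omega

theorem rank_b_sub (hw : w ≠ []) {r : ℕ} (hr : r < C.size) :
    periodRank S w (C.b - r * per w) = r := by
  rw [hC.b_sub hr, hC.rank_add hw (by omega)]; omega

theorem b_sub_mem {r : ℕ} (hr : r < C.size) : C.b - r * per w ∈ C.positions := by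
  rw [hC.b_sub hr, Cluster.mem_positions]
  exact ⟨C.size - 1 - r, by omega, by rw [hC.diff]⟩

/-- Ranks fall by one from each position of a cluster to the next, from `size - 1` at `a` to `0` at
`b`, so each of them is attained once. -/
theorem positions_filter_rank (hw : w ≠ []) (r : ℕ) :
    C.positions.filter (fun i => periodRank S w i = r) =
      if r < C.size then [C.b - r * per w] else [] := by
  have hnd : C.positions.Nodup := by
    refine List.Nodup.map_on ?_ List.nodup_range
    intro x _ y _ h
    have := per_pos w
    rw [hC.diff] at h
    exact Nat.eq_of_mul_eq_mul_right this (by omega)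
  have hmem : ∀ i ∈ C.positions, periodRank S w i = r → r < C.size ∧ i = C.b - r * per w := by
    intro i hi h
    obtain ⟨t, ht, rfl⟩ := Cluster.mem_positions.1 hi
    rw [hC.diff, hC.rank_add hw ht] at h
    subst h
    refine ⟨by omega, ?_⟩
    rw [hC.b_sub (by omega), hC.diff, show C.size - 1 - (C.size - 1 - t) = t by omega]
  split_ifs with hr
  · refine (List.perm_singleton.1 ?_)
    rw [List.perm_ext_iff_of_nodup (hnd.filter _) (List.nodup_singleton _)]
    intro i
    simp only [List.mem_filter, decide_eq_true_eq, List.mem_singleton]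
    constructor
    · exact fun h => (hmem i h.1 h.2).2
    · rintro rfl
      exact ⟨hC.b_sub_mem hr, hC.rank_b_sub hw hr⟩
  · rw [List.filter_eq_nil_iff]
    intro i hi h
    exact hr (hmem i hi (by simpa using h)).1

theorem drop_b_sub (hw : w ≠ []) {r : ℕ} (hr : r < C.size) :
    S.drop (C.b - r * per w) =
      w ++ ((List.replicate r (perSuffix w)).flatten ++ C.tail S w) := by
  have ho : Occurs S w (C.b - r * per w) := by
    rw [hC.b_sub hr]; exact hC.occurs_add (by omega)
  have hb : C.b - r * per w + r * per w = C.b := by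
    rw [hC.b_sub hr, add_assoc, ← add_mul, hC.b_eq,
      show C.size - 1 - r + r = C.size - 1 by omega]
  have h1 : (List.replicate r (perSuffix w)).flatten <+:
      S.drop (C.b - r * per w + w.length) := by
    rw [replicate_perSuffix_prefix_iff hw r ho]
    intro t ht
    rw [hC.b_sub hr, add_assoc, ← add_mul]
    exact hC.occurs_add (by omega)
  obtain ⟨x, hx⟩ := ho
  obtain ⟨y, hy⟩ := h1
  have hx' : x = S.drop (C.b - r * per w + w.length) := by
    rw [← List.drop_drop, ← hx, List.drop_left]
  have hy' : y = C.tail S w := by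
    have h2 : (List.replicate r (perSuffix w)).flatten.length = r * per w := by
      simp [length_perSuffix hw]
    have h3 := congrArg (List.drop (r * per w)) hy
    rw [← h2, List.drop_left, h2, List.drop_drop] at h3
    rw [h3, Cluster.tail]; congr 1; omega
  rw [← hx, hx', ← hy, hy']

theorem not_perSuffix_prefix_tail (hw : w ≠ []) : ¬ perSuffix w <+: C.tail S w := by
  rw [Cluster.tail, ← occurs_add_per_iff hw hC.occurs_b, ← hC.diff]
  exact hC.right_maximal

/-- Clusters are disjoint: both progressions run through `i` with the same difference, so if one of
them ended earlier on some side, the other would contradict its maximality there. `key` gives one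
inequality for each end, and symmetry the other. -/
theorem eq_of_mem {C' : Cluster} (hC' : IsCluster S w C') {i : ℕ} (h : i ∈ C.positions)
    (h' : i ∈ C'.positions) : C = C' := by
  have hp := per_pos w
  have key : ∀ {C C' : Cluster}, IsCluster S w C → IsCluster S w C' → i ∈ C.positions →
      i ∈ C'.positions → C.a ≤ C'.a ∧ C.b ≤ C'.b := by
    intro C C' hC hC' h h'
    obtain ⟨t, ht, hi⟩ := Cluster.mem_positions.1 h
    obtain ⟨u, hu, hi'⟩ := Cluster.mem_positions.1 h'
    rw [hC.diff] at hi
    rw [hC'.diff] at hi'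
    constructor
    · by_contra hlt
      have htu : t < u := by
        by_contra hc
        have : u * per w ≤ t * per w := Nat.mul_le_mul_right _ (by omega)
        omega
      refine hC.left_maximal (C'.a + (u - t - 1) * per w) ?_ (hC'.occurs_add (by omega))
      rw [hC.diff]
      obtain ⟨d, rfl⟩ := Nat.exists_eq_add_of_lt htu
      rw [show t + d + 1 - t - 1 = d by omega]
      nlinarith
    · by_contra hlt
      have e1 := hC.b_eq
      have e2 := hC'.b_eq
      refine hC'.right_maximal ?_
      have htu : C'.size - 1 - u < C.size - 1 - t := by
        by_contra hc
        have h1 : (C.size - 1 - t) * per w ≤ (C'.size - 1 - u) * per w :=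
          Nat.mul_le_mul_right _ (by omega)
        have h2 : (C.size - 1) * per w = t * per w + (C.size - 1 - t) * per w := by
          rw [← add_mul]; congr 1; omega
        have h3 : (C'.size - 1) * per w = u * per w + (C'.size - 1 - u) * per w := by
          rw [← add_mul]; congr 1; omega
        omega
      have : C'.b + C'.p = C.a + (t + (C'.size - 1 - u) + 1) * per w := by
        have h3 : (C'.size - 1) * per w = u * per w + (C'.size - 1 - u) * per w := by
          rw [← add_mul]; congr 1; omega
        rw [hC'.diff, add_mul, add_mul, one_mul]
        omega
      rw [this]
      exact hC.occurs_add (by omega)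
  have h1 := key hC hC' h h'
  have h2 := key hC' hC h' h
  have h3 := hC.diff.trans hC'.diff.symm
  cases C; cases C'
  simp only [Cluster.mk.injEq] at *
  omega

end IsCluster

theorem exists_leftmost_occurs (w : List α) (i : ℕ) (h : Occurs S w i) :
    ∃ a x, i = a + x * per w ∧ (∀ t ≤ x, Occurs S w (a + t * per w)) ∧
      ∀ j, j + per w = a → ¬ Occurs S w j := by
  induction i using Nat.strong_induction_on with
  | _ i ih =>
    by_cases hj : ∃ j, j + per w = i ∧ Occurs S w j
    · obtain ⟨j, hj, ho⟩ := hj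
      have hp := per_pos w
      obtain ⟨a, x, h1, h2, h3⟩ := ih j (by omega) ho
      refine ⟨a, x + 1, by rw [← hj, h1]; ring, ?_, h3⟩
      intro t ht
      rcases Nat.lt_or_ge x t with hxt | hxt
      · obtain rfl : t = x + 1 := by omega
        rwa [show a + (x + 1) * per w = i by rw [← hj, h1]; ring]
      · exact h2 t hxt
    · push Not at hj
      exact ⟨i, 0, by simp, by simpa using h, hj⟩

theorem exists_rightmost_occurs (hw : w ≠ []) (i : ℕ) (h : Occurs S w i) :
    ∃ y, (∀ t ≤ y, Occurs S w (i + t * per w)) ∧ ¬ Occurs S w (i + (y + 1) * per w) := by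
  classical
  have hp := per_pos w
  have hex : ∃ y, ¬ Occurs S w (i + (y + 1) * per w) := by
    refine ⟨S.length, fun hc => ?_⟩
    have := hc.add_length_le hw
    nlinarith
  refine ⟨Nat.find hex, fun t ht => ?_, Nat.find_spec hex⟩
  rcases t with _ | t
  · simpa using h
  · exact not_not.1 (Nat.find_min hex (m := t) (by omega))

/-- Walk from `i` to the left and to the right in steps of the period as long as `w` occurs. -/
theorem exists_isCluster (hw : w ≠ []) {i : ℕ} (h : Occurs S w i) :
    ∃ C, IsCluster S w C ∧ i ∈ C.positions := by
  obtain ⟨a, x, h1, h2, h3⟩ := exists_leftmost_occurs w i h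
  obtain ⟨y, h4, h5⟩ := exists_rightmost_occurs hw i h
  have hp := per_pos w
  let C : Cluster := ⟨a, i + y * per w, per w⟩
  have hb : C.b - C.a = (x + y) * per w := by
    simp only [C, h1, add_mul]; omega
  have hs : C.size = x + y + 1 := by
    rw [Cluster.size, hb, Nat.mul_div_cancel _ hp]
  refine ⟨C, ⟨rfl, ?_, ?_, ?_, h3, ?_⟩, ?_⟩
  · simp only [C, h1]; omega
  · rw [hb]; exact Dvd.intro_left _ rfl
  · intro j hj
    obtain ⟨t, ht, rfl⟩ := Cluster.mem_positions.1 hj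
    rcases Nat.le_total t x with hx | hx
    · exact h2 t hx
    · have := h4 (t - x) (by omega)
      rwa [h1, add_assoc, ← add_mul, Nat.add_sub_cancel' hx] at this
  · simpa only [C, add_mul, one_mul, add_assoc] using h5
  · exact Cluster.mem_positions.2 ⟨x, by omega, h1.symm⟩

end Strings

/-! ## The structure of the array of occurrences -/

section Structure

variable {α : Type*} [LinearOrder α] {S w : List α} {P Q : List Cluster} {C C' : Cluster}

theorem List.lt_append_of_lt {u v : List α} (x : List α) (h : u < v) : u < v ++ x := by
  induction u generalizing v with
  | nil =>
    cases v with
    | nil => exact absurd h (lt_irrefl _)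
    | cons b v => simp
  | cons a u ih =>
    cases v with
    | nil => simp at h
    | cons b v =>
      rw [List.cons_append, List.cons_lt_cons_iff]
      rcases List.cons_lt_cons_iff.1 h with h | ⟨h, h'⟩
      · exact Or.inl h
      · exact Or.inr ⟨h, ih h'⟩

/-- As `u` is not a prefix of `v`, the order is decided by two different letters at a common
position, and what follows `u` is irrelevant. This is where increasing clusters need right
maximality. -/
theorem List.append_lt_of_lt_of_not_prefix {u v : List α} (x : List α) (h : u < v)
    (hp : ¬ u <+: v) : u ++ x < v := by
  induction u generalizing v with
  | nil => exact absurd List.nil_prefix hp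
  | cons a u ih =>
    cases v with
    | nil => simp at h
    | cons b v =>
      rw [List.cons_append, List.cons_lt_cons_iff]
      rcases List.cons_lt_cons_iff.1 h with h | ⟨h, h'⟩
      · exact Or.inl h
      · exact Or.inr ⟨h, ih h' fun hc => hp (by rw [h]; exact List.cons_prefix_cons.2 ⟨rfl, hc⟩)⟩

omit [LinearOrder α] in
theorem flatten_replicate_of_lt (u x : List α) {r r' : ℕ} (h : r < r') :
    (List.replicate r' u).flatten ++ x =
      (List.replicate r u).flatten ++ (u ++ ((List.replicate (r' - r - 1) u).flatten ++ x)) := by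
  obtain ⟨d, rfl⟩ := Nat.exists_eq_add_of_lt h
  rw [show r + d + 1 - r - 1 = d by omega, add_assoc, List.replicate_add,
    List.replicate_succ, List.flatten_append]
  simp

section Compare

variable (hC : IsCluster S w C) (hC' : IsCluster S w C') (hw : w ≠ [])
include hC hC' hw

/-- Behind the common `w · w_s^r` the suffixes continue with the tail of `C` and with `w_s`. Only
`C` has to be decreasing; `C'` may be any cluster. -/
theorem drop_lt_drop_of_decreasing (hd : C.tail S w < perSuffix w) {r r' : ℕ}
    (hr : r < C.size) (hr' : r' < C'.size) (h : r < r') :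
    S.drop (C.b - r * per w) < S.drop (C'.b - r' * per w) := by
  rw [hC.drop_b_sub hw hr, hC'.drop_b_sub hw hr', flatten_replicate_of_lt _ _ h]
  exact List.append_left_lt (List.append_left_lt (List.lt_append_of_lt _ hd))

theorem drop_lt_drop_of_increasing (hi : perSuffix w < C.tail S w) {r r' : ℕ}
    (hr : r < C.size) (hr' : r' < C'.size) (h : r < r') :
    S.drop (C'.b - r' * per w) < S.drop (C.b - r * per w) := by
  rw [hC.drop_b_sub hw hr, hC'.drop_b_sub hw hr', flatten_replicate_of_lt _ _ h]
  exact List.append_left_lt (List.append_left_lt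
    (List.append_lt_of_lt_of_not_prefix _ hi (hC.not_perSuffix_prefix_tail hw)))

theorem drop_lt_drop_of_tail_lt (ht : C.tail S w < C'.tail S w) {r : ℕ}
    (hr : r < C.size) (hr' : r < C'.size) :
    S.drop (C.b - r * per w) < S.drop (C'.b - r * per w) := by
  rw [hC.drop_b_sub hw hr, hC'.drop_b_sub hw hr']
  exact List.append_left_lt (List.append_left_lt ht)

theorem drop_lt_drop_of_decreasing_of_increasing (hd : C.tail S w < perSuffix w)
    (hi : perSuffix w < C'.tail S w) {r r' : ℕ} (hr : r < C.size) (hr' : r' < C'.size) :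
    S.drop (C.b - r * per w) < S.drop (C'.b - r' * per w) := by
  rcases lt_trichotomy r r' with h | rfl | h
  · exact drop_lt_drop_of_decreasing hC hC' hw hd hr hr' h
  · exact drop_lt_drop_of_tail_lt hC hC' hw (hd.trans hi) hr hr'
  · exact drop_lt_drop_of_increasing hC' hC hw hi hr' hr h

end Compare

theorem IsCluster.tail_lt_or_lt (hC : IsCluster S w C) (hw : w ≠ []) :
    C.tail S w < perSuffix w ∨ perSuffix w < C.tail S w := by
  rcases lt_trichotomy (C.tail S w) (perSuffix w) with h | h | h
  · exact Or.inl h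
  · exact absurd (h ▸ List.prefix_rfl) (hC.not_perSuffix_prefix_tail hw)
  · exact Or.inr h

omit [LinearOrder α] in
-- The length of the tail determines `b`. Hence the order by tails is strict on clusters, which
-- makes the sorted list unique and the keys of the merge sort injective.
theorem IsCluster.eq_of_tail_eq (hC : IsCluster S w C) (hC' : IsCluster S w C') (hw : w ≠ [])
    (h : C.tail S w = C'.tail S w) : C = C' := by
  have h1 := hC.occurs_b.add_length_le hw
  have h2 := hC'.occurs_b.add_length_le hw
  have h3 := congrArg List.length h
  simp only [Cluster.tail, List.length_drop] at h3
  have e : C.b = C'.b := by omega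
  have m1 := hC.b_sub_mem C.size_pos
  have m2 := hC'.b_sub_mem C'.size_pos
  rw [zero_mul, Nat.sub_zero] at m1 m2
  exact hC.eq_of_mem hC' m1 (e ▸ m2)

/-- The clusters in `Q`, sorted by the lexicographic order of their tails. -/
noncomputable def tailSort (S w : List α) (Q : List Cluster) : List Cluster :=
  Q.mergeSort fun C C' => decide (C.tail S w ≤ C'.tail S w)

theorem tailSort_perm (S w : List α) (Q : List Cluster) : (tailSort S w Q).Perm Q :=
  List.mergeSort_perm _ _

theorem mem_tailSort : C ∈ tailSort S w Q ↔ C ∈ Q := (tailSort_perm S w Q).mem_iff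

theorem pairwise_tailSort (hw : w ≠ []) (hQ : ∀ C ∈ Q, IsCluster S w C) (hn : Q.Nodup) :
    (tailSort S w Q).Pairwise fun C C' => C.tail S w < C'.tail S w := by
  have h1 : (tailSort S w Q).Pairwise fun C C' => C.tail S w ≤ C'.tail S w := by
    have := List.pairwise_mergeSort
      (le := fun C C' : Cluster => decide (C.tail S w ≤ C'.tail S w))
      (fun a b c hab hbc => by simp only [decide_eq_true_eq] at *; exact le_trans hab hbc)
      (fun a b => by simpa using le_total _ _) Q
    simpa [tailSort] using this
  have h2 : (tailSort S w Q).Nodup := (tailSort_perm S w Q).nodup_iff.2 hn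
  refine (h1.and h2).imp_of_mem fun {a b} ha hb h => ?_
  exact lt_of_le_of_ne h.1 fun he =>
    h.2 ((hQ _ (mem_tailSort.1 ha)).eq_of_tail_eq (hQ _ (mem_tailSort.1 hb)) hw he)

theorem eq_tailSort (hw : w ≠ []) (hQ : ∀ C ∈ Q, IsCluster S w C) (hn : Q.Nodup)
    {l : List Cluster} (hl : l.Perm Q) (hs : l.Pairwise fun C C' => C.tail S w < C'.tail S w) :
    l = tailSort S w Q :=
  List.Perm.eq_of_pairwise (le := fun C C' => C.tail S w < C'.tail S w)
    (fun _ _ _ _ h h' => absurd h (lt_asymm h')) hs (pairwise_tailSort hw hQ hn)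
    (hl.trans (tailSort_perm S w Q).symm)

theorem tailSort_filter (hw : w ≠ []) (hQ : ∀ C ∈ Q, IsCluster S w C) (hn : Q.Nodup)
    (f : Cluster → Bool) : tailSort S w (Q.filter f) = (tailSort S w Q).filter f :=
  (eq_tailSort hw (fun C hC => hQ C (List.mem_filter.1 hC).1) (hn.filter _)
    ((tailSort_perm S w Q).filter f) ((pairwise_tailSort hw hQ hn).filter f)).symm

/-- Each cluster contributes at most one entry to `T_r`, so the `flatMap` collapses to a filter
followed by a map. -/
theorem rankArray_eq (hw : w ≠ []) (hQ : ∀ C ∈ Q, IsCluster S w C) (r : ℕ) :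
    rankArray S w Q r =
      ((tailSort S w Q).filter fun C => r < C.size).map fun C => C.b - r * per w := by
  have key : ∀ l : List Cluster, (∀ C ∈ l, IsCluster S w C) →
      (l.flatMap fun C => C.positions.filter fun i => periodRank S w i = r) =
        (l.filter fun C => r < C.size).map fun C => C.b - r * per w := by
    intro l hl
    induction l with
    | nil => rfl
    | cons C l ih =>
      rw [List.flatMap_cons, ih fun C hC => hl C (List.mem_cons_of_mem _ hC),
        (hl C List.mem_cons_self).positions_filter_rank hw]
      by_cases h : r < C.size <;> simp [h]
  exact key _ fun C hC => hQ C (mem_tailSort.1 hC)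

theorem mem_rankArray (hw : w ≠ []) (hQ : ∀ C ∈ Q, IsCluster S w C) {r i : ℕ} :
    i ∈ rankArray S w Q r ↔ ∃ C ∈ Q, r < C.size ∧ C.b - r * per w = i := by
  simp [rankArray_eq hw hQ, mem_tailSort, and_assoc]

theorem le_foldr_max {l : List ℕ} {x : ℕ} (h : x ∈ l) : x ≤ l.foldr max 0 := by
  induction l with
  | nil => simp at h
  | cons a l ih =>
    rcases List.mem_cons.1 h with rfl | h
    · simp
    · exact (ih h).trans (by simp)

omit [LinearOrder α] in
theorem le_maxRank (hw : w ≠ []) (hC : IsCluster S w C) (hCQ : C ∈ Q) {r : ℕ}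
    (hr : r < C.size) : r ≤ maxRank S w Q := by
  refine le_foldr_max (List.mem_map.2 ⟨C.b - r * per w, ?_, hC.rank_b_sub hw hr⟩)
  exact List.mem_flatMap.2 ⟨C, hCQ, hC.b_sub_mem hr⟩

theorem mem_flatMap_rankArray (hw : w ≠ []) (hQ : ∀ C ∈ Q, IsCluster S w C) {i : ℕ} :
    i ∈ (List.range (maxRank S w Q + 1)).flatMap (rankArray S w Q) ↔
      ∃ C ∈ Q, ∃ r < C.size, C.b - r * per w = i := by
  simp only [List.mem_flatMap, List.mem_range, mem_rankArray hw hQ]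
  constructor
  · rintro ⟨r, -, C, hC, hr, h⟩
    exact ⟨C, hC, r, hr, h⟩
  · rintro ⟨C, hC, r, hr, h⟩
    exact ⟨r, Nat.lt_succ_of_le (le_maxRank hw (hQ C hC) hC hr), C, hC, hr, h⟩

theorem pairwise_rankArray (hw : w ≠ []) (hQ : ∀ C ∈ Q, IsCluster S w C) (hn : Q.Nodup) (r : ℕ) :
    (rankArray S w Q r).Pairwise fun i j => S.drop i < S.drop j := by
  rw [rankArray_eq hw hQ, List.pairwise_map]
  refine ((pairwise_tailSort hw hQ hn).filter _).imp_of_mem fun {a b} ha hb h => ?_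
  simp only [List.mem_filter, mem_tailSort, decide_eq_true_eq] at ha hb
  exact drop_lt_drop_of_tail_lt (hQ _ ha.1) (hQ _ hb.1) hw h ha.2 hb.2

omit [LinearOrder α] in
theorem occurs_iff_exists_rank (hw : w ≠ []) (hP : IsPOR S w P) {i : ℕ} :
    Occurs S w i ↔ ∃ C ∈ P, ∃ r < C.size, C.b - r * per w = i := by
  constructor
  · intro h
    obtain ⟨C, hC, hi⟩ := exists_isCluster hw h
    obtain ⟨t, ht, rfl⟩ := Cluster.mem_positions.1 hi
    refine ⟨C, (hP.2 C).2 hC, C.size - 1 - t, by omega, ?_⟩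
    rw [hC.b_sub (by omega), hC.diff, show C.size - 1 - (C.size - 1 - t) = t by omega]
  · rintro ⟨C, hC, r, hr, rfl⟩
    exact ((hP.2 C).1 hC).occurs _ (((hP.2 C).1 hC).b_sub_mem hr)

theorem mem_incClusters : C ∈ incClusters S w P ↔ C ∈ P ∧ perSuffix w < C.tail S w := by
  simp [incClusters]

theorem mem_decClusters : C ∈ decClusters S w P ↔ C ∈ P ∧ C.tail S w < perSuffix w := by
  simp [decClusters]

theorem isPrefixOf_drop_iff {i : ℕ} : w.isPrefixOf (S.drop i) = true ↔ Occurs S w i :=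
  List.isPrefixOf_iff_prefix

theorem pairwise_sortedOcc (S w : List α) :
    (sortedOcc S w).Pairwise fun i j => S.drop i ≤ S.drop j := by
  have := List.pairwise_mergeSort
    (le := fun i j : ℕ => decide (S.drop i ≤ S.drop j))
    (fun a b c hab hbc => by simp only [decide_eq_true_eq] at *; exact le_trans hab hbc)
    (fun a b => by simpa using le_total _ _)
    ((List.range S.length).filter fun i => w.isPrefixOf (S.drop i))
  simpa [sortedOcc] using this

theorem mem_sortedOcc (hw : w ≠ []) {i : ℕ} : i ∈ sortedOcc S w ↔ Occurs S w i := by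
  rw [sortedOcc, List.mem_mergeSort, List.mem_filter, isPrefixOf_drop_iff, List.mem_range]
  refine ⟨fun h => h.2, fun h => ⟨?_, h⟩⟩
  have := h.add_length_le hw
  have := List.length_pos_iff.2 hw
  omega

/-- Both sides are sorted and have the same elements without repetition, and different positions
have suffixes of different lengths, so the sorted arrangement is unique. -/
theorem sortedOcc_eq (hw : w ≠ []) (hP : IsPOR S w P) :
    sortedOcc S w =
      ((List.range (maxRank S w (decClusters S w P) + 1)).flatMap
        fun r => rankArray S w (decClusters S w P) r) ++
      ((List.range (maxRank S w (incClusters S w P) + 1)).reverse.flatMap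
        fun r => rankArray S w (incClusters S w P) r) := by
  have hD : ∀ C ∈ decClusters S w P, IsCluster S w C :=
    fun C h => (hP.2 C).1 (mem_decClusters.1 h).1
  have hI : ∀ C ∈ incClusters S w P, IsCluster S w C :=
    fun C h => (hP.2 C).1 (mem_incClusters.1 h).1
  have hrev : ∀ i, i ∈ ((List.range (maxRank S w (incClusters S w P) + 1)).reverse.flatMap
        fun r => rankArray S w (incClusters S w P) r) ↔
      ∃ C ∈ incClusters S w P, ∃ r < C.size, C.b - r * per w = i := by
    intro i
    rw [← mem_flatMap_rankArray hw hI]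
    simp only [List.mem_flatMap, List.mem_reverse]
  have hpw : (((List.range (maxRank S w (decClusters S w P) + 1)).flatMap
        fun r => rankArray S w (decClusters S w P) r) ++
      ((List.range (maxRank S w (incClusters S w P) + 1)).reverse.flatMap
        fun r => rankArray S w (incClusters S w P) r)).Pairwise
          fun i j => S.drop i < S.drop j := by
    rw [List.pairwise_append, List.pairwise_flatMap, List.pairwise_flatMap, List.pairwise_reverse]
    refine ⟨⟨fun r _ => pairwise_rankArray hw hD (hP.1.filter _) r,
      List.pairwise_lt_range.imp ?_⟩, ⟨fun r _ => pairwise_rankArray hw hI (hP.1.filter _) r,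
      List.pairwise_lt_range.imp ?_⟩, ?_⟩
    · intro r r' h x hx y hy
      obtain ⟨C, hC, hr, rfl⟩ := (mem_rankArray hw hD).1 hx
      obtain ⟨C', hC', hr', rfl⟩ := (mem_rankArray hw hD).1 hy
      exact drop_lt_drop_of_decreasing (hD _ hC) (hD _ hC') hw (mem_decClusters.1 hC).2 hr hr' h
    · intro r r' h x hx y hy
      obtain ⟨C, hC, hr, rfl⟩ := (mem_rankArray hw hI).1 hx
      obtain ⟨C', hC', hr', rfl⟩ := (mem_rankArray hw hI).1 hy
      exact drop_lt_drop_of_increasing (hI _ hC') (hI _ hC) hw (mem_incClusters.1 hC').2 hr' hr h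
    · intro x hx y hy
      obtain ⟨C, hC, r, hr, rfl⟩ := (mem_flatMap_rankArray hw hD).1 hx
      obtain ⟨C', hC', r', hr', rfl⟩ := (hrev y).1 hy
      exact drop_lt_drop_of_decreasing_of_increasing (hD _ hC) (hI _ hC') hw
        (mem_decClusters.1 hC).2 (mem_incClusters.1 hC').2 hr hr'
  refine List.Perm.eq_of_pairwise (le := fun i j => S.drop i ≤ S.drop j) ?_
    (pairwise_sortedOcc S w) (hpw.imp le_of_lt) ?_
  · intro i j hi hj hij hji
    have h1 := congrArg List.length (le_antisymm hij hji)
    have h2 : i < S.length := by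
      have := ((mem_sortedOcc hw).1 hi).add_length_le hw
      have := List.length_pos_iff.2 hw
      omega
    have h3 : j < S.length := by
      by_contra hc
      simp only [List.length_drop] at h1
      omega
    simp only [List.length_drop] at h1
    omega
  · rw [List.perm_ext_iff_of_nodup]
    · intro i
      rw [mem_sortedOcc hw, occurs_iff_exists_rank hw hP, List.mem_append,
        hrev, mem_flatMap_rankArray hw hD]
      constructor
      · rintro ⟨C, hC, h⟩
        rcases ((hP.2 C).1 hC).tail_lt_or_lt hw with h' | h'
        · exact Or.inl ⟨C, mem_decClusters.2 ⟨hC, h'⟩, h⟩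
        · exact Or.inr ⟨C, mem_incClusters.2 ⟨hC, h'⟩, h⟩
      · rintro (⟨C, hC, h⟩ | ⟨C, hC, h⟩)
        · exact ⟨C, (mem_decClusters.1 hC).1, h⟩
        · exact ⟨C, (mem_incClusters.1 hC).1, h⟩
    · exact (List.mergeSort_perm _ _).nodup_iff.2 (List.nodup_range.filter _)
    · exact hpw.imp fun {a b} h => by rintro rfl; exact lt_irrefl _ h

end Structure

/-! ## Sorted dyadic blocks -/

section Blocks

/-- The indices below `m` in the `g`-th dyadic block of length `2 ^ l`. -/
def block (m l g : ℕ) : Finset ℕ := (Finset.range m).filter fun j => j / 2 ^ l = g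

/-- The position of the index `j` after each dyadic block of length `2 ^ l` has been sorted by
`key`. -/
def blockPos {K : Type*} [LinearOrder K] (key : ℕ → K) (m l j : ℕ) : ℕ :=
  j / 2 ^ l * 2 ^ l + ((block m l (j / 2 ^ l)).filter fun i => key i < key j).card

/-- From address `M` on, the memory `μ` holds the indices below `m`, where each dyadic block of
length `2 ^ l` has been sorted by `key`. -/
def SortedAt {K : Type*} [LinearOrder K] (key : ℕ → K) (m l : ℕ) (μ : ℕ → ℕ) (M : ℕ) : Prop :=
  ∀ j < m, μ (M + blockPos key m l j) = j

variable {m l g : ℕ}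

theorem mem_block_iff {j : ℕ} : j ∈ block m l g ↔ j < m ∧ j / 2 ^ l = g := by
  simp [block]

theorem div_two_pow_eq_iff {j : ℕ} :
    j / 2 ^ l = g ↔ g * 2 ^ l ≤ j ∧ j < g * 2 ^ l + 2 ^ l := by
  have h : 0 < 2 ^ l := by positivity
  rw [Nat.div_eq_iff h]
  omega

theorem block_eq_Ico : block m l g = Finset.Ico (min (g * 2 ^ l) m) (min (g * 2 ^ l + 2 ^ l) m) := by
  ext j
  rw [mem_block_iff, div_two_pow_eq_iff, Finset.mem_Ico]
  omega

theorem card_block : (block m l g).card = min (g * 2 ^ l + 2 ^ l) m - min (g * 2 ^ l) m := by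
  rw [block_eq_Ico, Nat.card_Ico]

theorem block_succ : block m (l + 1) g = block m l (2 * g) ∪ block m l (2 * g + 1) := by
  ext j
  simp only [mem_block_iff, Finset.mem_union, pow_succ, ← Nat.div_div_eq_div_mul]
  omega

theorem disjoint_block {g' : ℕ} (h : g ≠ g') : Disjoint (block m l g) (block m l g') := by
  rw [Finset.disjoint_left]
  intro j h1 h2
  rw [mem_block_iff] at h1 h2
  exact h (h1.2.symm.trans h2.2)

theorem card_filter_block_succ (p : ℕ → Prop) [DecidablePred p] :
    ((block m (l + 1) g).filter p).card =
      ((block m l (2 * g)).filter p).card + ((block m l (2 * g + 1)).filter p).card := by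
  rw [block_succ, Finset.filter_union, Finset.card_union_of_disjoint]
  exact Finset.disjoint_filter_filter (disjoint_block (by omega))

theorem block_zero {j : ℕ} (hj : j < m) : block m 0 j = {j} := by
  ext i
  simp only [mem_block_iff, pow_zero, Nat.div_one, Finset.mem_singleton]
  omega

theorem block_zero_eq_range (h : m ≤ 2 ^ l) : block m l 0 = Finset.range m := by
  rw [block_eq_Ico]
  ext j
  simp only [Finset.mem_Ico, Finset.mem_range]
  omega

variable {K : Type*} [LinearOrder K] {key : ℕ → K}

theorem blockPos_zero {j : ℕ} (hj : j < m) : blockPos key m 0 j = j := by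
  simp [blockPos, block_zero hj, Finset.filter_singleton]

theorem blockPos_bounds {j : ℕ} (hj : j < m) :
    j / 2 ^ l * 2 ^ l ≤ blockPos key m l j ∧
      blockPos key m l j < j / 2 ^ l * 2 ^ l + 2 ^ l ∧ blockPos key m l j < m := by
  have h1 := (div_two_pow_eq_iff (l := l) (j := j)).1 rfl
  have h2 : ((block m l (j / 2 ^ l)).filter fun i => key i < key j).card <
      (block m l (j / 2 ^ l)).card := by
    apply Finset.card_lt_card
    refine Finset.filter_ssubset.2 ⟨j, mem_block_iff.2 ⟨hj, rfl⟩, lt_irrefl _⟩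
  rw [card_block] at h2
  unfold blockPos
  omega

theorem blockPos_div {j : ℕ} (hj : j < m) : blockPos key m l j / 2 ^ l = j / 2 ^ l :=
  div_two_pow_eq_iff.2
    ⟨(blockPos_bounds hj).1, (blockPos_bounds hj).2.1⟩

/-- A property inherited by smaller keys holds on an initial segment of each sorted block. If `p j`
holds, the items below `j` form a proper subset of those with `p`, because `j` is missing; otherwise
all items with `p` are below `j`. -/
theorem blockPos_lt_iff (hk : Set.InjOn key (Set.Iio m)) {p : ℕ → Prop} [DecidablePred p]
    (hp : ∀ i < m, ∀ j < m, key i < key j → p j → p i) {j : ℕ} (hj : j < m) :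
    blockPos key m l j < j / 2 ^ l * 2 ^ l + ((block m l (j / 2 ^ l)).filter p).card ↔ p j := by
  unfold blockPos
  rw [Nat.add_lt_add_iff_left]
  constructor
  · intro h
    by_contra hc
    refine absurd h (not_lt.2 (Finset.card_le_card fun i hi => ?_))
    rw [Finset.mem_filter, mem_block_iff] at *
    refine ⟨hi.1, ?_⟩
    rcases lt_trichotomy (key i) (key j) with h' | h' | h'
    · exact h'
    · exact absurd (hk hi.1.1 hj h' ▸ hi.2) hc
    · exact absurd (hp j hj i hi.1.1 h' hi.2) hc
  · intro h
    apply Finset.card_lt_card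
    rw [Finset.ssubset_iff_of_subset]
    · exact ⟨j, Finset.mem_filter.2 ⟨mem_block_iff.2 ⟨hj, rfl⟩, h⟩, by simp⟩
    · intro i hi
      rw [Finset.mem_filter, mem_block_iff] at *
      exact ⟨hi.1, hp i hi.1.1 j hj hi.2 h⟩

theorem blockPos_inj (hk : Set.InjOn key (Set.Iio m)) {i j : ℕ} (hi : i < m) (hj : j < m)
    (h : blockPos key m l i = blockPos key m l j) : i = j := by
  have hd : i / 2 ^ l = j / 2 ^ l := by
    rw [← blockPos_div (key := key) hi, ← blockPos_div (key := key) hj, h]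
  have key' : ∀ {i j : ℕ}, i < m → j < m → i / 2 ^ l = j / 2 ^ l → key i < key j →
      blockPos key m l i < blockPos key m l j := by
    intro i j hi hj hd h
    have := (blockPos_lt_iff (l := l) hk (p := fun x => key x < key j)
      (fun a _ b _ hab hb => hab.trans hb) hi).2 h
    rwa [hd] at this
  rcases lt_trichotomy (key i) (key j) with h' | h' | h'
  · exact absurd h (key' hi hj hd h').ne
  · exact hk hi hj h'
  · exact absurd h (key' hj hi hd.symm h').ne'

/-- An injection of a finite set into itself is surjective. -/
theorem exists_blockPos_eq (hk : Set.InjOn key (Set.Iio m)) {x : ℕ} (hx : x < m) :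
    ∃ j < m, blockPos key m l j = x := by
  have := Finset.surj_on_of_inj_on_of_card_le (s := Finset.range m) (t := Finset.range m)
    (fun j _ => blockPos key m l j)
    (fun j hj => Finset.mem_range.2 (blockPos_bounds (Finset.mem_range.1 hj)).2.2)
    (fun i j hi hj h => blockPos_inj hk (Finset.mem_range.1 hi) (Finset.mem_range.1 hj) h)
    le_rfl x (Finset.mem_range.2 hx)
  obtain ⟨j, hj, h⟩ := this
  exact ⟨j, Finset.mem_range.1 hj, h.symm⟩

/-- When two sibling blocks are merged, an item of the left one moves up by the number of smaller
items in the right one. Its new place does not depend on the moves of other items, so no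
simultaneous scan of the two blocks is needed. -/
theorem blockPos_succ_even {j : ℕ} (h : j / 2 ^ l % 2 = 0) :
    blockPos key m (l + 1) j = blockPos key m l j +
      ((block m l (j / 2 ^ l + 1)).filter fun i => key i < key j).card := by
  have e : j / 2 ^ (l + 1) = j / 2 ^ l / 2 := by rw [pow_succ, Nat.div_div_eq_div_mul]
  unfold blockPos
  rw [e, card_filter_block_succ, show 2 * (j / 2 ^ l / 2) = j / 2 ^ l by omega]
  rw [pow_succ, ← mul_assoc, mul_right_comm, show j / 2 ^ l / 2 * 2 = j / 2 ^ l by omega]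
  omega

theorem blockPos_succ_odd {j : ℕ} (h : j / 2 ^ l % 2 = 1) :
    blockPos key m (l + 1) j + 2 ^ l = blockPos key m l j +
      ((block m l (j / 2 ^ l - 1)).filter fun i => key i < key j).card := by
  have e : j / 2 ^ (l + 1) = j / 2 ^ l / 2 := by rw [pow_succ, Nat.div_div_eq_div_mul]
  unfold blockPos
  obtain ⟨q, hq⟩ : ∃ q, j / 2 ^ l = 2 * q + 1 := ⟨j / 2 ^ l / 2, by omega⟩
  rw [e, card_filter_block_succ, hq, show (2 * q + 1) / 2 = q by omega, Nat.add_sub_cancel]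
  ring

/-- Binary search for the first failure of `p` in a block therefore counts the items with `p`. The
minima with `m` account for an incomplete last block. -/
theorem SortedAt.search {μ : ℕ → ℕ} {M : ℕ} (hs : SortedAt key m l μ M)
    (hk : Set.InjOn key (Set.Iio m)) {p : ℕ → Prop} [DecidablePred p]
    (hp : ∀ i < m, ∀ j < m, key i < key j → p j → p i) {x : ℕ}
    (h1 : min (g * 2 ^ l) m ≤ x) (h2 : x < min (g * 2 ^ l + 2 ^ l) m) :
    μ (M + x) < m ∧
      (p (μ (M + x)) ↔ x < min (g * 2 ^ l) m + ((block m l g).filter p).card) := by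
  obtain ⟨j, hj, rfl⟩ := exists_blockPos_eq (l := l) hk (x := x) (by omega)
  rw [hs j hj, ← blockPos_lt_iff (l := l) hk hp hj]
  have h3 : j / 2 ^ l = g := by
    rw [← blockPos_div (key := key) hj]
    exact div_two_pow_eq_iff.2 (by omega)
  rw [h3, show min (g * 2 ^ l) m = g * 2 ^ l by omega]
  exact ⟨hj, Iff.rfl⟩

theorem SortedAt.apply {μ : ℕ → ℕ} {M : ℕ} (hs : SortedAt key m l μ M)
    (hk : Set.InjOn key (Set.Iio m)) {x : ℕ} (hx : x < m) :
    μ (M + x) < m ∧ blockPos key m l (μ (M + x)) = x := by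
  obtain ⟨j, hj, rfl⟩ := exists_blockPos_eq (l := l) hk hx
  rw [hs j hj]
  exact ⟨hj, rfl⟩

theorem SortedAt.congr {μ μ' : ℕ → ℕ} {M : ℕ} (hs : SortedAt key m l μ M)
    (h : ∀ x < m, μ' (M + x) = μ (M + x)) : SortedAt key m l μ' M := fun j hj => by
  rw [h _ (blockPos_bounds hj).2.2, hs j hj]

theorem card_filter_block_le (p : ℕ → Prop) [DecidablePred p] :
    min (g * 2 ^ l) m + ((block m l g).filter p).card ≤ min (g * 2 ^ l + 2 ^ l) m := by
  have := Finset.card_filter_le (block m l g) p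
  rw [card_block] at this
  have : 0 < 2 ^ l := by positivity
  omega

/-! ## Counting by rank -/

/-- The number of indices below `m` whose value exceeds `r`. -/
def countGt (f : ℕ → ℕ) (m r : ℕ) : ℕ := ((Finset.range m).filter fun j => r < f j).card

/-- The number of pairs of an index `j < m` and a number below both `f j` and `r`. -/
def rankSum (f : ℕ → ℕ) (m r : ℕ) : ℕ := ∑ j ∈ Finset.range m, min (f j) r

/-- Indices are compared by their values; ties are broken by the indices themselves. -/
def valueKey (f : ℕ → ℕ) (j : ℕ) : ℕ ×ₗ ℕ := toLex (f j, j)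

theorem valueKey_injOn (f : ℕ → ℕ) (s : Set ℕ) : Set.InjOn (valueKey f) s := by
  intro i _ j _ h
  have := congrArg ofLex h
  simp only [valueKey, ofLex_toLex, Prod.mk.injEq] at this
  exact this.2

theorem valueKey_lt_iff {f : ℕ → ℕ} {i j : ℕ} :
    valueKey f i < valueKey f j ↔ f i < f j ∨ f i = f j ∧ i < j := by
  simp [valueKey, Prod.Lex.toLex_lt_toLex]

theorem rankSum_zero (f : ℕ → ℕ) (m : ℕ) : rankSum f m 0 = 0 := by simp [rankSum]

/-- Raising `r` by one raises `min (f j) r` exactly when `r < f j`. Hence `rankSum` is the partial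
sum of the lengths of the arrays `T_0, T_1, …`. -/
theorem rankSum_succ (f : ℕ → ℕ) (m r : ℕ) :
    rankSum f m (r + 1) = rankSum f m r + countGt f m r := by
  rw [rankSum, rankSum, countGt, Finset.card_filter, ← Finset.sum_add_distrib]
  refine Finset.sum_congr rfl fun j _ => ?_
  split_ifs <;> omega

theorem rankSum_mono (f : ℕ → ℕ) (m : ℕ) : Monotone (rankSum f m) :=
  monotone_nat_of_le_succ fun r => by rw [rankSum_succ]; omega

theorem rankSum_of_le {f : ℕ → ℕ} {m r : ℕ} (h : ∀ j < m, f j ≤ r) :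
    rankSum f m r = ∑ j ∈ Finset.range m, f j :=
  Finset.sum_congr rfl fun j hj => min_eq_left (h j (Finset.mem_range.1 hj))

theorem rankSum_eq_sum_range (f : ℕ → ℕ) (m r : ℕ) :
    rankSum f m r = ∑ x ∈ Finset.range r, countGt f m x := by
  induction r with
  | zero => simp [rankSum_zero]
  | succ r ih => rw [rankSum_succ, ih, Finset.sum_range_succ]

theorem SortedAt.sum_eq {μ : ℕ → ℕ} {M : ℕ} (hs : SortedAt key m l μ M)
    (hk : Set.InjOn key (Set.Iio m)) (f : ℕ → ℕ) :
    ∑ x ∈ Finset.range m, f (μ (M + x)) = ∑ j ∈ Finset.range m, f j := by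
  refine (Finset.sum_nbij (fun j => blockPos key m l j) ?_ ?_ ?_ ?_).symm
  · intro j hj
    exact Finset.mem_range.2 (blockPos_bounds (Finset.mem_range.1 hj)).2.2
  · intro i hi j hj h
    exact blockPos_inj hk (by simpa using hi) (by simpa using hj) h
  · intro x hx
    obtain ⟨j, hj, h⟩ := exists_blockPos_eq (l := l) hk (x := x) (by simpa using hx)
    exact ⟨j, by simpa using hj, h⟩
  · intro j hj
    rw [hs j (Finset.mem_range.1 hj)]

/-- Values up to `r` contribute themselves, and they are the first `c` entries of the sorted array;
each of the other values contributes `r`. With prefix sums, one binary search for `c` evaluates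
`rankSum`. -/
theorem SortedAt.rankSum_eq {f : ℕ → ℕ} {μ : ℕ → ℕ} {M : ℕ}
    (hs : SortedAt (valueKey f) m l μ M) (hm : m ≤ 2 ^ l) (r : ℕ) :
    (∑ x ∈ Finset.range ((Finset.range m).filter fun j => f j ≤ r).card, f (μ (M + x))) +
      (m - ((Finset.range m).filter fun j => f j ≤ r).card) * r = rankSum f m r := by
  have hk := valueKey_injOn f (Set.Iio m)
  set c := ((Finset.range m).filter fun j => f j ≤ r).card with hc
  have hcm : c ≤ m := (Finset.card_filter_le _ _).trans (by simp)
  have key : ∀ x < m, f (μ (M + x)) ≤ r ↔ x < c := by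
    intro x hx
    have := (hs.search hk (g := 0) (p := fun j => f j ≤ r) (x := x)
      (fun i _ j _ h h' => by rw [valueKey_lt_iff] at h; omega) (by omega) (by omega)).2
    rw [this, block_zero_eq_range hm, hc]
    simp
  rw [rankSum, ← hs.sum_eq hk (fun j => min (f j) r),
    ← Finset.sum_range_add_sum_Ico _ hcm]
  congr 1
  · refine Finset.sum_congr rfl fun x hx => ?_
    rw [Finset.mem_range] at hx
    exact (min_eq_left ((key x (by omega)).2 hx)).symm
  · rw [Finset.sum_congr rfl (g := fun _ => r)]
    · simp
    · intro x hx
      rw [Finset.mem_Ico] at hx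
      have := (key x hx.2).not.2 (by omega)
      omega

/-- The rank is characterized by a test that is monotone in `x`, as binary search requires. -/
theorem exists_rank {f : ℕ → ℕ} {m n i : ℕ} (h : ∀ j < m, f j ≤ n)
    (hi : i < ∑ j ∈ Finset.range m, f j) :
    ∃ r < n, ∀ x, rankSum f m (x + 1) ≤ i ↔ x < r := by
  have hex : ∃ r, i < rankSum f m (r + 1) := by
    refine ⟨n, ?_⟩
    rw [rankSum_of_le fun j hj => (h j hj).trans (Nat.le_succ n)]
    exact hi
  refine ⟨Nat.find hex, ?_, fun x => ?_⟩
  · rcases n with _ | n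
    · have : ∑ j ∈ Finset.range m, f j = 0 :=
        Finset.sum_eq_zero fun j hj => Nat.le_zero.1 (h j (Finset.mem_range.1 hj))
      omega
    · refine Nat.lt_succ_of_le (Nat.find_min' hex ?_)
      rwa [rankSum_of_le h]
  · constructor
    · intro hx
      by_contra hc
      have := Nat.find_spec hex
      have := rankSum_mono f m (show Nat.find hex + 1 ≤ x + 1 by omega)
      omega
    · intro hx
      have := Nat.find_min hex hx
      omega

end Blocks

/-! ## Total correctness with running times -/

section WP

variable {α : Type*} [LinearOrder α]

/-- Started in `σ`, the program `c` halts in a state and after a time that satisfy `Q`. -/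
def WP (S : List α) (B L : ℕ) (c : Cmd) (σ : State) (Q : State → ℕ → Prop) : Prop :=
  ∃ σ' t, Exec S B L c σ σ' t ∧ Q σ' t

@[simp] theorem State.setReg_reg (σ : State) (x v y : ℕ) :
    (σ.setReg x v).reg y = if y = x then v else σ.reg y := by
  simp [State.setReg, Function.update_apply]

@[simp] theorem State.setReg_mem (σ : State) (x v : ℕ) : (σ.setReg x v).mem = σ.mem := rfl

@[simp] theorem State.setMem_reg (σ : State) (x v : ℕ) : (σ.setMem x v).reg = σ.reg := rfl

@[simp] theorem State.setMem_mem (σ : State) (x v : ℕ) :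
    (σ.setMem x v).mem = Function.update σ.mem x v := rfl

variable {S : List α} {B L : ℕ} {σ : State} {Q Q' : State → ℕ → Prop} {c d : Cmd}

theorem WP.mono (h : WP S B L c σ Q) (hQ : ∀ σ' t, Q σ' t → Q' σ' t) : WP S B L c σ Q' := by
  obtain ⟨σ', t, h1, h2⟩ := h
  exact ⟨σ', t, h1, hQ _ _ h2⟩

@[simp] theorem wp_skip : WP S B L .skip σ Q ↔ Q σ 1 :=
  ⟨fun ⟨_, _, h, hQ⟩ => by cases h; exact hQ, fun h => ⟨_, _, .skip σ, h⟩⟩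

@[simp] theorem wp_const {x v : ℕ} : WP S B L (.const x v) σ Q ↔ v < B ∧ Q (σ.setReg x v) 1 :=
  ⟨fun ⟨_, _, h, hQ⟩ => by cases h; exact ⟨‹_›, hQ⟩, fun h => ⟨_, _, .const σ x v h.1, h.2⟩⟩

@[simp] theorem wp_op {o : BinOp} {x y z : ℕ} : WP S B L (.op o x y z) σ Q ↔
    o.eval (σ.reg y) (σ.reg z) < B ∧ Q (σ.setReg x (o.eval (σ.reg y) (σ.reg z))) 1 :=
  ⟨fun ⟨_, _, h, hQ⟩ => by cases h; exact ⟨‹_›, hQ⟩, fun h => ⟨_, _, .op σ o x y z h.1, h.2⟩⟩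

@[simp] theorem wp_load {x y : ℕ} :
    WP S B L (.load x y) σ Q ↔ Q (σ.setReg x (σ.mem (σ.reg y))) 1 :=
  ⟨fun ⟨_, _, h, hQ⟩ => by cases h; exact hQ, fun h => ⟨_, _, .load σ x y, h⟩⟩

@[simp] theorem wp_store {x y : ℕ} :
    WP S B L (.store x y) σ Q ↔ Q (σ.setMem (σ.reg x) (σ.reg y)) 1 :=
  ⟨fun ⟨_, _, h, hQ⟩ => by cases h; exact hQ, fun h => ⟨_, _, .store σ x y, h⟩⟩

@[simp] theorem wp_lcp {x y z : ℕ} : WP S B L (.lcp x y z) σ Q ↔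
    Q (σ.setReg x (lcpLen (S.drop (σ.reg y)) (S.drop (σ.reg z)))) L :=
  ⟨fun ⟨_, _, h, hQ⟩ => by cases h; exact hQ, fun h => ⟨_, _, .lcp σ x y z, h⟩⟩

@[simp] theorem wp_symLt {x y z : ℕ} : WP S B L (.symLt x y z) σ Q ↔
    Q (σ.setReg x (symLtVal S (σ.reg y) (σ.reg z))) L :=
  ⟨fun ⟨_, _, h, hQ⟩ => by cases h; exact hQ, fun h => ⟨_, _, .symLt σ x y z, h⟩⟩

@[simp] theorem wp_seq : WP S B L (.seq c d) σ Q ↔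
    WP S B L c σ fun σ' t => WP S B L d σ' fun σ'' t' => Q σ'' (t + t') := by
  constructor
  · rintro ⟨_, _, h, hQ⟩
    cases h with
    | seq h1 h2 => exact ⟨_, _, h1, _, _, h2, hQ⟩
  · rintro ⟨_, _, h1, _, _, h2, hQ⟩
    exact ⟨_, _, h1.seq h2, hQ⟩

@[simp] theorem wp_ite {x : ℕ} : WP S B L (.ite x c d) σ Q ↔
    (σ.reg x ≠ 0 → WP S B L c σ fun σ' t => Q σ' (t + 1)) ∧
      (σ.reg x = 0 → WP S B L d σ fun σ' t => Q σ' (t + 1)) := by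
  constructor
  · rintro ⟨_, _, h, hQ⟩
    cases h with
    | ite_true hx h => exact ⟨fun _ => ⟨_, _, h, hQ⟩, fun h0 => absurd h0 hx⟩
    | ite_false hx h => exact ⟨fun h0 => absurd hx h0, fun _ => ⟨_, _, h, hQ⟩⟩
  · rintro ⟨h1, h2⟩
    by_cases hx : σ.reg x = 0
    · obtain ⟨_, _, h, hQ⟩ := h2 hx
      exact ⟨_, _, .ite_false hx h, hQ⟩
    · obtain ⟨_, _, h, hQ⟩ := h1 hx
      exact ⟨_, _, .ite_true hx h, hQ⟩

/-- Execute the program `c` as often as register `x` tells, counting `x` down; `y` is a scratch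
register. -/
def Cmd.down (x y : ℕ) (c : Cmd) : Cmd :=
  .loop x (.seq (.const y 1) (.seq (.op .sub x x y) c))

/-- The invariant is indexed by the number of rounds still to be done. Besides the body, a round
costs the test, the constant and the subtraction, hence `T + 3`; the last failing test costs `1`. -/
theorem wp_down {x y N T : ℕ} {c : Cmd} (I : ℕ → State → Prop) (hB : 1 < B) (hN : N < B)
    (hxy : x ≠ y) (hx : σ.reg x = N) (h0 : I N σ)
    (hstep : ∀ k < N, ∀ σ : State, σ.reg x = k + 1 → I (k + 1) σ →
      WP S B L c ((σ.setReg y 1).setReg x k) fun σ' t => t ≤ T ∧ σ'.reg x = k ∧ I k σ') :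
    WP S B L (.down x y c) σ fun σ' t => t ≤ N * (T + 3) + 1 ∧ σ'.reg x = 0 ∧ I 0 σ' := by
  induction N generalizing σ with
  | zero => exact ⟨σ, 1, .loop_done hx, by omega, hx, h0⟩
  | succ N ih =>
    obtain ⟨σ₁, t₁, h1, ht₁, hx₁, hI₁⟩ := hstep N (Nat.lt_succ_self N) σ hx h0
    obtain ⟨σ₂, t₂, h2, ht₂, hx₂, hI₂⟩ := ih (by omega) hx₁ hI₁
      fun k hk σ hσ hI => hstep k (by omega) σ hσ hI
    have e : BinOp.sub.eval ((σ.setReg y 1).reg x) ((σ.setReg y 1).reg y) = N := by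
      simp [BinOp.eval, hxy, hx]
    refine ⟨σ₂, 1 + (1 + t₁) + t₂ + 1, .loop_step (by omega) (.seq (.const σ y 1 hB)
      (.seq (.op _ .sub x x y (by omega)) (by rw [e]; exact h1))) h2, ?_, hx₂, hI₂⟩
    rw [Nat.succ_mul]
    omega

theorem WP.seq {Q₁ : State → ℕ → Prop} (h : WP S B L c σ Q₁)
    (h' : ∀ σ' t, Q₁ σ' t → WP S B L d σ' fun σ'' t' => Q σ'' (t + t')) :
    WP S B L (.seq c d) σ Q :=
  wp_seq.2 (h.mono h')

/-- The registers below `K` have the same contents in both states. -/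
def Agree (K : ℕ) (σ σ' : State) : Prop := ∀ x < K, σ'.reg x = σ.reg x

@[simp] theorem Agree.refl (K : ℕ) (σ : State) : Agree K σ σ := fun _ _ => rfl

theorem Agree.trans {K : ℕ} {σ σ' σ'' : State} (h : Agree K σ σ') (h' : Agree K σ' σ'') :
    Agree K σ σ'' := fun x hx => (h' x hx).trans (h x hx)

theorem Agree.mono {K K' : ℕ} {σ σ' : State} (h : Agree K σ σ') (hK : K' ≤ K) : Agree K' σ σ' :=
  fun x hx => h x (hx.trans_le hK)

@[simp] theorem agree_setReg_right {K x v : ℕ} {σ σ' : State} (h : K ≤ x) :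
    Agree K σ (σ'.setReg x v) ↔ Agree K σ σ' := by
  refine forall₂_congr fun y hy => ?_
  rw [State.setReg_reg, if_neg (by omega)]

@[simp] theorem agree_setReg_left {K x v : ℕ} {σ σ' : State} (h : K ≤ x) :
    Agree K (σ.setReg x v) σ' ↔ Agree K σ σ' := by
  refine forall₂_congr fun y hy => ?_
  rw [State.setReg_reg, if_neg (by omega)]

@[simp] theorem agree_setMem_right {K x v : ℕ} {σ σ' : State} :
    Agree K σ (σ'.setMem x v) ↔ Agree K σ σ' := Iff.rfl

/-- The memories agree outside the addresses from `a` to `b - 1`. -/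
def EqOff (a b : ℕ) (μ μ' : ℕ → ℕ) : Prop := ∀ x, x < a ∨ b ≤ x → μ' x = μ x

theorem EqOff.refl (a b : ℕ) (μ : ℕ → ℕ) : EqOff a b μ μ := fun _ _ => rfl

theorem EqOff.trans {a b : ℕ} {μ μ' μ'' : ℕ → ℕ} (h : EqOff a b μ μ') (h' : EqOff a b μ' μ'') :
    EqOff a b μ μ'' := fun x hx => (h' x hx).trans (h x hx)

theorem EqOff.mono {a b a' b' : ℕ} {μ μ' : ℕ → ℕ} (h : EqOff a b μ μ') (ha : a' ≤ a)
    (hb : b ≤ b') : EqOff a' b' μ μ' := fun x hx => h x (by omega)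

theorem EqOff.update {a b x v : ℕ} {μ μ' : ℕ → ℕ} (h : EqOff a b μ μ') (ha : a ≤ x)
    (hb : x < b) : EqOff a b μ (Function.update μ' x v) := fun y hy => by
  rw [Function.update_of_ne (by omega), h y hy]

theorem ite_one_zero_lt {p : Prop} [Decidable p] {B : ℕ} (h : 1 < B) :
    (if p then 1 else 0) < B := by
  split_ifs <;> omega

end WP

infixr:60 " ;; " => Cmd.seq

/-! ### Binary search -/

section BinarySearch

/-- Binary search between the contents of the registers `K` and `K + 1`. The program `test` decides
whether the result exceeds the number in register `K + 3` and puts its answer into register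
`K + 6`. Register `12` bounds the number of rounds, and the result is left in register `K`. -/
def Cmd.bsearch (K : ℕ) (test : Cmd) : Cmd :=
  .const (K + 4) 0 ;; .op .add (K + 2) 12 (K + 4) ;;
  .down (K + 2) (K + 5) (
    .op .lt (K + 4) K (K + 1) ;;
    .ite (K + 4)
      (.op .add (K + 3) K (K + 1) ;; .const (K + 5) 2 ;; .op .div (K + 3) (K + 3) (K + 5) ;;
        test ;;
        .ite (K + 6) (.const (K + 5) 1 ;; .op .add K (K + 3) (K + 5))
          (.const (K + 5) 0 ;; .op .add (K + 1) (K + 3) (K + 5)))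
      .skip)

variable {α : Type*} [LinearOrder α] {S : List α} {B L : ℕ} {σ : State}

/-- With `k` rounds left, `c` lies between the two ends and these differ by less than `2 ^ k`. The
number of rounds is fixed by register `12`; once the ends meet, the remaining rounds are idle. -/
theorem wp_bsearch {K : ℕ} {test : Cmd} {T c : ℕ} (hK : 20 ≤ K) (h1 : σ.reg K ≤ c)
    (h2 : c ≤ σ.reg (K + 1)) (h3 : σ.reg (K + 1) < σ.reg K + 2 ^ σ.reg 12)
    (hB : 2 * σ.reg (K + 1) + 2 < B) (hB' : σ.reg 12 < B)
    (htest : ∀ σ' : State, σ'.mem = σ.mem → Agree K σ σ' → σ.reg K ≤ σ'.reg (K + 3) →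
      σ'.reg (K + 3) < σ.reg (K + 1) → WP S B L test σ' fun σ'' t =>
        t ≤ T ∧ σ''.mem = σ.mem ∧ Agree (K + 6) σ' σ'' ∧
          (σ''.reg (K + 6) ≠ 0 ↔ σ'.reg (K + 3) < c)) :
    WP S B L (.bsearch K test) σ fun σ' t =>
      t ≤ σ.reg 12 * (T + 15) + 5 ∧ σ'.mem = σ.mem ∧ Agree K σ σ' ∧ σ'.reg K = c := by
  obtain ⟨K, rfl⟩ := Nat.exists_eq_add_of_le' hK
  rw [Cmd.bsearch]
  simp only [Nat.add_assoc, Nat.reduceAdd] at *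
  simp only [wp_seq, wp_const, wp_op, BinOp.eval]
  refine ⟨by omega, by simpa using hB', ?_⟩
  refine (wp_down (N := σ.reg 12) (T := T + 12) (fun k σ' => σ'.mem = σ.mem ∧
      Agree (K + 20) σ σ' ∧ σ.reg (K + 20) ≤ σ'.reg (K + 20) ∧ σ'.reg (K + 20) ≤ c ∧
      c ≤ σ'.reg (K + 21) ∧ σ'.reg (K + 21) ≤ σ.reg (K + 21) ∧
      σ'.reg (K + 21) < σ'.reg (K + 20) + 2 ^ k)
    (by omega) hB' (by simp) (by simp) ?_ ?_).mono ?_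
  · simp only [State.setReg_mem, State.setReg_reg, true_and]
    refine ⟨?_, ?_⟩
    · rw [agree_setReg_right (by omega), agree_setReg_right (by omega)]
      exact Agree.refl _ _
    · simp
      omega
  · rintro k hk σ' hk' ⟨i1, i2, i3, i4, i5, i6, i7⟩
    have hpow : 2 ^ (k + 1) = 2 * 2 ^ k := by ring
    simp only [wp_seq, wp_const, wp_op, wp_ite, wp_skip, BinOp.eval]
    simp
    refine ⟨by split_ifs <;> omega, ?_, ?_⟩
    · intro hlt
      refine ⟨by omega, by omega, by omega, ?_⟩
      refine (htest _ ?_ ?_ ?_ ?_).mono ?_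
      · simpa using i1
      · simpa [agree_setReg_right] using i2
      · simp; omega
      · simp; omega
      · rintro σ'' t ⟨j1, j2, j3, j4⟩
        have a0 := j3 (K + 20) (by omega)
        have a1 := j3 (K + 21) (by omega)
        have a2 := j3 (K + 22) (by omega)
        have a3 := j3 (K + 23) (by omega)
        have a4 : Agree (K + 20) σ σ'' :=
          i2.trans (by simpa [agree_setReg_left] using j3.mono (by omega : K + 20 ≤ K + 20 + 6))
        simp at a0 a1 a2 a3 j4
        simp only [a0, a1, a2, a3, j2]
        constructor
        · intro h
          have := j4.1 h
          refine ⟨by omega, by omega, by omega, by simp, trivial, ?_, ?_⟩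
          · simpa [agree_setReg_right] using a4
          · omega
        · intro h
          have := j4.not.1 (by simpa using h)
          refine ⟨by omega, by omega, by omega, by simp, trivial, ?_, ?_⟩
          · simpa [agree_setReg_right] using a4
          · omega
    · intro hge
      refine ⟨i1, ?_, ?_⟩
      · simpa [agree_setReg_right] using i2
      · have := Nat.one_le_two_pow (n := k)
        omega
  · rintro σ' t ⟨j1, j2, j3, j4, j5, j6, j7, j8, j9⟩
    rw [pow_zero] at j9
    refine ⟨?_, j3, j4, by omega⟩
    rw [show T + 12 + 3 = T + 15 by omega] at j1
    omega

end BinarySearch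

/-! ### Comparison of suffixes, of tails and of values -/

section Comparisons

variable {α : Type*} [LinearOrder α] {S : List α} {B L : ℕ} {σ : State}

/-- If the common prefix ends inside `u`, the next letters decide, and `u` is not smaller if `v` has
none. Otherwise `u` is a prefix of `v`. -/
theorem lt_iff_lcpLen {u v : List α} :
    u < v ↔ if lcpLen u v < u.length
      then ∃ x y, u[lcpLen u v]? = some x ∧ v[lcpLen u v]? = some y ∧ x < y
      else lcpLen u v < v.length := by
  induction u generalizing v with
  | nil => cases v <;> simp [lcpLen]
  | cons a u ih =>
    cases v with
    | nil => simp [lcpLen]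
    | cons b v =>
      rw [List.cons_lt_cons_iff]
      by_cases h : a = b
      · subst h
        simp [lcpLen, ih]
      · simp [lcpLen, h]

theorem lcpLen_le_length_left (u v : List α) : lcpLen u v ≤ u.length := by
  induction u generalizing v with
  | nil => cases v <;> simp [lcpLen]
  | cons a u ih =>
    cases v with
    | nil => simp [lcpLen]
    | cons b v =>
      have := ih v
      by_cases h : a = b <;> simp [lcpLen, h, this]

/-- Compare the suffixes of the text that start at the positions in the registers `x` and `y`;
register `10` holds the length of the text, and the answer is put into register `z`. -/
def Cmd.suffixLt (x y z : ℕ) : Cmd :=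
  .lcp z x y ;; .op .add (z + 1) x z ;; .op .lt (z + 2) (z + 1) 10 ;; .op .add (z + 3) y z ;;
    .ite (z + 2) (.symLt z (z + 1) (z + 3)) (.op .lt z (z + 3) 10)

theorem wp_suffixLt {x y z : ℕ} (hx : x < z) (hy : y < z) (hz : 10 < z)
    (hn : σ.reg 10 = S.length) (hx' : σ.reg x ≤ S.length) (hy' : σ.reg y ≤ S.length)
    (hB : 2 * S.length + 1 < B) :
    WP S B L (.suffixLt x y z) σ fun σ' t => t ≤ 2 * L + 8 ∧ σ'.mem = σ.mem ∧ Agree z σ σ' ∧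
      σ'.reg z ≤ 1 ∧ (σ'.reg z ≠ 0 ↔ S.drop (σ.reg x) < S.drop (σ.reg y)) := by
  have hl := lcpLen_le_length_left (S.drop (σ.reg x)) (S.drop (σ.reg y))
  rw [List.length_drop] at hl
  rw [lt_iff_lcpLen]
  simp [Cmd.suffixLt, BinOp.eval, ite_one_zero_lt (show 1 < B by omega), hx.ne, hy.ne, hz.ne,
    show y ≠ z + 1 by omega, show 10 ≠ z + 1 by omega, show 10 ≠ z + 2 by omega,
    show y ≠ z + 2 by omega, show 10 ≠ z + 3 by omega, hn]
  generalize lcpLen (S.drop (σ.reg x)) (S.drop (σ.reg y)) = l at *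
  refine ⟨by omega, by omega, ?_, ?_⟩
  · intro h
    refine ⟨by omega, by rw [symLtVal]; split_ifs <;> simp, ?_⟩
    -- `symLtVal` is `0` behind the end of the text, which is the right answer if the second suffix
    -- is a proper prefix of the first.
    rw [if_pos (by omega), symLtVal]
    simp
  · intro h
    refine ⟨by omega, by split_ifs <;> simp, ?_⟩
    rw [if_neg (by omega)]
    omega

/-- Compare the tails of the clusters with the indices in the registers `37` and `25`; register
`16` holds the length of the word, and the answer is put into register `36`. -/
def Cmd.tailLt : Cmd :=
  .const 38 3 ;; .const 40 1 ;;
  .op .mul 39 37 38 ;; .op .add 39 39 40 ;; .load 39 39 ;; .op .add 39 39 16 ;;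
  .op .mul 41 25 38 ;; .op .add 41 41 40 ;; .load 41 41 ;; .op .add 41 41 16 ;;
  .suffixLt 39 41 42 ;; .const 43 0 ;; .op .add 36 42 43

theorem wp_tailLt (hn : σ.reg 10 = S.length)
    (hi : σ.mem (3 * σ.reg 37 + 1) + σ.reg 16 ≤ S.length)
    (hj : σ.mem (3 * σ.reg 25 + 1) + σ.reg 16 ≤ S.length)
    (hB : 2 * S.length + 4 < B) (hB₁ : 3 * σ.reg 37 + 1 < B) (hB₂ : 3 * σ.reg 25 + 1 < B) :
    WP S B L .tailLt σ fun σ' t => t ≤ 2 * L + 20 ∧ σ'.mem = σ.mem ∧ Agree 36 σ σ' ∧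
      (σ'.reg 36 ≠ 0 ↔ S.drop (σ.mem (3 * σ.reg 37 + 1) + σ.reg 16) <
        S.drop (σ.mem (3 * σ.reg 25 + 1) + σ.reg 16)) := by
  rw [mul_comm 3] at hi hj hB₁ hB₂ ⊢
  rw [mul_comm 3 (σ.reg 25)]
  simp [Cmd.tailLt, BinOp.eval]
  refine ⟨by omega, by omega, by omega, by omega, by omega, by omega, by omega, by omega, ?_⟩
  refine (wp_suffixLt (by omega) (by omega) (by omega) (by simpa using hn) (by simpa using hi)
    (by simpa using hj) (by omega)).mono ?_
  rintro σ' t ⟨h1, h2, h3, h4, h5⟩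
  refine ⟨by omega, by omega, by omega, by simpa using h2, ?_, by simpa using h5⟩
  simpa using h3.mono (show 36 ≤ 42 by omega)

/-- Compare the indices in the registers `37` and `25` by the values in the array at the address in
register `19`, and then by themselves; the answer is put into register `36`. -/
def Cmd.valueLt : Cmd :=
  .op .add 38 19 37 ;; .load 38 38 ;; .op .add 39 19 25 ;; .load 39 39 ;;
  .op .lt 36 38 39 ;; .op .eq 40 38 39 ;; .op .lt 41 37 25 ;; .op .mul 40 40 41 ;;
  .op .add 36 36 40

theorem wp_valueLt {f : ℕ → ℕ} (hi : σ.mem (σ.reg 19 + σ.reg 37) = f (σ.reg 37))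
    (hj : σ.mem (σ.reg 19 + σ.reg 25) = f (σ.reg 25)) (hB : 2 < B)
    (hB₁ : σ.reg 19 + σ.reg 37 < B) (hB₂ : σ.reg 19 + σ.reg 25 < B) :
    WP S B L .valueLt σ fun σ' t => t ≤ 9 ∧ σ'.mem = σ.mem ∧ Agree 36 σ σ' ∧
      (σ'.reg 36 ≠ 0 ↔ valueKey f (σ.reg 37) < valueKey f (σ.reg 25)) := by
  rw [valueKey_lt_iff]
  simp [Cmd.valueLt, BinOp.eval, hi, hj, ite_one_zero_lt (show 1 < B by omega), hB₁, hB₂]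
  refine ⟨?_, ?_, ?_⟩
  · split_ifs <;> omega
  · split_ifs <;> omega
  · constructor
    · intro h
      by_cases h' : f (σ.reg 37) < f (σ.reg 25)
      · exact Or.inl h'
      · exact Or.inr (h (by omega))
    · rintro (h | h) h'
      · omega
      · exact h

end Comparisons

/-! ### Moving one item in a merge -/

section MergeSort

variable {α : Type*} [LinearOrder α] {S : List α} {B L : ℕ} {σ : State}

/-- Put the element with index in register `24` of the array at the address in register `23` into
its place in the array at the address in register `28`. Blocks whose length is in register `22`
are merged in pairs. -/
def Cmd.mergeStep (cmp : Cmd) : Cmd :=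
  .op .add 25 23 24 ;; .load 25 25 ;;
  .op .div 26 25 22 ;; .const 29 2 ;; .op .mod 27 26 29 ;; .op .mul 29 27 29 ;;
  .const 30 1 ;; .op .add 26 26 30 ;; .op .sub 26 26 29 ;;
  .op .mul 30 26 22 ;; .op .add 31 30 22 ;;
  .op .sub 32 30 11 ;; .op .sub 30 30 32 ;; .op .sub 32 31 11 ;; .op .sub 31 31 32 ;;
  .const 29 0 ;; .op .add 26 30 29 ;;
  .bsearch 30 (.op .add 37 23 33 ;; .load 37 37 ;; cmp) ;;
  .op .add 30 30 24 ;; .op .sub 30 30 26 ;; .op .mul 29 27 22 ;; .op .sub 30 30 29 ;;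
  .op .add 30 28 30 ;; .store 30 25

/-- Started in `σ`, the program `cmp` decides within time `T` whether the index in register `37` has
a smaller key than the index in register `25`, and puts the answer into register `36`. -/
def Compares {K : Type*} [LinearOrder K] (S : List α) (B L : ℕ) (cmp : Cmd) (key : ℕ → K)
    (m T : ℕ) (σ : State) : Prop :=
  σ.reg 37 < m → σ.reg 25 < m → WP S B L cmp σ fun σ' t => t ≤ T ∧ σ'.mem = σ.mem ∧
    Agree 36 σ σ' ∧ (σ'.reg 36 ≠ 0 ↔ key (σ.reg 37) < key (σ.reg 25))

set_option maxHeartbeats 1000000 in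
theorem wp_mergeStep {K : Type*} [LinearOrder K] {key : ℕ → K} {cmp : Cmd} {m l x T : ℕ}
    (hk : Set.InjOn key (Set.Iio m)) (hs : SortedAt key m l σ.mem (σ.reg 23)) (hx : x < m)
    (h11 : σ.reg 11 = m) (h12 : m < 2 ^ σ.reg 12) (h22 : σ.reg 22 = 2 ^ l) (h24 : σ.reg 24 = x)
    (hB : 2 * m + 2 * 2 ^ l + 4 < B) (hB₁₂ : σ.reg 12 < B) (hB₂₃ : σ.reg 23 + m < B)
    (hB₂₈ : σ.reg 28 + m < B)
    (hcmp : ∀ σ' : State, σ'.mem = σ.mem → Agree 24 σ σ' → Compares S B L cmp key m T σ') :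
    WP S B L (.mergeStep cmp) σ fun σ' t => t ≤ σ.reg 12 * (T + 17) + 40 ∧ Agree 25 σ σ' ∧
      σ'.reg 28 = σ.reg 28 ∧
      σ'.mem = Function.update σ.mem (σ.reg 28 + blockPos key m (l + 1) (σ.mem (σ.reg 23 + x)))
        (σ.mem (σ.reg 23 + x)) := by
  obtain ⟨hy, hpos⟩ := hs.apply hk hx
  simp [Cmd.mergeStep, BinOp.eval, h24, h22, h11, Nat.sub_sub_eq_min]
  generalize σ.mem (σ.reg 23 + x) = y at *
  have hb₁ : y / 2 ^ l * 2 ^ l ≤ y := Nat.div_mul_le_self _ _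
  have hb₂ : y / 2 ^ l ≤ y := Nat.div_le_self _ _
  have hq : 0 < 2 ^ l := by positivity
  -- The sibling of block `q` is `q + 1 - 2 * (q % 2)`; the `1` is added first so that the truncated
  -- subtraction is exact.
  have hnext : (y / 2 ^ l % 2 = 0 ∧ blockPos key m (l + 1) y = x +
        ((block m l (y / 2 ^ l + 1 - y / 2 ^ l % 2 * 2)).filter fun i => key i < key y).card) ∨
      (y / 2 ^ l % 2 = 1 ∧ blockPos key m (l + 1) y + 2 ^ l = x +
        ((block m l (y / 2 ^ l + 1 - y / 2 ^ l % 2 * 2)).filter fun i => key i < key y).card) := by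
    rcases Nat.mod_two_eq_zero_or_one (y / 2 ^ l) with h | h
    · exact Or.inl ⟨h, by rw [blockPos_succ_even h, hpos, h]; simp⟩
    · exact Or.inr ⟨h, by rw [blockPos_succ_odd h, hpos, h]; simp⟩
  have hsib : y / 2 ^ l + 1 - y / 2 ^ l % 2 * 2 ≤ y / 2 ^ l + 1 := Nat.sub_le _ _
  have hb₃ := (blockPos_bounds (key := key) (l := l + 1) hy).2.2
  generalize y / 2 ^ l % 2 = par at *
  generalize hg : y / 2 ^ l + 1 - par * 2 = g at *
  have hlo : g * 2 ^ l ≤ y / 2 ^ l * 2 ^ l + 2 ^ l := by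
    rw [← Nat.succ_mul]; exact Nat.mul_le_mul_right _ hsib
  have hcard := card_filter_block_le (m := m) (l := l) (g := g) fun i => key i < key y
  generalize hc : ((block m l g).filter fun i => key i < key y).card = c at *
  have hpq : par * 2 ^ l ≤ 2 ^ l := by
    rcases hnext with h | h <;> simp [h.1]
  refine ⟨by omega, by omega, by omega, by omega, by omega, by omega, by omega, by omega,
    by omega, by omega, by omega, by omega, by omega, by omega, by omega, by omega, ?_⟩
  refine (wp_bsearch (c := min (g * 2 ^ l) m + c) (T := T + 2) (by omega) ?_ ?_ ?_ ?_ ?_ ?_).mono ?_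
  · simp
  · simpa using hcard
  · simp
    omega
  · simp
    omega
  · simpa using hB₁₂
  · intro σ' i1 i2 i3 i4
    simp at i1 i2 i3 i4
    have e25 := i2 25 (by omega)
    have e23 := i2 23 (by omega)
    simp at e25 e23
    simp [BinOp.eval, e23, i1]
    obtain ⟨s1, s2⟩ := hs.search hk (g := g) (p := fun i => key i < key y) (x := σ'.reg 33)
      (fun _ _ _ _ h h' => h.trans h') (by omega) (by omega)
    rw [hc] at s2
    refine ⟨by omega, (hcmp _ ?_ ?_ ?_ ?_).mono ?_⟩
    · simpa using i1
    · simpa using i2.mono (show 24 ≤ 30 by omega)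
    · simpa using s1
    · simpa [e25] using hy
    · rintro σ'' t ⟨j1, j2, j3, j4⟩
      refine ⟨by omega, by simpa [i1] using j2, ?_, ?_⟩
      · simpa using j3
      · simpa [e25, s2] using j4
  · rintro σ' t ⟨j1, j2, j3, j4⟩
    have e22 := j3 22 (by omega)
    have e24 := j3 24 (by omega)
    have e25 := j3 25 (by omega)
    have e26 := j3 26 (by omega)
    have e27 := j3 27 (by omega)
    have e28 := j3 28 (by omega)
    simp at e22 e24 e25 e26 e27 e28 j1 j2 j3
    simp only [e22, e24, e25, e26, e27, e28, j4, h22, h24]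
    -- The search result minus the start of the sibling block is the number of smaller items there.
    -- An item of a right block also loses the `2 ^ l` by which its block starts later than the
    -- merged one.
    have epos : min (g * 2 ^ l) m + c + x - min (g * 2 ^ l) m - par * 2 ^ l =
        blockPos key m (l + 1) y := by
      rcases hnext with ⟨h, h'⟩ | ⟨h, h'⟩ <;> rw [h] <;> omega
    rw [epos]
    refine ⟨by omega, by omega, by omega, by omega, by omega, ?_, ?_, trivial, ?_⟩
    · clear * - j1
      rw [show T + 2 + 15 = T + 17 by omega] at j1
      omega
    · simpa using j3.mono (show 25 ≤ 30 by omega)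
    · rw [j2]

end MergeSort

/-! ### Merging a level, and the whole merge sort -/

section MergeSort

variable {α : Type*} [LinearOrder α] {S : List α} {B L : ℕ} {σ : State}

/-- Merge the blocks of the array at the address in register `23` in pairs, and put the result
behind that array. -/
def Cmd.mergeLevel (cmp : Cmd) : Cmd :=
  .op .add 28 23 11 ;; .const 29 0 ;; .op .add 24 11 29 ;;
  .down 24 29 (.mergeStep cmp) ;;
  .op .add 22 22 22 ;; .const 29 0 ;; .op .add 23 28 29

/-- The comparison is required to work for every content of the target area, since this area changes
during the merge. The source is not touched, so all items are placed with respect to the same sorted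
blocks. -/
theorem wp_mergeLevel {K : Type*} [LinearOrder K] {key : ℕ → K} {cmp : Cmd} {m l T : ℕ}
    (hk : Set.InjOn key (Set.Iio m)) (hs : SortedAt key m l σ.mem (σ.reg 23))
    (h11 : σ.reg 11 = m) (h12 : m < 2 ^ σ.reg 12) (h22 : σ.reg 22 = 2 ^ l)
    (hB : 2 * m + 2 * 2 ^ l + 4 < B) (hB₁₂ : σ.reg 12 < B) (hB₂₃ : σ.reg 23 + 2 * m < B)
    (hcmp : ∀ σ' : State, EqOff (σ.reg 23 + m) (σ.reg 23 + 2 * m) σ.mem σ'.mem →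
      Agree 24 σ σ' → Compares S B L cmp key m T σ') :
    WP S B L (.mergeLevel cmp) σ fun σ' t => t ≤ m * (σ.reg 12 * (T + 17) + 43) + 10 ∧
      Agree 22 σ σ' ∧ σ'.reg 22 = 2 ^ (l + 1) ∧ σ'.reg 23 = σ.reg 23 + m ∧
      EqOff (σ.reg 23 + m) (σ.reg 23 + 2 * m) σ.mem σ'.mem ∧
      SortedAt key m (l + 1) σ'.mem (σ.reg 23 + m) := by
  simp [Cmd.mergeLevel, BinOp.eval, h11]
  refine ⟨by omega, by omega, by omega, ?_⟩
  refine (wp_down (N := m) (T := σ.reg 12 * (T + 17) + 40) (fun k σ' => Agree 24 σ σ' ∧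
    σ'.reg 28 = σ.reg 23 + m ∧ EqOff (σ.reg 23 + m) (σ.reg 23 + 2 * m) σ.mem σ'.mem ∧
    ∀ x < m, k ≤ x → σ'.mem (σ.reg 23 + m + blockPos key m (l + 1) (σ.mem (σ.reg 23 + x))) =
      σ.mem (σ.reg 23 + x)) (by omega) (by omega) (by omega) ?_ ?_ ?_).mono ?_
  · simp
  · refine ⟨by simp, by simp, EqOff.refl _ _ _, fun x hx hx' => by omega⟩
  · rintro k hk' σ' h24 ⟨i1, i2, i3, i4⟩
    have e11 := i1 11 (by omega)
    have e12 := i1 12 (by omega)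
    have e22 := i1 22 (by omega)
    have e23 := i1 23 (by omega)
    have hM : ∀ x < m, σ'.mem (σ.reg 23 + x) = σ.mem (σ.reg 23 + x) :=
      fun x hx => i3 _ (by omega)
    have hy := hs.apply hk hk'
    refine (wp_mergeStep (key := key) (m := m) (l := l) (x := k) (T := T) hk ?_ hk' ?_ ?_ ?_ ?_ hB
      ?_ ?_ ?_ ?_).mono ?_
    · simp [e23]
      exact hs.congr hM
    · simp [e11, h11]
    · simpa [e12] using h12
    · simp [e22, h22]
    · simp
    · simpa [e12] using hB₁₂
    · simp [e23]
      omega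
    · simp [i2]
      omega
    · intro σ'' j1 j2
      refine hcmp _ ?_ ?_
      · simp at j1
        rw [j1]
        exact i3
      · simp at j2
        exact i1.trans j2
    · rintro σ'' t ⟨j1, j2, j3, j4⟩
      simp [e12, e23, i2, hM k hk'] at j1 j3 j4
      have hb := (blockPos_bounds (key := key) (l := l + 1) hy.1).2.2
      refine ⟨j1, ?_, ?_, j3, ?_, ?_⟩
      · simpa using j2 24 (by omega)
      · exact i1.trans (by simpa using j2.mono (show 24 ≤ 25 by omega))
      · rw [j4]
        exact i3.update (by omega) (by omega)
      · intro x hx hkx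
        have hyx := hs.apply hk hx
        rw [j4, Function.update_apply]
        split_ifs with he
        -- If two writes hit the same cell, they wrote the same item.
        · exact (blockPos_inj (l := l + 1) hk hyx.1 hy.1 (by omega)).symm
        · refine i4 x hx ?_
          rcases Nat.eq_or_lt_of_le hkx with h | h
          · exact absurd (by rw [h]) he
          · exact h
  · rintro σ' t ⟨j1, -, j2, j3, j4, j5⟩
    have e22 := j2 22 (by omega)
    simp [e22, h22, j3]
    refine ⟨by omega, by omega, by omega, ?_, ?_, ?_, ?_, ?_⟩
    · clear * - j1
      rw [show σ.reg 12 * (T + 17) + 40 + 3 = σ.reg 12 * (T + 17) + 43 by omega] at j1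
      omega
    · exact j2.mono (by omega)
    · ring
    · exact j4
    · intro j hj
      have := j5 (blockPos key m l j) (blockPos_bounds hj).2.2 (Nat.zero_le _)
      rwa [hs j hj] at this

/-- Sort the indices below the number in register `11`; all levels of the merge sort are kept in
memory from the address in register `20` on. -/
def Cmd.mergeSort (cmp : Cmd) : Cmd :=
  .const 29 0 ;; .op .add 24 11 29 ;;
  .down 24 29 (.op .add 25 20 24 ;; .store 25 24) ;;
  .const 22 1 ;; .const 29 0 ;; .op .add 23 20 29 ;; .op .add 21 12 29 ;;
  .down 21 29 (.mergeLevel cmp)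

/-- Each merge writes behind its source, so level `l` stays in the `m` cells from offset `l * m` on,
where the descent of `Cmd.select` needs it. As `m < 2 ^ lg`, level `lg` is a single sorted block. -/
theorem wp_mergeSort {K : Type*} [LinearOrder K] {key : ℕ → K} {cmp : Cmd} {m lg T : ℕ}
    (hk : Set.InjOn key (Set.Iio m))
    (h11 : σ.reg 11 = m) (h12 : σ.reg 12 = lg) (hm : m < 2 ^ lg)
    (hB : 2 * m + 2 * 2 ^ lg + 4 < B) (hB₂₀ : σ.reg 20 + (lg + 1) * m < B)
    (hcmp : ∀ σ' : State, EqOff (σ.reg 20) (σ.reg 20 + (lg + 1) * m) σ.mem σ'.mem →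
      Agree 21 σ σ' → Compares S B L cmp key m T σ') :
    WP S B L (.mergeSort cmp) σ fun σ' t =>
      t ≤ lg * (m * (lg * (T + 17) + 43) + 13) + m * 5 + 10 ∧ Agree 21 σ σ' ∧
      EqOff (σ.reg 20) (σ.reg 20 + (lg + 1) * m) σ.mem σ'.mem ∧
      ∀ l ≤ lg, SortedAt key m l σ'.mem (σ.reg 20 + l * m) := by
  have hlg : lg < 2 ^ lg := Nat.lt_two_pow_self
  have hlm : (lg + 1) * m = lg * m + m := by ring
  simp [Cmd.mergeSort, BinOp.eval, h11]
  refine ⟨by omega, by omega, ?_⟩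
  refine (wp_down (N := m) (T := 2) (fun k σ' => Agree 21 σ σ' ∧
    EqOff (σ.reg 20) (σ.reg 20 + m) σ.mem σ'.mem ∧
    ∀ x < m, k ≤ x → σ'.mem (σ.reg 20 + x) = x) (by omega) (by omega) (by omega) ?_ ?_ ?_).mono ?_
  · simp
  · exact ⟨by simp, EqOff.refl _ _ _, fun x hx hx' => by omega⟩
  · rintro k hk' σ' h24 ⟨i1, i2, i3⟩
    have e20 := i1 20 (by omega)
    simp [BinOp.eval, e20]
    refine ⟨by omega, i1, i2.update (by omega) (by omega), ?_⟩
    intro x hx hkx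
    rw [Function.update_apply]
    split_ifs with he
    · omega
    · exact i3 x hx (by omega)
  · rintro σ₁ t₁ ⟨j1, -, j2, j3, j4⟩
    have e20 := j2 20 (by omega)
    have e12 := j2 12 (by omega)
    simp [e20, e12, h12]
    refine ⟨by omega, by omega, by omega, by omega, ?_⟩
    refine (wp_down (N := lg) (T := m * (lg * (T + 17) + 43) + 10)
      (fun k σ' => Agree 21 σ σ' ∧
        EqOff (σ.reg 20) (σ.reg 20 + (lg + 1) * m) σ.mem σ'.mem ∧ k ≤ lg ∧
        σ'.reg 22 = 2 ^ (lg - k) ∧ σ'.reg 23 = σ.reg 20 + (lg - k) * m ∧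
        ∀ l ≤ lg - k, SortedAt key m l σ'.mem (σ.reg 20 + l * m))
      (by omega) (by omega) (by omega) ?_ ?_ ?_).mono ?_
    · simp
    · refine ⟨by simpa using j2, j3.mono (by omega) (by omega), le_rfl, by simp, by simp, ?_⟩
      intro l hl
      obtain rfl : l = 0 := by omega
      intro j hj
      rw [blockPos_zero hj]
      simpa using j4 j hj (Nat.zero_le _)
    · rintro k hk' σ' h21 ⟨i1, i2, i3, i4, i5, i6⟩
      have f11 := i1 11 (by omega)
      have f12 := i1 12 (by omega)
      obtain ⟨l, hl⟩ : ∃ l, lg = l + (k + 1) := ⟨lg - (k + 1), by omega⟩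
      have hl₁ : lg - (k + 1) = l := by omega
      have hl₂ : lg - k = l + 1 := by omega
      rw [hl₁] at i4 i5 i6
      have hlm₁ : l * m + m ≤ lg * m := by
        rw [← Nat.succ_mul]; exact Nat.mul_le_mul_right _ (by omega)
      have hq : 2 ^ l ≤ 2 ^ lg := Nat.pow_le_pow_right (by omega) (by omega)
      refine (wp_mergeLevel (key := key) (m := m) (l := l) (T := T) hk ?_ ?_ ?_ ?_ ?_ ?_ ?_
        ?_).mono ?_
      · simpa [i5] using i6 l le_rfl
      · simp [f11, h11]
      · simpa [f12, h12] using hm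
      · simpa using i4
      · omega
      · simp [f12, h12]
        omega
      · simp [i5]
        omega
      · simp only [State.setReg_reg, State.setReg_mem]
        simp [i5]
        intro σ'' j1 j2
        refine hcmp σ'' (i2.trans (j1.mono (by omega) (by omega))) (i1.trans ?_)
        simpa using j2.mono (show 21 ≤ 24 by omega)
      · simp [i5, f12, h12]
        intro σ'' t k1 k2 k3 k4 k5 k6
        rw [hl₂]
        refine ⟨k1, ?_, i1.trans ?_, i2.trans (k5.mono (by omega) (by omega)), by omega, k3, ?_, ?_⟩
        · simpa using k2 21 (by omega)
        · simpa using k2.mono (show 21 ≤ 22 by omega)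
        · rw [k4]; ring
        · intro l' hl'
          rcases Nat.eq_or_lt_of_le hl' with rfl | hl'
          · convert k6 using 1
            ring
          · refine (i6 l' (by omega)).congr fun x hx => k5 _ ?_
            have : l' * m ≤ l * m := Nat.mul_le_mul_right _ (by omega)
            omega
    · rintro σ' t ⟨k1, -, k2, k3, -, -, -, k4⟩
      refine ⟨?_, k2, k3, fun l hl => k4 l (by omega)⟩
      clear * - k1 j1
      rw [show m * (lg * (T + 17) + 43) + 10 + 3 = m * (lg * (T + 17) + 43) + 13 by omega] at k1
      omega

end MergeSort

/-! ### The value index: values, merge sort levels and prefix sums -/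

section ValueIndex

variable {α : Type*} [LinearOrder α] {S : List α} {B L : ℕ} {σ : State} {f : ℕ → ℕ} {m lg : ℕ}

/-- From address `X` on, the memory `μ` holds the values of `f` below `m`, then the merge sort of
these values, and finally the prefix sums of the sorted values. -/
structure ValueIndex (f : ℕ → ℕ) (m lg : ℕ) (μ : ℕ → ℕ) (X : ℕ) : Prop where
  value : ∀ j < m, μ (X + j) = f j
  sorted : ∀ l ≤ lg, SortedAt (valueKey f) m l μ (X + m + l * m)
  sum : ∀ c ≤ m, μ (X + m + lg * m + m + c) =
    ∑ x ∈ Finset.range c, f (μ (X + m + lg * m + x))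

theorem ValueIndex.congr {μ μ' : ℕ → ℕ} {X : ℕ} (h : ValueIndex f m lg μ X)
    (h' : ∀ x, X ≤ x → x < X + m + lg * m + m + m + 1 → μ' x = μ x) :
    ValueIndex f m lg μ' X where
  value j hj := by rw [h' _ (by omega) (by omega), h.value j hj]
  sorted l hl := (h.sorted l hl).congr fun x hx => by
    have : l * m ≤ lg * m := Nat.mul_le_mul_right _ hl
    exact h' _ (by omega) (by omega)
  sum c hc := by
    rw [h' _ (by omega) (by omega), h.sum c hc]
    refine Finset.sum_congr rfl fun x hx => ?_
    rw [Finset.mem_range] at hx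
    rw [h' _ (by omega) (by omega)]

/-- Complete the array of values at the address in register `19` to a value index. Register `13`
holds the product of the registers `12` and `11`. -/
def Cmd.buildIndex : Cmd :=
  .op .add 20 19 11 ;; .mergeSort .valueLt ;;
  .op .add 22 20 13 ;; .op .add 23 22 11 ;; .const 25 0 ;; .store 23 25 ;;
  .const 29 0 ;; .op .add 24 11 29 ;;
  .down 24 29 (.load 26 22 ;; .op .add 26 19 26 ;; .load 26 26 ;; .op .add 25 25 26 ;;
    .const 29 1 ;; .op .add 22 22 29 ;; .op .add 23 23 29 ;; .store 23 25)

theorem wp_buildIndex {X : ℕ} (h11 : σ.reg 11 = m) (h12 : σ.reg 12 = lg)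
    (h13 : σ.reg 13 = lg * m) (h19 : σ.reg 19 = X) (hm : m < 2 ^ lg)
    (hf : ∀ j < m, σ.mem (X + j) = f j)
    (hB : 2 * m + 2 * 2 ^ lg + 4 < B) (hBX : X + m + lg * m + m + m + 1 < B)
    (hBf : ∑ j ∈ Finset.range m, f j < B) :
    WP S B L .buildIndex σ fun σ' t => t ≤ lg * (m * (lg * 26 + 43) + 13) + m * 16 + 20 ∧
      Agree 20 σ σ' ∧ EqOff (X + m) (X + m + lg * m + m + m + 1) σ.mem σ'.mem ∧
      ValueIndex f m lg σ'.mem X := by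
  have hlm : (lg + 1) * m = lg * m + m := by ring
  simp [Cmd.buildIndex, BinOp.eval, h11, h19]
  refine ⟨by omega, ?_⟩
  refine (wp_mergeSort (key := valueKey f) (m := m) (lg := lg) (T := 9) (valueKey_injOn f _)
    ?_ ?_ hm hB ?_ ?_).mono ?_
  · simp [h11]
  · simp [h12]
  · simp
    omega
  · intro σ' i1 i2 j1 j2
    simp at i1
    have e19 := i2 19 (by omega)
    simp [h19] at e19
    have hv : ∀ j < m, σ'.mem (X + j) = f j := fun j hj => by
      rw [i1 _ (by omega), hf j hj]
    refine wp_valueLt ?_ ?_ ?_ ?_ ?_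
    · rw [e19, hv _ j1]
    · rw [e19, hv _ j2]
    all_goals omega
  · rintro σ₁ t₁ ⟨j1, j2, j3, j4⟩
    simp only [Nat.reduceAdd] at j1
    have e11 := j2 11 (by omega)
    have e13 := j2 13 (by omega)
    have e19 := j2 19 (by omega)
    have e20 := j2 20 (by omega)
    simp [h11, h13, h19] at e11 e13 e19 e20 j3 j4
    simp [e11, e13, e20]
    refine ⟨by omega, by omega, by omega, by omega, ?_⟩
    have htop := j4 lg le_rfl
    set M := X + m + lg * m with hM
    have hf₁ : ∀ j < m, σ₁.mem (X + j) = f j := fun j hj => by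
      rw [j3 _ (by omega), hf j hj]
    -- The sorted array is a permutation of the values, so every prefix sum is at most their total
    -- and fits into a word.
    have hsum : ∀ c ≤ m, ∑ x ∈ Finset.range c, f (σ₁.mem (M + x)) < B := by
      intro c hc
      refine lt_of_le_of_lt ?_ hBf
      rw [← htop.sum_eq (valueKey_injOn f _)]
      exact Finset.sum_le_sum_of_subset (Finset.range_subset_range.2 hc)
    refine (wp_down (N := m) (T := 8) (fun k σ' => k ≤ m ∧ Agree 20 σ σ' ∧
      EqOff (M + m) (M + m + m + 1) σ₁.mem σ'.mem ∧
      σ'.reg 22 = M + (m - k) ∧ σ'.reg 23 = M + m + (m - k) ∧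
      σ'.reg 25 = ∑ x ∈ Finset.range (m - k), f (σ₁.mem (M + x)) ∧
      ∀ c ≤ m - k, σ'.mem (M + m + c) = ∑ x ∈ Finset.range c, f (σ₁.mem (M + x)))
      (by omega) (by omega) (by omega) ?_ ?_ ?_).mono ?_
    · simp
    · refine ⟨le_rfl, ?_, ?_, by simp, by simp, by simp, ?_⟩
      · simpa using j2.mono (show 20 ≤ 21 by omega)
      · exact (EqOff.refl _ _ _).update (by omega) (by omega)
      · intro c hc
        obtain rfl : c = 0 := by omega
        simp
    · rintro k hk' σ' h24 ⟨i0, i1, i2, i3, i4, i5, i6⟩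
      obtain ⟨c, hc⟩ : ∃ c, m = c + (k + 1) := ⟨m - (k + 1), by omega⟩
      have hc₁ : m - (k + 1) = c := by omega
      have hc₂ : m - k = c + 1 := by omega
      rw [hc₁] at i3 i4 i5 i6
      have f19 := i1 19 (by omega)
      have hy := (htop.apply (valueKey_injOn f _) (show c < m by omega)).1
      have hv : σ'.mem (X + σ₁.mem (M + c)) = f (σ₁.mem (M + c)) := by
        rw [i2 _ (by omega), hf₁ _ hy]
      have hs := hsum (c + 1) (by omega)
      rw [Finset.sum_range_succ] at hs
      simp [BinOp.eval, i3, i4, i5, f19, h19, i2 (M + c) (by omega), hv]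
      refine ⟨by omega, by omega, by omega, by omega, by omega, by omega, i1, ?_, by omega,
        by omega, ?_, ?_⟩
      · exact i2.update (by omega) (by omega)
      · rw [hc₂, Finset.sum_range_succ]
      · intro c' hc'
        rw [hc₂] at hc'
        rw [Function.update_apply]
        split_ifs with he
        · rw [show c' = c + 1 by omega, Finset.sum_range_succ]
        · exact i6 c' (by omega)
    · rintro σ' t ⟨k1, -, -, k2, k3, -, -, -, k4⟩
      refine ⟨by omega, k2, ?_, ?_⟩
      · exact (j3.mono (by omega) (by omega)).trans (k3.mono (by omega) (by omega))
      · refine ⟨fun j hj => ?_, fun l hl => ?_, fun c hc => ?_⟩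
        · rw [k3 _ (by omega), hf₁ j hj]
        · have : l * m ≤ lg * m := Nat.mul_le_mul_right _ hl
          exact (j4 l hl).congr fun x hx => k3 _ (by omega)
        · rw [k4 c (by omega)]
          refine Finset.sum_congr rfl fun x hx => ?_
          rw [Finset.mem_range] at hx
          rw [k3 _ (by omega)]

end ValueIndex

/-! ### Counting, rank search and selection in a value index -/

section Select

variable {α : Type*} [LinearOrder α] {S : List α} {B L : ℕ} {σ : State} {f : ℕ → ℕ} {m lg : ℕ}

/-- Count the values that are at most the number in register `37` in a dyadic block of a level of a
value index. The level is at the address in register `38`, and the block is between the positions in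
the registers `40` and `41`. The position behind the last such value is left in register `40`. -/
def Cmd.countLe : Cmd :=
  .bsearch 40 (.op .add 47 38 43 ;; .load 47 47 ;; .op .add 47 19 47 ;; .load 47 47 ;;
    .op .lt 46 37 47 ;; .const 47 1 ;; .op .sub 46 47 46)

/-- The property `f j ≤ r` is inherited by smaller value keys, so `SortedAt.search` applies on every
level. -/
theorem wp_countLe {X l g r : ℕ} (hv : ValueIndex f m lg σ.mem X) (hm : m < 2 ^ lg)
    (hl : l ≤ lg) (h12 : σ.reg 12 = lg) (h19 : σ.reg 19 = X) (h37 : σ.reg 37 = r)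
    (h38 : σ.reg 38 = X + m + l * m)
    (h40 : σ.reg 40 = min (g * 2 ^ l) m) (h41 : σ.reg 41 = min (g * 2 ^ l + 2 ^ l) m)
    (hB : 2 * m + 2 < B) (hBlg : lg < B) (hBX : X + m + lg * m + m < B) :
    WP S B L .countLe σ fun σ' t => t ≤ lg * 22 + 5 ∧ σ'.mem = σ.mem ∧ Agree 40 σ σ' ∧
      σ'.reg 40 = min (g * 2 ^ l) m + ((block m l g).filter fun j => f j ≤ r).card := by
  have hlm : l * m ≤ lg * m := Nat.mul_le_mul_right _ hl
  have hcard := card_filter_block_le (m := m) (l := l) (g := g) fun j => f j ≤ r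
  refine (wp_bsearch (T := 7)
    (c := min (g * 2 ^ l) m + ((block m l g).filter fun j => f j ≤ r).card)
    (by omega) (by omega) ?_ ?_ ?_ (by omega) ?_).mono ?_
  · simpa [h41] using hcard
  · simp only [Nat.reduceAdd, h12]
    omega
  · simp only [Nat.reduceAdd]
    omega
  · intro σ' i1 i2 i3 i4
    have e19 := i2 19 (by omega)
    have e37 := i2 37 (by omega)
    have e38 := i2 38 (by omega)
    simp only [Nat.reduceAdd] at i4 i3
    obtain ⟨s1, s2⟩ := (hv.sorted l hl).search (valueKey_injOn f _) (g := g)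
      (p := fun j => f j ≤ r) (x := σ'.reg 43)
      (fun i _ j _ h h' => by rw [valueKey_lt_iff] at h; omega) (by omega) (by omega)
    simp [BinOp.eval, e19, e37, e38, h19, h37, h38, i1, hv.value _ s1,
      ite_one_zero_lt (show 1 < B by omega)]
    refine ⟨by omega, by omega, by omega, by omega, ?_⟩
    rw [← s2]
    split_ifs <;> simp <;> omega
  · rintro σ' t ⟨j1, j2, j3, j4⟩
    rw [h12] at j1
    exact ⟨j1, j2, j3, j4⟩

/-- Compute `rankSum f m r`, where `r` is in register `37`, from the value index at the address in
register `19`, and put it into register `40`. -/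
def Cmd.rankSum : Cmd :=
  .op .add 38 19 11 ;; .op .add 38 38 13 ;; .const 40 0 ;; .op .add 41 11 40 ;; .countLe ;;
  .op .add 41 38 11 ;; .op .add 41 41 40 ;; .load 41 41 ;; .op .sub 42 11 40 ;;
  .op .mul 42 42 37 ;; .op .add 40 41 42

theorem rankSum_le_sum (f : ℕ → ℕ) (m r : ℕ) : rankSum f m r ≤ ∑ j ∈ Finset.range m, f j :=
  Finset.sum_le_sum fun _ _ => min_le_left _ _

theorem wp_rankSum {X r : ℕ} (hv : ValueIndex f m lg σ.mem X) (hm : m < 2 ^ lg)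
    (h11 : σ.reg 11 = m) (h12 : σ.reg 12 = lg) (h13 : σ.reg 13 = lg * m) (h19 : σ.reg 19 = X)
    (h37 : σ.reg 37 = r) (hB : 2 * m + 2 < B) (hBlg : lg < B)
    (hBX : X + m + lg * m + m + m < B) (hBf : ∑ j ∈ Finset.range m, f j < B) :
    WP S B L .rankSum σ fun σ' t => t ≤ lg * 22 + 15 ∧ σ'.mem = σ.mem ∧ Agree 38 σ σ' ∧
      σ'.reg 40 = rankSum f m r := by
  have hr := (rankSum_le_sum f m r).trans_lt hBf
  rw [← (hv.sorted lg le_rfl).rankSum_eq hm.le] at hr ⊢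
  simp [Cmd.rankSum, BinOp.eval, h11, h13, h19]
  refine ⟨by omega, by omega, by omega, by omega, ?_⟩
  refine (wp_countLe (f := f) (m := m) (lg := lg) (X := X) (l := lg) (g := 0) (r := r) ?_ hm le_rfl
    ?_ ?_ ?_ ?_ ?_ ?_ hB hBlg (by omega)).mono ?_
  · simpa using hv
  · simpa using h12
  · simpa using h19
  · simpa using h37
  · simp
  · simp
  · simp
    omega
  · rintro σ' t ⟨j1, j2, j3, j4⟩
    have e11 := j3 11 (by omega)
    have e37 := j3 37 (by omega)
    have e38 := j3 38 (by omega)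
    rw [block_zero_eq_range hm.le] at j4
    simp [h11, h37] at e11 e37 e38 j2 j3 j4
    have hc : ((Finset.range m).filter fun j => f j ≤ r).card ≤ m :=
      (Finset.card_filter_le _ _).trans (by simp)
    simp only [e11, e37, e38, j2, j4]
    rw [hv.sum _ hc]
    refine ⟨by omega, by omega, by omega, by omega, by omega, by omega, trivial, ?_, rfl⟩
    simpa using j3.mono (show 38 ≤ 40 by omega)

/-- Find the rank `r` for which the number `i` in register `22` lies between `rankSum f m r` and
`rankSum f m (r + 1)`, and put it into register `30`. -/
def Cmd.findRank : Cmd :=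
  .const 30 0 ;; .op .add 31 10 30 ;;
  .bsearch 30 (.const 37 1 ;; .op .add 37 33 37 ;; .rankSum ;; .op .lt 36 22 40 ;;
    .const 40 1 ;; .op .sub 36 40 36)

/-- The search runs over the ranks from `0` to `n`, for which `lg` rounds suffice, and each round
evaluates `rankSum` in `O(lg)` time. -/
theorem wp_findRank {X n r : ℕ} (hv : ValueIndex f m lg σ.mem X) (hm : m < 2 ^ lg)
    (hn : n < 2 ^ lg) (h10 : σ.reg 10 = n)
    (h11 : σ.reg 11 = m) (h12 : σ.reg 12 = lg) (h13 : σ.reg 13 = lg * m) (h19 : σ.reg 19 = X)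
    (hr : r ≤ n) (hri : ∀ x, rankSum f m (x + 1) ≤ σ.reg 22 ↔ x < r)
    (hB : 2 * m + 2 < B) (hBlg : lg < B) (hBn : 2 * n + 2 < B)
    (hBX : X + m + lg * m + m + m < B) (hBf : ∑ j ∈ Finset.range m, f j < B) :
    WP S B L .findRank σ fun σ' t => t ≤ lg * (lg * 22 + 35) + 7 ∧ σ'.mem = σ.mem ∧
      Agree 30 σ σ' ∧ σ'.reg 30 = r := by
  simp [Cmd.findRank, BinOp.eval, h10]
  refine ⟨by omega, by omega, ?_⟩
  refine (wp_bsearch (T := lg * 22 + 20) (c := r) (by omega) ?_ ?_ ?_ ?_ ?_ ?_).mono ?_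
  · simp
  · simpa using hr
  · simpa [h12] using hn
  · simpa using hBn
  · simpa [h12] using hBlg
  · intro σ' i1 i2 i3 i4
    simp at i1 i2 i3 i4
    have e11 := i2 11 (by omega)
    have e12 := i2 12 (by omega)
    have e13 := i2 13 (by omega)
    have e19 := i2 19 (by omega)
    have e22 := i2 22 (by omega)
    simp [BinOp.eval]
    refine ⟨by omega, by omega, ?_⟩
    refine (wp_rankSum (f := f) (m := m) (lg := lg) (X := X) (r := σ'.reg 33 + 1) ?_ hm ?_ ?_ ?_ ?_
      ?_ hB hBlg hBX hBf).mono ?_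
    · simpa [i1] using hv
    · simpa [e11] using h11
    · simpa [e12] using h12
    · simpa [e13] using h13
    · simpa [e19] using h19
    · simp
    · rintro σ'' t ⟨j1, j2, j3, j4⟩
      have f22 := j3 22 (by omega)
      simp [e22] at f22
      simp [f22, j4, ← hri]
      simp at j2 j3
      refine ⟨by split_ifs <;> omega, by omega, by omega, by omega, by rw [j2, i1], ?_⟩
      refine ⟨by simpa using j3.mono (show 36 ≤ 38 by omega), ?_⟩
      split_ifs <;> simp <;> omega
  · rintro σ' t ⟨j1, j2, j3, j4⟩
    simp [h12] at j1 j2 j3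
    refine ⟨?_, j2, j3, j4⟩
    rw [show lg * 22 + 20 + 15 = lg * 22 + 35 by omega] at j1
    omega

/-- Find the index `j` with `r < f j` that is preceded by exactly `i` such indices, where `r` is in
register `23` and `i` in register `24`, and put it into register `28`. -/
def Cmd.select : Cmd :=
  .const 34 0 ;; .op .add 37 23 34 ;; .op .add 25 12 34 ;; .op .add 28 34 34 ;;
  .op .add 29 24 34 ;; .op .add 26 18 34 ;; .op .add 27 19 11 ;; .op .add 27 27 13 ;;
  .down 25 35 (
    .const 35 2 ;; .op .div 26 26 35 ;; .op .sub 27 27 11 ;; .op .mul 28 28 35 ;;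
    .op .mul 40 28 26 ;; .op .add 41 40 26 ;;
    .op .sub 42 40 11 ;; .op .sub 40 40 42 ;; .op .sub 42 41 11 ;; .op .sub 41 41 42 ;;
    .const 34 0 ;; .op .sub 33 41 40 ;; .op .add 36 40 34 ;; .op .add 38 27 34 ;;
    .countLe ;;
    .op .add 33 33 36 ;; .op .sub 33 33 40 ;; .op .lt 32 29 33 ;;
    .ite 32 .skip (.op .sub 29 29 33 ;; .const 34 1 ;; .op .add 28 28 34))

theorem card_filter_range_add_block {l g : ℕ} (p : ℕ → Prop) [DecidablePred p] :
    ((Finset.range (min (g * 2 ^ l + 2 ^ l) m)).filter p).card =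
      ((Finset.range (min (g * 2 ^ l) m)).filter p).card + ((block m l g).filter p).card := by
  have h : Finset.range (min (g * 2 ^ l + 2 ^ l) m) =
      Finset.range (min (g * 2 ^ l) m) ∪ block m l g := by
    ext x
    rw [block_eq_Ico]
    simp only [Finset.mem_union, Finset.mem_range, Finset.mem_Ico]
    have : 0 < 2 ^ l := by positivity
    omega
  rw [h, Finset.filter_union, Finset.card_union_of_disjoint]
  refine Finset.disjoint_filter_filter ?_
  rw [Finset.disjoint_left]
  intro x h1 h2
  rw [block_eq_Ico, Finset.mem_Ico] at h2
  rw [Finset.mem_range] at h1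
  omega

theorem card_filter_le_add_card_filter_lt (s : Finset ℕ) (f : ℕ → ℕ) (r : ℕ) :
    (s.filter fun j => f j ≤ r).card + (s.filter fun j => r < f j).card = s.card := by
  have := Finset.card_filter_add_card_filter_not (s := s) (fun j => f j ≤ r)
  simpa only [not_le] using this

set_option maxHeartbeats 1000000 in
theorem wp_select {X r i : ℕ} (hv : ValueIndex f m lg σ.mem X) (hm : m < 2 ^ lg)
    (h11 : σ.reg 11 = m) (h12 : σ.reg 12 = lg) (h13 : σ.reg 13 = lg * m) (h18 : σ.reg 18 = 2 ^ lg)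
    (h19 : σ.reg 19 = X) (h23 : σ.reg 23 = r) (h24 : σ.reg 24 = i) (hi : i < countGt f m r)
    (hB : 2 * m + 2 * 2 ^ lg + 4 < B) (hBr : r < B)
    (hBX : X + m + lg * m + m + m < B) :
    WP S B L .select σ fun σ' t => t ≤ lg * (lg * 22 + 40) + 10 ∧ σ'.mem = σ.mem ∧
      Agree 25 σ σ' ∧ σ'.reg 28 < m ∧ r < f (σ'.reg 28) ∧
        ((Finset.range (σ'.reg 28)).filter fun j => r < f j).card = i := by
  have hlg : lg < 2 ^ lg := Nat.lt_two_pow_self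
  have him : countGt f m r ≤ m := (Finset.card_filter_le _ _).trans (by simp)
  simp [Cmd.select, BinOp.eval, h11, h12, h13, h18, h19, h23, h24]
  refine ⟨by omega, by omega, by omega, by omega, by omega, by omega, by omega,
    by omega, ?_⟩
  -- Descent in the tree of dyadic blocks. Register `28` holds the current block of level `l` and
  -- register `29` the number of hits (indices with `r < f j`) to be skipped inside it: together
  -- with the hits before the block this makes `i`, and the block has more hits than that.
  refine (wp_down (N := lg) (T := lg * 22 + 37) (fun l σ' => l ≤ lg ∧ σ'.mem = σ.mem ∧
    Agree 25 σ σ' ∧ σ'.reg 37 = r ∧ σ'.reg 26 = 2 ^ l ∧ σ'.reg 27 = X + m + l * m ∧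
    σ'.reg 28 * 2 ^ l ≤ m ∧
    ((Finset.range (min (σ'.reg 28 * 2 ^ l) m)).filter fun j => r < f j).card + σ'.reg 29 = i ∧
    σ'.reg 29 < ((block m l (σ'.reg 28)).filter fun j => r < f j).card)
    (by omega) (by omega) (by omega) ?_ ?_ ?_).mono ?_
  · simp
  · refine ⟨le_rfl, by simp, by simp, by simp, by simp, by simp, by simp, by simp, ?_⟩
    simp [block_zero_eq_range hm.le]
    exact hi
  · rintro l hl σ' h25 ⟨i0, i1, i2, i3, i4, i5, i6, i7, i8⟩
    have e11 := i2 11 (by omega)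
    have e12 := i2 12 (by omega)
    have e19 := i2 19 (by omega)
    have hdiv : 2 ^ (l + 1) / 2 = 2 ^ l := by rw [pow_succ]; omega
    have hsub : X + m + (l + 1) * m - m = X + m + l * m := by rw [Nat.succ_mul]; omega
    simp [BinOp.eval, i4, i5, e11, h11, hdiv, hsub, Nat.sub_sub_eq_min]
    generalize σ'.reg 28 = g at *
    obtain ⟨k, hk⟩ : ∃ k, σ'.reg 29 = k := ⟨_, rfl⟩
    rw [hk] at i7 i8
    have hg : g * 2 ^ (l + 1) = g * 2 * 2 ^ l := by ring
    rw [hg] at i6 i7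
    have hlm : (l + 1) * m ≤ lg * m := Nat.mul_le_mul_right _ i0
    have hlm' : (l + 1) * m = l * m + m := by ring
    have hq : 2 ^ l ≤ 2 ^ lg := Nat.pow_le_pow_right (by omega) (by omega)
    have hq₀ : 0 < 2 ^ l := by positivity
    have hq₁ : g * 2 ≤ g * 2 * 2 ^ l := Nat.le_mul_of_pos_right _ hq₀
    refine ⟨by omega, by omega, by omega, by omega, by omega, by omega, by omega, by omega,
      by omega, by omega, by omega, by omega, by omega, by omega, ?_⟩
    refine (wp_countLe (f := f) (m := m) (lg := lg) (X := X) (l := l) (g := g * 2) (r := r) ?_ hm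
      (by omega) ?_ ?_ ?_ ?_ ?_ ?_ (by omega) (by omega) (by omega)).mono ?_
    · simpa [i1] using hv
    · simp [e12, h12]
    · simp [e19, h19]
    · simpa using i3
    · simp
    · simp
    · simp
    · rintro σ'' t ⟨j1, j2, j3, j4⟩
      have f25 := j3 25 (by omega)
      have f26 := j3 26 (by omega)
      have f27 := j3 27 (by omega)
      have f28 := j3 28 (by omega)
      have f29 := j3 29 (by omega)
      have f33 := j3 33 (by omega)
      have f36 := j3 36 (by omega)
      have f37 := j3 37 (by omega)
      have a25 : Agree 25 σ σ'' := i2.trans (by simpa using j3.mono (show 25 ≤ 40 by omega))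
      simp [i1, i3, hk] at f25 f26 f27 f28 f29 f33 f36 f37 j2
      clear j3
      have hcard := card_filter_le_add_card_filter_lt (block m l (g * 2)) f r
      rw [card_block] at hcard
      have hsplit := card_filter_block_succ (m := m) (l := l) (g := g) fun j => r < f j
      rw [mul_comm 2 g] at hsplit
      have hrange := card_filter_range_add_block (m := m) (l := l) (g := g * 2) fun j => r < f j
      have hmin : min (g * 2 * 2 ^ l) m = g * 2 * 2 ^ l := by omega
      simp only [f25, f26, f27, f28, f29, f33, f36, f37, j2, j4, a25]
      -- The hits in the left child are its length minus the number of values up to `r`.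
      have hgt : min (g * 2 * 2 ^ l + 2 ^ l) m - min (g * 2 * 2 ^ l) m + min (g * 2 * 2 ^ l) m -
          (min (g * 2 * 2 ^ l) m + ((block m l (g * 2)).filter fun j => f j ≤ r).card) =
          ((block m l (g * 2)).filter fun j => r < f j).card := by omega
      rw [hgt]
      refine ⟨by omega, by omega, by split_ifs <;> omega, ?_, ?_⟩
      · intro hlt
        exact ⟨by omega, trivial, by omega, trivial, trivial, trivial, trivial, trivial, i6, i7, hlt⟩
      · intro hge
        have hpos : 0 < ((block m l (g * 2 + 1)).filter fun j => r < f j).card := by omega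
        have hsucc : (g * 2 + 1) * 2 ^ l = g * 2 * 2 ^ l + 2 ^ l := by ring
        -- The right child contains a hit, so it starts below `m` and its start is not clipped.
        have hle : (g * 2 + 1) * 2 ^ l ≤ m := by
          obtain ⟨y, hy⟩ := Finset.card_pos.1 hpos
          rw [Finset.mem_filter, mem_block_iff, div_two_pow_eq_iff] at hy
          omega
        refine ⟨by omega, by omega, by omega, by omega, trivial, by omega, trivial, trivial, trivial,
          trivial, trivial, hle, ?_, by omega⟩
        rw [hsucc, hrange]
        omega
  · rintro σ' t ⟨j1, -, -, j2, j3, -, -, -, j4, j5, j6⟩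
    -- On level `0` the block has at most one index. It contains a hit, so this index exists,
    -- exceeds `r`, and nothing is left to be skipped.
    have hlt : σ'.reg 28 < m := by
      by_contra hc
      have : block m 0 (σ'.reg 28) = ∅ := by
        rw [block_eq_Ico, Finset.Ico_eq_empty]
        simp
        omega
      rw [this] at j6
      simp at j6
    rw [block_zero hlt, Finset.filter_singleton] at j6
    rw [pow_zero, mul_one, min_eq_left hlt.le] at j5
    refine ⟨?_, j2, j3, hlt, ?_, ?_⟩
    · rw [show lg * 22 + 37 + 3 = lg * 22 + 40 by omega] at j1
      omega
    · by_contra hc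
      rw [if_neg hc] at j6
      simp at j6
    · have : σ'.reg 29 < 1 := j6.trans_le (by split_ifs <;> simp)
      omega

end Select

/-! ### The query program -/

section Query

variable {α : Type*} [LinearOrder α] {S : List α} {B L : ℕ} {σ : State} {f g : ℕ → ℕ} {m lg n : ℕ}

/-- Find, in the value index at the address in register `19`, the entry that belongs to the number
in register `22`. The entries of every rank are counted forwards if register `21` is not `0`, and
backwards otherwise. The rank, the index among the entries of this rank and the index of the value
are put into the registers `23`, `24` and `28`. -/
def Cmd.locate : Cmd :=
  .findRank ;; .const 31 0 ;; .op .add 23 30 31 ;;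
  .ite 21 (.op .add 37 23 31 ;; .rankSum ;; .op .sub 24 22 40)
    (.const 31 1 ;; .op .add 37 23 31 ;; .rankSum ;; .op .sub 24 40 22 ;; .op .sub 24 24 31) ;;
  .select

/-- Read from the end, the increasing half is `I_0, I_1, …`, each array reversed. The rank is
therefore found by the same inequalities as forwards, and only the index inside `T_r` is mirrored,
to `rankSum f m (r + 1) - i - 1`. -/
theorem wp_locate {X i : ℕ} (hv : ValueIndex f m lg σ.mem X) (hm : m < 2 ^ lg)
    (hn : n < 2 ^ lg) (hf : ∀ j < m, f j ≤ n) (h10 : σ.reg 10 = n)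
    (h11 : σ.reg 11 = m) (h12 : σ.reg 12 = lg) (h13 : σ.reg 13 = lg * m) (h18 : σ.reg 18 = 2 ^ lg)
    (h19 : σ.reg 19 = X) (h22 : σ.reg 22 = i) (hi : i < ∑ j ∈ Finset.range m, f j)
    (hB : 2 * m + 2 * 2 ^ lg + 4 < B) (hBn : 2 * n + 2 < B)
    (hBX : X + m + lg * m + m + m < B) (hBf : ∑ j ∈ Finset.range m, f j < B) :
    WP S B L .locate σ fun σ' t => t ≤ lg * (lg * 44 + 97) + 45 ∧ σ'.mem = σ.mem ∧
      Agree 22 σ σ' ∧ σ'.reg 28 < m ∧ σ'.reg 23 < n ∧ σ'.reg 23 < f (σ'.reg 28) ∧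
      ((Finset.range (σ'.reg 28)).filter fun j => σ'.reg 23 < f j).card = σ'.reg 24 ∧
      (σ.reg 21 ≠ 0 → rankSum f m (σ'.reg 23) + σ'.reg 24 = i) ∧
      (σ.reg 21 = 0 → σ'.reg 24 + i + 1 = rankSum f m (σ'.reg 23 + 1)) := by
  have hlg : lg < 2 ^ lg := Nat.lt_two_pow_self
  obtain ⟨r, hrn, hri⟩ := exists_rank hf hi
  have hr₁ : rankSum f m r ≤ i := by
    rcases r with _ | r
    · rw [rankSum_zero]
      omega
    · exact (hri r).2 (Nat.lt_succ_self r)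
  have hr₂ : i < rankSum f m (r + 1) := not_le.1 ((hri r).not.2 (lt_irrefl r))
  have hr₃ := rankSum_succ f m r
  rw [← h22] at hri
  rw [Cmd.locate]
  refine WP.seq (wp_findRank hv hm hn h10 h11 h12 h13 h19 hrn.le hri (by omega) (by omega) hBn hBX
    hBf) ?_
  rintro σ₁ t₁ ⟨j1, j2, j3, j4⟩
  have e11 := j3 11 (by omega)
  have e12 := j3 12 (by omega)
  have e13 := j3 13 (by omega)
  have e18 := j3 18 (by omega)
  have e19 := j3 19 (by omega)
  have e21 := j3 21 (by omega)
  have e22 := j3 22 (by omega)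
  have key : ∀ {σ₂ : State} {t₂ k : ℕ}, t₂ ≤ lg * 22 + 22 → σ₂.mem = σ.mem → Agree 22 σ σ₂ →
      σ₂.reg 23 = r → σ₂.reg 24 = k → k < countGt f m r →
      (σ.reg 21 ≠ 0 → rankSum f m r + k = i) →
      (σ.reg 21 = 0 → k + i + 1 = rankSum f m (r + 1)) →
      WP S B L .select σ₂ fun σ' t => t₁ + (1 + (1 + (t₂ + t))) ≤ lg * (lg * 44 + 97) + 45 ∧
        σ'.mem = σ.mem ∧ Agree 22 σ σ' ∧ σ'.reg 28 < m ∧ σ'.reg 23 < n ∧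
        σ'.reg 23 < f (σ'.reg 28) ∧
        ((Finset.range (σ'.reg 28)).filter fun j => σ'.reg 23 < f j).card = σ'.reg 24 ∧
        (σ.reg 21 ≠ 0 → rankSum f m (σ'.reg 23) + σ'.reg 24 = i) ∧
        (σ.reg 21 = 0 → σ'.reg 24 + i + 1 = rankSum f m (σ'.reg 23 + 1)) := by
    intro σ₂ t₂ k k1 k2 k3 k4 k5 k6 k7 k8
    refine (wp_select (f := f) (m := m) (lg := lg) (X := X) (r := r) (i := k) (k2 ▸ hv) hm
      ((k3 11 (by omega)).trans h11) ((k3 12 (by omega)).trans h12) ((k3 13 (by omega)).trans h13)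
      ((k3 18 (by omega)).trans h18) ((k3 19 (by omega)).trans h19) k4 k5 k6 hB (by omega)
      hBX).mono ?_
    rintro σ₃ t₃ ⟨l1, l2, l3, l4, l5, l6⟩
    have f23 := l3 23 (by omega)
    have f24 := l3 24 (by omega)
    rw [f23, f24, k4, k5]
    refine ⟨?_, l2.trans k2, k3.trans (l3.mono (by omega)), l4, hrn, l5, l6, k7, k8⟩
    have : lg * (lg * 22 + 35) + lg * 22 + lg * (lg * 22 + 40) = lg * (lg * 44 + 97) := by ring
    omega
  have hsum : ∀ {σ₂ : State} {x : ℕ}, σ₂.mem = σ.mem → Agree 22 σ σ₂ → σ₂.reg 37 = x →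
      WP S B L .rankSum σ₂ fun σ' t => t ≤ lg * 22 + 15 ∧ σ'.mem = σ₂.mem ∧ Agree 38 σ₂ σ' ∧
        σ'.reg 40 = rankSum f m x := fun k2 k3 k4 =>
    wp_rankSum (k2 ▸ hv) hm
      ((k3 11 (by omega)).trans h11) ((k3 12 (by omega)).trans h12) ((k3 13 (by omega)).trans h13)
      ((k3 19 (by omega)).trans h19) k4 (by omega) (by omega) hBX hBf
  have hF := (rankSum_le_sum f m (r + 1)).trans_lt hBf
  simp [BinOp.eval, j4, e21]
  refine ⟨by omega, by omega, ?_, ?_⟩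
  · intro h21
    refine ⟨by omega, (hsum (x := r) ?_ ?_ ?_).mono ?_⟩
    · simpa using j2
    · simpa using j3.mono (show 22 ≤ 30 by omega)
    · simp
    · rintro σ₂ t₂ ⟨k1, k2, k3, k4⟩
      have f22 := k3 22 (by omega)
      have f23 := k3 23 (by omega)
      have f21 : Agree 22 σ σ₂ := (j3.mono (by omega)).trans
        (by simpa using k3.mono (show 22 ≤ 38 by omega))
      simp [j2, e22, h22] at f22 f23 k2
      simp [f22, k4]
      refine ⟨by omega, ?_⟩
      refine (key (σ₂ := σ₂.setReg 24 (i - rankSum f m r)) (t₂ := 1 + (t₂ + 1) + 1)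
        (k := i - rankSum f m r) (by omega) (by simpa using k2) (by simpa using f21) (by simpa using f23)
        (by simp) (by omega) (by omega) (by omega)).mono ?_
      rintro σ₃ t₃ h
      simpa [h21] using h
  · intro h21
    refine ⟨by omega, by omega, (hsum (x := r + 1) ?_ ?_ ?_).mono ?_⟩
    · simpa using j2
    · simpa using j3.mono (show 22 ≤ 30 by omega)
    · simp
    · rintro σ₂ t₂ ⟨k1, k2, k3, k4⟩
      have f22 := k3 22 (by omega)
      have f23 := k3 23 (by omega)
      have f31 := k3 31 (by omega)
      have f21 : Agree 22 σ σ₂ := (j3.mono (by omega)).trans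
        (by simpa using k3.mono (show 22 ≤ 38 by omega))
      simp [j2, e22, h22] at f22 f23 f31 k2
      simp [f22, f31, k4]
      refine ⟨by omega, by omega, ?_⟩
      refine (key (σ₂ := (σ₂.setReg 24 (rankSum f m (r + 1) - i)).setReg 24
          (rankSum f m (r + 1) - i - 1)) (t₂ := 1 + (1 + (t₂ + (1 + 1))) + 1)
        (k := rankSum f m (r + 1) - i - 1) (by omega) (by simpa using k2) (by simpa using f21)
        (by simpa using f23) (by simp) (by omega) (by omega) (by omega)).mono ?_
      rintro σ₃ t₃ h
      simpa [h21] using h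

/-- Load the sum of all the values of the value index at the address in register `19` into
register `31`. -/
def Cmd.loadTotal : Cmd :=
  .op .add 31 19 11 ;; .op .add 31 31 13 ;; .op .add 31 31 11 ;; .op .add 31 31 11 ;; .load 31 31

theorem ValueIndex.total {μ : ℕ → ℕ} {X : ℕ} (h : ValueIndex f m lg μ X) :
    μ (X + m + lg * m + m + m) = ∑ j ∈ Finset.range m, f j := by
  rw [h.sum m le_rfl, (h.sorted lg le_rfl).sum_eq (valueKey_injOn f _)]

/-- Choose the value index that holds the entry with index in register `0`: the one at the address in
register `14` comes first, and the one at the address in register `15` is read backwards. -/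
def Cmd.chooseIndex : Cmd :=
  .const 30 0 ;; .op .add 19 14 30 ;; .loadTotal ;; .op .add 22 0 30 ;; .op .lt 21 22 31 ;;
  .ite 21 .skip (.op .sub 22 22 31 ;; .op .add 19 15 30 ;; .loadTotal ;; .op .sub 22 31 22 ;;
    .const 30 1 ;; .op .sub 22 22 30)

/-- In the second case register `22` gets the number of entries of `A_w` that follow entry `i`. -/
theorem wp_chooseIndex {X Y i : ℕ} (hX : ValueIndex f m lg σ.mem X)
    (hY : ValueIndex g m lg σ.mem Y) (h0 : σ.reg 0 = i)
    (h11 : σ.reg 11 = m) (h13 : σ.reg 13 = lg * m) (h14 : σ.reg 14 = X) (h15 : σ.reg 15 = Y)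
    (hi : i < ∑ j ∈ Finset.range m, f j + ∑ j ∈ Finset.range m, g j) (hB : 1 < B)
    (hBi : i < B)
    (hBX : X + m + lg * m + m + m < B) (hBY : Y + m + lg * m + m + m < B)
    (hBg : ∑ j ∈ Finset.range m, g j < B) :
    WP S B L .chooseIndex σ fun σ' t => t ≤ 30 ∧ σ'.mem = σ.mem ∧ Agree 19 σ σ' ∧
      ((i < ∑ j ∈ Finset.range m, f j ∧ σ'.reg 21 ≠ 0 ∧ σ'.reg 19 = X ∧ σ'.reg 22 = i) ∨
      (∑ j ∈ Finset.range m, f j ≤ i ∧ σ'.reg 21 = 0 ∧ σ'.reg 19 = Y ∧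
        σ'.reg 22 + i + 1 = ∑ j ∈ Finset.range m, f j + ∑ j ∈ Finset.range m, g j)) := by
  have hf := hX.total
  have hg := hY.total
  generalize ∑ j ∈ Finset.range m, f j = F at *
  generalize ∑ j ∈ Finset.range m, g j = G at *
  simp only [Cmd.chooseIndex, Cmd.loadTotal, wp_seq, wp_ite, wp_skip, wp_const, wp_op, wp_load,
    BinOp.eval]
  simp [h0, h11, h13, h14, h15, hf, hg, ite_one_zero_lt hB]
  refine ⟨by omega, by omega, by omega, by omega, by omega, by omega, by omega, fun h => Or.inl h, fun h => ?_⟩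
  · refine ⟨by omega, by omega, by omega, by omega, by omega, by omega, by omega, by omega, by omega, ?_⟩
    exact Or.inr ⟨h, by omega⟩

/-- Collect the answer to a query from the registers `23`, `24` and `28`. -/
def Cmd.output : Cmd :=
  .const 30 3 ;; .op .mul 31 30 11 ;; .op .add 31 31 13 ;; .op .add 31 31 28 ;; .load 31 31 ;;
  .op .mul 31 31 30 ;; .load 3 31 ;; .const 30 1 ;; .op .add 31 31 30 ;; .load 4 31 ;;
  .op .add 31 31 30 ;; .load 5 31 ;; .const 30 0 ;; .op .add 1 23 30 ;; .op .add 2 24 30 ;;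
  .op .mul 30 23 5 ;; .op .sub 0 4 30

theorem wp_output {c : ℕ} (h11 : σ.reg 11 = m) (h13 : σ.reg 13 = lg * m)
    (hc : σ.mem (3 * m + lg * m + σ.reg 28) = c) (hB : 3 < B)
    (hBm : 3 * m + lg * m + σ.reg 28 < B) (hBc : 3 * c + 2 < B) (hB₂₃ : σ.reg 23 < B)
    (hB₂₄ : σ.reg 24 < B) (hBp : σ.reg 23 * σ.mem (3 * c + 2) < B)
    (hBb : σ.mem (3 * c + 1) < B) :
    WP S B L .output σ fun σ' t => t ≤ 20 ∧ σ'.mem = σ.mem ∧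
      (∀ x, 10 ≤ x → x < 19 → σ'.reg x = σ.reg x) ∧ σ'.reg 1 = σ.reg 23 ∧ σ'.reg 2 = σ.reg 24 ∧
      σ'.reg 0 = σ.mem (3 * c + 1) - σ.reg 23 * σ.mem (3 * c + 2) ∧
      σ'.reg 3 = σ.mem (3 * c) ∧ σ'.reg 4 = σ.mem (3 * c + 1) ∧
      σ'.reg 5 = σ.mem (3 * c + 2) := by
  rw [mul_comm 3 c] at *
  simp only [Cmd.output, wp_seq, wp_const, wp_op, wp_load, BinOp.eval]
  simp [h11, h13, add_assoc]
  rw [add_assoc] at hc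
  simp [hc]
  refine ⟨by omega, by omega, by omega, by omega, by omega, by omega, by omega, by omega, by omega,
    by omega, by omega, by omega, by omega, ?_⟩
  intro x h1 h2
  simp [show x ≠ 0 by omega, show x ≠ 1 by omega, show x ≠ 2 by omega, show x ≠ 3 by omega,
    show x ≠ 4 by omega, show x ≠ 5 by omega, show x ≠ 30 by omega, show x ≠ 31 by omega]

/-- The answer to a look-up query. -/
def Cmd.query : Cmd := .chooseIndex ;; .locate ;; .output

/-- The last alternative is additive to avoid truncated subtraction: before `I_r` there are all
decreasing entries and the increasing entries of rank above `r`, whose number is `∑ g - rankSum g m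
(r + 1)`. -/
theorem wp_query {X Y i : ℕ} {π : ℕ → ℕ} (hX : ValueIndex f m lg σ.mem X)
    (hY : ValueIndex g m lg σ.mem Y) (hm : m < 2 ^ lg) (hn : n < 2 ^ lg)
    (hf : ∀ j < m, f j ≤ n) (hg : ∀ j < m, g j ≤ n)
    (hπ : ∀ j < m, σ.mem (3 * m + lg * m + j) = π j) (hπm : ∀ j < m, π j < m)
    (hp : ∀ c < m, σ.mem (3 * c + 2) ≤ n) (hb : ∀ c < m, σ.mem (3 * c + 1) ≤ n)
    (h0 : σ.reg 0 = i) (h10 : σ.reg 10 = n)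
    (h11 : σ.reg 11 = m) (h12 : σ.reg 12 = lg) (h13 : σ.reg 13 = lg * m) (h14 : σ.reg 14 = X)
    (h15 : σ.reg 15 = Y) (h18 : σ.reg 18 = 2 ^ lg)
    (hi : i < ∑ j ∈ Finset.range m, f j + ∑ j ∈ Finset.range m, g j) (hBi : i < B)
    (hB : 2 * m + 2 * 2 ^ lg + 4 < B) (hBm : 4 * m + lg * m < B) (hBn : 2 * n + 2 < B)
    (hBnn : n * n < B)
    (hBX : X + m + lg * m + m + m < B) (hBY : Y + m + lg * m + m + m < B)
    (hBf : ∑ j ∈ Finset.range m, f j < B) (hBg : ∑ j ∈ Finset.range m, g j < B) :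
    WP S B L .query σ fun σ' t => t ≤ lg * (lg * 44 + 97) + 100 ∧ σ'.mem = σ.mem ∧
      (∀ x, 10 ≤ x → x < 19 → σ'.reg x = σ.reg x) ∧ ∃ j < m, σ'.reg 1 < n ∧
      σ'.reg 0 = σ.mem (3 * π j + 1) - σ'.reg 1 * σ.mem (3 * π j + 2) ∧
      σ'.reg 3 = σ.mem (3 * π j) ∧ σ'.reg 4 = σ.mem (3 * π j + 1) ∧
      σ'.reg 5 = σ.mem (3 * π j + 2) ∧
      ((i < ∑ j ∈ Finset.range m, f j ∧ σ'.reg 1 < f j ∧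
        ((Finset.range j).filter fun x => σ'.reg 1 < f x).card = σ'.reg 2 ∧
        rankSum f m (σ'.reg 1) + σ'.reg 2 = i) ∨
      (∑ j ∈ Finset.range m, f j ≤ i ∧ σ'.reg 1 < g j ∧
        ((Finset.range j).filter fun x => σ'.reg 1 < g x).card = σ'.reg 2 ∧
        i + rankSum g m (σ'.reg 1 + 1) =
          ∑ j ∈ Finset.range m, f j + ∑ j ∈ Finset.range m, g j + σ'.reg 2)) := by
  have hlg : lg < 2 ^ lg := Nat.lt_two_pow_self
  rw [Cmd.query]
  refine WP.seq (wp_chooseIndex hX hY h0 h11 h13 h14 h15 hi (by omega) hBi hBX hBY hBg) ?_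
  rintro σ₁ t₁ ⟨j1, j2, j3, j4⟩
  have e10 := (j3 10 (by omega)).trans h10
  have e11 := (j3 11 (by omega)).trans h11
  have e12 := (j3 12 (by omega)).trans h12
  have e13 := (j3 13 (by omega)).trans h13
  have e18 := (j3 18 (by omega)).trans h18
  have key : ∀ {σ₂ : State} {t₂ : ℕ}, t₂ ≤ lg * (lg * 44 + 97) + 45 → σ₂.mem = σ₁.mem →
      Agree 19 σ₁ σ₂ → σ₂.reg 28 < m → σ₂.reg 23 < n → σ₂.reg 24 ≤ m →
      WP S B L .output σ₂ fun σ' t =>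
        t₁ + (t₂ + t) ≤ lg * (lg * 44 + 97) + 100 ∧ σ'.mem = σ.mem ∧
        (∀ x, 10 ≤ x → x < 19 → σ'.reg x = σ.reg x) ∧ σ'.reg 1 = σ₂.reg 23 ∧
        σ'.reg 2 = σ₂.reg 24 ∧
        σ'.reg 0 = σ.mem (3 * π (σ₂.reg 28) + 1) - σ₂.reg 23 * σ.mem (3 * π (σ₂.reg 28) + 2) ∧
        σ'.reg 3 = σ.mem (3 * π (σ₂.reg 28)) ∧ σ'.reg 4 = σ.mem (3 * π (σ₂.reg 28) + 1) ∧
        σ'.reg 5 = σ.mem (3 * π (σ₂.reg 28) + 2) := by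
    intro σ₂ t₂ k1 k2 k3 k4 k5 k6
    have hc := hπm _ k4
    have hrp : σ₂.reg 23 * σ.mem (3 * π (σ₂.reg 28) + 2) < B :=
      (Nat.mul_le_mul k5.le (hp _ hc)).trans_lt hBnn
    have hb' := hb _ hc
    refine (wp_output (m := m) (lg := lg) (c := π (σ₂.reg 28)) ((k3 11 (by omega)).trans e11)
      ((k3 13 (by omega)).trans e13) (by rw [k2, j2, hπ _ k4]) (by omega) (by omega) (by omega)
      (by omega) (by omega) (by rwa [k2, j2]) (by rw [k2, j2]; omega)).mono ?_
    rintro σ₃ t₃ ⟨l1, l2, l3, l4⟩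
    rw [k2, j2] at l4
    refine ⟨by omega, by rw [l2, k2, j2], fun x h1 h2 => ?_, l4⟩
    rw [l3 x h1 h2, k3 x h2, j3 x h2]
  have hcount : ∀ (h : ℕ → ℕ) (r j : ℕ), j < m →
      ((Finset.range j).filter fun x => r < h x).card ≤ m := fun h r j hj =>
    ((Finset.card_filter_le _ _).trans (by simp)).trans hj.le
  rcases j4 with ⟨hi', h21, h19, h22⟩ | ⟨hi', h21, h19, h22⟩
  · refine WP.seq (wp_locate (j2 ▸ hX) hm hn hf e10 e11 e12 e13 e18 h19 h22 hi' hB hBn hBX hBf) ?_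
    rintro σ₂ t₂ ⟨k1, k2, k3, k4, k5, k6, k7, k8, -⟩
    refine (key k1 k2 (k3.mono (by omega)) k4 k5 (k7 ▸ hcount _ _ _ k4)).mono ?_
    rintro σ₃ t₃ ⟨l1, l2, l3, l4, l5, l6, l7⟩
    rw [l4, l5]
    exact ⟨l1, l2, l3, σ₂.reg 28, k4, k5, l6, l7.1, l7.2.1, l7.2.2, Or.inl ⟨hi', k6, k7, k8 h21⟩⟩
  · refine WP.seq (wp_locate (j2 ▸ hY) hm hn hg e10 e11 e12 e13 e18 h19 rfl (by omega) hB hBn hBY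
      hBg) ?_
    rintro σ₂ t₂ ⟨k1, k2, k3, k4, k5, k6, k7, -, k8⟩
    refine (key k1 k2 (k3.mono (by omega)) k4 k5 (k7 ▸ hcount _ _ _ k4)).mono ?_
    rintro σ₃ t₃ ⟨l1, l2, l3, l4, l5, l6, l7⟩
    rw [l4, l5]
    have := k8 h21
    exact ⟨l1, l2, l3, σ₂.reg 28, k4, k5, l6, l7.1, l7.2.1, l7.2.2,
      Or.inr ⟨hi', k6, k7, by omega⟩⟩

end Query

/-! ### The stages of the preprocessing -/

section Preprocess

variable {α : Type*} [LinearOrder α] {S : List α} {B L : ℕ} {σ : State} {m lg : ℕ}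

/-- The number of binary digits. -/
def bitCount (v : ℕ) : ℕ := if v = 0 then 0 else Nat.log 2 v + 1

theorem bitCount_eq {v : ℕ} (hv : v ≠ 0) : bitCount v = bitCount (v / 2) + 1 := by
  rw [bitCount, if_neg hv, bitCount]
  split_ifs with h
  · rw [Nat.log_of_lt (by omega)]
  · rw [Nat.log_of_one_lt_of_le (by omega) (by omega)]

/-- Count the binary digits of register `22` in register `12`, and double register `18` as
often. Register `21` holds `1`. -/
def Cmd.bitLoop : Cmd :=
  .loop 22 (.const 23 2 ;; .op .div 22 22 23 ;; .op .add 12 12 21 ;; .op .add 18 18 18)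

theorem wp_bitLoop (v : ℕ) : ∀ σ : State, σ.reg 22 = v → σ.reg 21 = 1 → 2 < B →
    v < B → σ.reg 12 + bitCount v < B → σ.reg 18 * 2 ^ bitCount v < B →
    WP S B L .bitLoop σ fun σ' t => t ≤ bitCount v * 5 + 1 ∧ σ'.mem = σ.mem ∧
      σ'.reg 12 = σ.reg 12 + bitCount v ∧ σ'.reg 18 = σ.reg 18 * 2 ^ bitCount v ∧
      ∀ x, x ≠ 12 → x ≠ 18 → x < 22 → σ'.reg x = σ.reg x := by
  induction v using Nat.strong_induction_on with
  | _ v ih =>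
    intro σ h22 h21 hB hBv hB₁₂ hB₁₈
    rcases Nat.eq_zero_or_pos v with rfl | hv
    · refine ⟨σ, 1, .loop_done h22, by simp, rfl, ?_, ?_, fun _ _ _ _ => rfl⟩ <;> simp [bitCount]
    · rw [bitCount_eq hv.ne'] at *
      have h2 : σ.reg 18 + σ.reg 18 ≤ σ.reg 18 * 2 ^ (bitCount (v / 2) + 1) := by
        rw [pow_succ]
        have : 1 ≤ 2 ^ bitCount (v / 2) := Nat.one_le_two_pow
        nlinarith
      have hbody : WP S B L (.const 23 2 ;; .op .div 22 22 23 ;; .op .add 12 12 21 ;;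
          .op .add 18 18 18) σ fun σ' t => t = 4 ∧ σ'.mem = σ.mem ∧ σ'.reg 22 = v / 2 ∧
          σ'.reg 21 = 1 ∧ σ'.reg 12 = σ.reg 12 + 1 ∧ σ'.reg 18 = σ.reg 18 + σ.reg 18 ∧
          ∀ x, x ≠ 12 → x ≠ 18 → x < 22 → σ'.reg x = σ.reg x := by
        simp [BinOp.eval, h22, h21]
        refine ⟨by omega, by omega, by omega, by omega, fun x h1 h2 h3 => ?_⟩
        simp [h1, h2, show x ≠ 22 by omega, show x ≠ 23 by omega]
      obtain ⟨σ₁, t₁, e₁, rfl, i1, i2, i3, i4, i5, i6⟩ := hbody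
      obtain ⟨σ₂, t₂, e₂, j1, j2, j3, j4, j5⟩ := ih (v / 2) (by omega) σ₁ i2 i3 hB (by omega)
        (by omega) (by rw [i5]; convert hB₁₈ using 1; ring)
      refine ⟨σ₂, 4 + t₂ + 1, .loop_step (by omega) e₁ e₂, by omega, by rw [j2, i1], by omega, ?_,
        fun x h1 h2 h3 => (j5 x h1 h2 h3).trans (i6 x h1 h2 h3)⟩
      rw [j4, i5]
      ring

/-- Set up the registers `10`, `11`, `12`, `13`, `16`, `17` and `18` from the input. -/
def Cmd.setup : Cmd :=
  .const 20 0 ;; .op .add 10 0 20 ;; .op .add 11 3 20 ;; .const 21 1 ;; .op .add 16 2 21 ;;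
  .const 22 2 ;; .load 22 22 ;; .op .sub 17 16 22 ;; .op .sub 16 16 1 ;;
  .const 12 0 ;; .const 18 1 ;; .op .add 22 0 20 ;; .bitLoop ;; .op .mul 13 12 11

/-- Halving `n` down to `0` replaces a logarithm instruction. Cell `2` of the input is the
difference of the first cluster, that is the period, so register `17` gets the position where the
last `per w` letters of `w` start. -/
theorem wp_setup {n s e m : ℕ} (h0 : σ.reg 0 = n) (h1 : σ.reg 1 = s) (h2 : σ.reg 2 = e)
    (h3 : σ.reg 3 = m) (hn : n ≠ 0) (hlg : lg = Nat.log 2 n + 1) (hB : 2 < B) (hBn : n < B)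
    (hBm : m < B) (hBe : e + 1 < B) (hBlg : 2 ^ lg < B) (hBlm : lg * m < B) :
    WP S B L .setup σ fun σ' t => t ≤ lg * 5 + 20 ∧ σ'.mem = σ.mem ∧ σ'.reg 10 = n ∧
      σ'.reg 11 = m ∧ σ'.reg 12 = lg ∧ σ'.reg 13 = lg * m ∧ σ'.reg 16 = e + 1 - s ∧
      σ'.reg 17 = e + 1 - σ.mem 2 ∧ σ'.reg 18 = 2 ^ lg := by
  have hbit : bitCount n = lg := by rw [bitCount, if_neg hn, hlg]
  have hlg' : lg < 2 ^ lg := Nat.lt_two_pow_self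
  simp [Cmd.setup, BinOp.eval, h0, h1, h2, h3]
  refine ⟨by omega, by omega, by omega, by omega, by omega, by omega, by omega, by omega,
    by omega, by omega, by omega, ?_⟩
  refine (wp_bitLoop (S := S) n _ ?_ ?_ hB hBn ?_ ?_).mono ?_
  · simp
  · simp
  · simp [hbit]
    omega
  · simpa [hbit] using hBlg
  · rintro σ' t ⟨j1, j2, j3, j4, j5⟩
    rw [hbit] at j1 j3 j4
    have e10 := j5 10 (by omega) (by omega) (by omega)
    have e11 := j5 11 (by omega) (by omega) (by omega)
    have e16 := j5 16 (by omega) (by omega) (by omega)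
    have e17 := j5 17 (by omega) (by omega) (by omega)
    simp at e10 e11 e16 e17 j2 j3 j4
    simp [e10, e11, e16, e17, j2, j3, j4]
    omega

/-- The size of the cluster with index `c` in the memory `μ`. -/
def sizeAt (μ : ℕ → ℕ) (c : ℕ) : ℕ := (μ (3 * c + 1) - μ (3 * c)) / μ (3 * c + 2) + 1

/-- The size of the cluster with index `π j` in the memory `μ`, or `0` if this cluster is not
decreasing. -/
noncomputable def decSize (S : List α) (len ws : ℕ) (μ π : ℕ → ℕ) (j : ℕ) : ℕ :=
  if S.drop (μ (3 * π j + 1) + len) < S.drop ws then sizeAt μ (π j) else 0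

/-- The size of the cluster with index `π j` in the memory `μ`, or `0` if this cluster is
decreasing. -/
noncomputable def incSize (S : List α) (len ws : ℕ) (μ π : ℕ → ℕ) (j : ℕ) : ℕ :=
  if S.drop (μ (3 * π j + 1) + len) < S.drop ws then 0 else sizeAt μ (π j)

/-- Fill the arrays at the addresses in the registers `14` and `15` with the sizes of the decreasing
and of the increasing clusters. -/
def Cmd.fillSizes : Cmd :=
  .const 29 0 ;; .op .add 24 11 29 ;;
  .down 24 29 (
    .op .add 25 20 13 ;; .op .add 25 25 24 ;; .load 25 25 ;; .const 26 3 ;; .op .mul 25 25 26 ;;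
    .load 27 25 ;; .const 26 1 ;; .op .add 25 25 26 ;; .load 28 25 ;; .op .add 25 25 26 ;;
    .load 26 25 ;; .op .sub 27 28 27 ;; .op .div 27 27 26 ;; .const 26 1 ;; .op .add 27 27 26 ;;
    .op .add 28 28 16 ;; .suffixLt 28 17 30 ;;
    .op .mul 31 27 30 ;; .op .sub 32 27 31 ;; .op .add 33 14 24 ;; .store 33 31 ;;
    .op .add 33 15 24 ;; .store 33 32)

set_option maxHeartbeats 800000 in
theorem wp_fillSizes {X Y len ws : ℕ} {μ π : ℕ → ℕ} (h10 : σ.reg 10 = S.length) (h11 : σ.reg 11 = m)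
    (h13 : σ.reg 13 = lg * m) (h14 : σ.reg 14 = X) (h15 : σ.reg 15 = Y) (h16 : σ.reg 16 = len)
    (h17 : σ.reg 17 = ws) (h20 : σ.reg 20 = 3 * m) (hX : 3 * m + lg * m + m ≤ X)
    (hXY : X + m ≤ Y) (hμ : ∀ x < 3 * m, σ.mem x = μ x)
    (hπ : ∀ j < m, σ.mem (3 * m + lg * m + j) = π j) (hπm : ∀ j < m, π j < m)
    (hb : ∀ c < m, μ (3 * c + 1) + len ≤ S.length) (hws : ws ≤ S.length)
    (hs : ∀ c < m, sizeAt μ c ≤ S.length) (hB : 2 * S.length + 4 < B) (hBY : Y + m < B) :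
    WP S B L .fillSizes σ fun σ' t => t ≤ m * (2 * L + 33) + 3 ∧ Agree 24 σ σ' ∧
      EqOff X (Y + m) σ.mem σ'.mem ∧
      (∀ j < m, σ'.mem (X + j) = decSize S len ws μ π j) ∧
      ∀ j < m, σ'.mem (Y + j) = incSize S len ws μ π j := by
  simp [Cmd.fillSizes, BinOp.eval, h11]
  refine ⟨by omega, by omega, ?_⟩
  refine (wp_down (N := m) (T := 2 * L + 30) (fun k σ' => Agree 24 σ σ' ∧
    EqOff X (Y + m) σ.mem σ'.mem ∧
    (∀ j < m, k ≤ j → σ'.mem (X + j) = decSize S len ws μ π j) ∧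
    ∀ j < m, k ≤ j → σ'.mem (Y + j) = incSize S len ws μ π j)
    (by omega) (by omega) (by omega) ?_ ?_ ?_).mono ?_
  · simp
  · exact ⟨by simp, EqOff.refl _ _ _, fun j _ _ => by omega, fun j _ _ => by omega⟩
  · rintro k hk σ' h24 ⟨i1, i2, i3, i4⟩
    have e10 := i1 10 (by omega)
    have e13 := i1 13 (by omega)
    have e14 := i1 14 (by omega)
    have e15 := i1 15 (by omega)
    have e16 := i1 16 (by omega)
    have e17 := i1 17 (by omega)
    have e20 := i1 20 (by omega)
    have hc := hπm k hk
    have hπk := (i2 (3 * m + lg * m + k) (by omega)).trans (hπ k hk)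
    have hdec : decSize S len ws μ π k =
      if S.drop (μ (3 * π k + 1) + len) < S.drop ws then
        sizeAt μ (π k) else 0 := rfl
    have hinc : incSize S len ws μ π k =
      if S.drop (μ (3 * π k + 1) + len) < S.drop ws then 0 else
        sizeAt μ (π k) := rfl
    generalize π k = c at *
    have ha := (i2 (3 * c) (by omega)).trans (hμ _ (by omega))
    have hb' := (i2 (3 * c + 1) (by omega)).trans (hμ _ (by omega))
    have hp := (i2 (3 * c + 2) (by omega)).trans (hμ _ (by omega))
    have hbc := hb c hc
    have hsc := hs c hc
    have hsz : (μ (3 * c + 1) - μ (3 * c)) / μ (3 * c + 2) + 1 = sizeAt μ c := rfl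
    have hdiv := Nat.div_le_self (μ (3 * c + 1) - μ (3 * c)) (μ (3 * c + 2))
    rw [mul_comm 3 c] at ha hb' hp
    simp [BinOp.eval, e13, e16, e20, h13, h16, h20, hπk, ha, hb', hp]
    rw [mul_comm c 3]
    rw [hsz]
    refine ⟨by omega, by omega, by omega, by omega, by omega, by omega, by omega, by omega,
      by omega, by omega, by omega, by omega, ?_⟩
    refine (wp_suffixLt (by omega) (by omega) (by omega) ?_ ?_ ?_ (by omega)).mono ?_
    · simp [e10, h10]
    · simpa using hbc
    · simp [e17, h17, hws]
    · rintro τ t ⟨j1, j2, j3, j4, j5⟩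
      have f14 := j3 14 (by omega)
      have f15 := j3 15 (by omega)
      have f24 := j3 24 (by omega)
      have f27 := j3 27 (by omega)
      have j3' := j3.mono (show 24 ≤ 30 by omega)
      simp [e14, e15, e17, h14, h15, h17] at f14 f15 f24 f27 j2 j3' j5
      simp [f14, f15, f24, f27, j2]
      clear j3
      -- The answer of the comparison is `0` or `1`, so a product selects the decreasing size
      -- without branching, and the difference from the size is the increasing one.
      have h1 : sizeAt μ c * τ.reg 30 = decSize S len ws μ π k := by
        rw [hdec]
        split_ifs with h
        · rw [show τ.reg 30 = 1 by have := j5.2 h; omega, mul_one]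
        · rw [show τ.reg 30 = 0 by by_contra h'; exact h (j5.1 h'), mul_zero]
      have h2 : sizeAt μ c - decSize S len ws μ π k =
          incSize S len ws μ π k := by
        rw [hdec, hinc]
        split_ifs <;> simp
      have h3 : decSize S len ws μ π k ≤ sizeAt μ c := by
        rw [hdec]
        split_ifs <;> simp
      rw [h1, h2]
      refine ⟨by omega, by omega, by omega, by omega, by omega, i1.trans j3',
        (i2.update (by omega) (by omega)).update (by omega) (by omega), fun j hj hkj => ?_,
        fun j hj hkj => ?_⟩
      · rw [Function.update_of_ne (by omega)]
        rcases hkj.eq_or_lt with rfl | h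
        · simp
        · rw [Function.update_of_ne (by omega), i3 j hj h]
      · rcases hkj.eq_or_lt with rfl | h
        · simp
        · rw [Function.update_of_ne (by omega), Function.update_of_ne (by omega), i4 j hj h]
  · rintro σ' t ⟨j1, -, j2, j3, j4, j5⟩
    refine ⟨?_, j2, j3, fun j hj => j4 j hj (Nat.zero_le _), fun j hj => j5 j hj (Nat.zero_le _)⟩
    rw [show 2 * L + 30 + 3 = 2 * L + 33 by omega] at j1
    omega

/-- Sort the clusters by their tails, and put into the registers `14` and `15` the addresses of the
arrays of the sizes. -/
def Cmd.sortClusters : Cmd :=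
  .const 22 3 ;; .op .mul 20 22 11 ;; .mergeSort .tailLt ;;
  .op .add 14 20 13 ;; .op .add 14 14 11 ;; .op .add 15 14 13 ;; .op .add 15 15 11 ;;
  .op .add 15 15 11 ;; .op .add 15 15 11 ;; .const 22 1 ;; .op .add 15 15 22

/-- Memory layout: `3 * m` cells for the clusters, `(lg + 1) * m` for the merge sort of the tails,
and then two value indices of `m + (lg + 1) * m + (m + 1)` cells each. -/
theorem wp_sortClusters {len : ℕ} (h10 : σ.reg 10 = S.length) (h11 : σ.reg 11 = m)
    (h12 : σ.reg 12 = lg) (h13 : σ.reg 13 = lg * m) (h16 : σ.reg 16 = len)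
    (hb : ∀ c < m, σ.mem (3 * c + 1) + len ≤ S.length)
    (hinj : Set.InjOn (fun c => S.drop (σ.mem (3 * c + 1) + len)) (Set.Iio m))
    (hm : m < 2 ^ lg) (hB : 2 * m + 2 * 2 ^ lg + 4 < B) (hBS : 2 * S.length + 4 < B)
    (hBm : 7 * m + lg * m + lg * m + 1 < B) :
    WP S B L .sortClusters σ fun σ' t =>
      t ≤ lg * (m * (lg * (2 * L + 37) + 43) + 13) + m * 5 + 20 ∧ Agree 14 σ σ' ∧
      σ'.reg 14 = 3 * m + lg * m + m ∧
      σ'.reg 15 = 3 * m + lg * m + m + m + lg * m + m + m + 1 ∧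
      σ'.reg 16 = σ.reg 16 ∧ σ'.reg 17 = σ.reg 17 ∧ σ'.reg 18 = σ.reg 18 ∧ σ'.reg 20 = 3 * m ∧
      EqOff (3 * m) (3 * m + (lg + 1) * m) σ.mem σ'.mem ∧
      SortedAt (fun c => S.drop (σ.mem (3 * c + 1) + len)) m lg σ'.mem (3 * m + lg * m) := by
  have hlm : (lg + 1) * m = lg * m + m := by ring
  simp [Cmd.sortClusters, BinOp.eval, h11]
  refine ⟨by omega, by omega, ?_⟩
  refine (wp_mergeSort (key := fun c => S.drop (σ.mem (3 * c + 1) + len)) (m := m) (lg := lg)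
    (T := 2 * L + 20) hinj ?_ ?_ hm hB ?_ ?_).mono ?_
  · simp [h11]
  · simp [h12]
  · simp
    omega
  · intro σ' i1 i2 h37 h25
    simp at i1
    have e10 := i2 10 (by omega)
    have e16 := i2 16 (by omega)
    simp [h10, h16] at e10 e16
    have f1 := i1 (3 * σ'.reg 37 + 1) (by omega)
    have f2 := i1 (3 * σ'.reg 25 + 1) (by omega)
    refine (wp_tailLt e10 ?_ ?_ hBS (by omega) (by omega)).mono ?_
    · rw [f1, e16]
      exact hb _ h37
    · rw [f2, e16]
      exact hb _ h25
    · rw [f1, f2, e16]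
      exact fun _ _ h => h
  · rintro σ' t ⟨j1, j2, j3, j4⟩
    have f11 := j2 11 (by omega)
    have f13 := j2 13 (by omega)
    have f16 := j2 16 (by omega)
    have f17 := j2 17 (by omega)
    have f18 := j2 18 (by omega)
    have f20 := j2 20 (by omega)
    have j2' := j2.mono (show 14 ≤ 21 by omega)
    have j4' := j4 lg le_rfl
    clear j2 j4
    simp [h11, h13] at f11 f13 f16 f17 f18 f20 j2' j3 j4'
    simp [f11, f13, f16, f17, f18, f20, j2', j3, j4']
    refine ⟨by omega, by omega, by omega, by omega, by omega, by omega, by omega, by omega, ?_⟩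
    rw [show 2 * L + 20 + 17 = 2 * L + 37 by omega] at j1
    omega

end Preprocess

/-! ### Assembling the preprocessing -/

section Preprocess

/-- On a level with a single block, `blockPos` just counts the smaller keys. -/
theorem SortedAt.lt {K : Type*} [LinearOrder K] {key : ℕ → K} {m l M : ℕ} {μ : ℕ → ℕ}
    (hs : SortedAt key m l μ M) (hk : Set.InjOn key (Set.Iio m)) (hm : m ≤ 2 ^ l) {x y : ℕ}
    (hxy : x < y) (hy : y < m) : key (μ (M + x)) < key (μ (M + y)) := by
  obtain ⟨h1, h2⟩ := hs.apply hk (hxy.trans hy)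
  obtain ⟨h3, h4⟩ := hs.apply hk hy
  have h := blockPos_lt_iff (l := l) hk (p := fun i => key i < key (μ (M + y)))
    (fun a _ b _ hab hb => hab.trans hb) h1
  refine h.1 ?_
  rw [blockPos, Nat.div_eq_of_lt (h3.trans_le hm)] at h4
  rw [h2, Nat.div_eq_of_lt (h1.trans_le hm)]
  omega

variable {α : Type*} [LinearOrder α] {S : List α} {B L : ℕ} {σ : State} {m lg : ℕ}

theorem decSize_add_incSize (S : List α) (len ws : ℕ) (μ π : ℕ → ℕ) (j : ℕ) :
    decSize S len ws μ π j + incSize S len ws μ π j = sizeAt μ (π j) := by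
  rw [decSize, incSize]
  split_ifs <;> simp

/-- Build the indices of the two arrays at the addresses in the registers `14` and `15`. -/
def Cmd.buildIndices : Cmd :=
  .const 22 0 ;; .op .add 19 14 22 ;; .buildIndex ;; .const 22 0 ;; .op .add 19 15 22 ;; .buildIndex

theorem wp_buildIndices {X Y : ℕ} {f g : ℕ → ℕ} (h11 : σ.reg 11 = m) (h12 : σ.reg 12 = lg)
    (h13 : σ.reg 13 = lg * m) (h14 : σ.reg 14 = X) (h15 : σ.reg 15 = Y)
    (hXY : Y = X + m + lg * m + m + m + 1) (hf : ∀ j < m, σ.mem (X + j) = f j)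
    (hg : ∀ j < m, σ.mem (Y + j) = g j) (hm : m < 2 ^ lg) (hB : 2 * m + 2 * 2 ^ lg + 4 < B)
    (hBY : Y + m + lg * m + m + m + 1 < B) (hBf : ∑ j ∈ Finset.range m, f j < B)
    (hBg : ∑ j ∈ Finset.range m, g j < B) :
    WP S B L .buildIndices σ fun σ' t => t ≤ 2 * (lg * (m * (lg * 26 + 43) + 13) + m * 16) + 44 ∧
      Agree 19 σ σ' ∧ EqOff (X + m) (Y + m + lg * m + m + m + 1) σ.mem σ'.mem ∧
      ValueIndex f m lg σ'.mem X ∧ ValueIndex g m lg σ'.mem Y := by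
  simp [Cmd.buildIndices, BinOp.eval, h14]
  refine ⟨by omega, by omega, ?_⟩
  refine (wp_buildIndex (S := S) (f := f) (m := m) (lg := lg) (X := X) ?_ ?_ ?_ ?_ hm
    ?_ hB (by omega) hBf).mono ?_
  · simp [h11]
  · simp [h12]
  · simp [h13]
  · simp
  · exact hf
  rintro σ₄ t₄ ⟨ht₄, l1, l2, l3⟩
  replace l1 := l1.mono (show 19 ≤ 20 by omega)
  simp at l1 l2
  have l11 := (l1 11 (by omega)).trans h11
  have l12 := (l1 12 (by omega)).trans h12
  have l13 := (l1 13 (by omega)).trans h13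
  have l15 := (l1 15 (by omega)).trans h15
  simp [l15]
  refine ⟨by omega, by omega, ?_⟩
  refine (wp_buildIndex (S := S) (f := g) (m := m) (lg := lg) (X := Y) ?_ ?_ ?_ ?_ hm
    ?_ hB (by omega) hBg).mono ?_
  · simp [l11]
  · simp [l12]
  · simp [l13]
  · simp
  · intro j hj
    rw [← hg j hj]
    exact l2 _ (by omega)
  rintro σ₅ t₅ ⟨ht₅, n1, n2, n3⟩
  replace n1 := n1.mono (show 19 ≤ 20 by omega)
  simp at n1 n2
  exact ⟨by omega, l1.trans n1, (l2.mono (by omega) (by omega)).trans (n2.mono (by omega) (by omega)),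
    l3.congr fun x hx hx' => n2 x (by omega), n3⟩

/-- The preprocessing. -/
def Cmd.preprocess : Cmd := .setup ;; .sortClusters ;; .fillSizes ;; .buildIndices

set_option maxHeartbeats 1000000 in
theorem wp_preprocess {s e len ws : ℕ} (h0 : σ.reg 0 = S.length) (h1 : σ.reg 1 = s)
    (h2 : σ.reg 2 = e) (h3 : σ.reg 3 = m) (hS : S ≠ []) (hlg : lg = Nat.log 2 S.length + 1)
    (hlen : e + 1 - s = len) (hws : e + 1 - σ.mem 2 = ws) (hwsS : ws ≤ S.length)
    (he : e < S.length)
    (hb : ∀ c < m, σ.mem (3 * c + 1) + len ≤ S.length)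
    (hinj : Set.InjOn (fun c => S.drop (σ.mem (3 * c + 1) + len)) (Set.Iio m))
    (hs : ∀ c < m, sizeAt σ.mem c ≤ S.length) (hm : m ≤ S.length)
    (hB : 16 * (S.length * S.length) + 16 * S.length + 16 ≤ B) :
    WP S B L .preprocess σ fun σ' t =>
      t ≤ lg * (m * (lg * (2 * L + 89) + 129) + 44) + m * (2 * L + 70) + 100 ∧
      (∀ x < 3 * m, σ'.mem x = σ.mem x) ∧
      σ'.reg 10 = S.length ∧ σ'.reg 11 = m ∧ σ'.reg 12 = lg ∧ σ'.reg 13 = lg * m ∧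
      σ'.reg 14 = 3 * m + lg * m + m ∧
      σ'.reg 15 = 3 * m + lg * m + m + m + lg * m + m + m + 1 ∧ σ'.reg 18 = 2 ^ lg ∧
      ∃ π : ℕ → ℕ, (∀ j < m, σ'.mem (3 * m + lg * m + j) = π j) ∧ (∀ j < m, π j < m) ∧
        (∀ y < m, ∀ x < y, S.drop (σ.mem (3 * π x + 1) + len) <
          S.drop (σ.mem (3 * π y + 1) + len)) ∧
        ValueIndex (decSize S len ws σ.mem π) m lg σ'.mem (3 * m + lg * m + m) ∧
        ValueIndex (incSize S len ws σ.mem π) m lg σ'.mem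
          (3 * m + lg * m + m + m + lg * m + m + m + 1) := by
  have hn : S.length ≠ 0 := by simpa using hS
  have hlg2 : S.length < 2 ^ lg := by
    rw [hlg]
    exact Nat.lt_pow_succ_log_self (by omega) _
  have hlg3 : 2 ^ lg ≤ 2 * S.length := by
    rw [hlg, pow_succ]
    have := Nat.pow_log_le_self 2 hn
    omega
  have hlgn : lg ≤ S.length := by
    have := Nat.log_lt_self 2 hn
    omega
  -- All numbers stay within `O(n²)`: the addresses because `lg ≤ n` and `m ≤ n`, and the sums
  -- because there are at most `n` sizes, each at most `n`.
  have hlm : lg * m ≤ S.length * S.length := Nat.mul_le_mul hlgn hm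
  have hlm' : (lg + 1) * m = lg * m + m := by ring
  rw [Cmd.preprocess]
  refine WP.seq (wp_setup h0 h1 h2 h3 hn hlg (by omega) (by omega) (by omega) (by omega)
    (by omega) (by omega)) ?_
  rintro σ₁ t₁ ⟨ht₁, i1, i10, i11, i12, i13, i16, i17, i18⟩
  rw [hlen] at i16
  rw [hws] at i17
  rw [← i1] at hb hinj
  refine WP.seq (wp_sortClusters (m := m) (lg := lg) (L := L) i10 i11 i12 i13 i16 hb hinj
    (by omega) (by omega) (by omega) (by omega)) ?_
  rintro σ₂ t₂ ⟨ht₂, j1, j14, j15, j16, j17, j18, j20, j2, j3⟩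
  have j10 := (j1 10 (by omega)).trans i10
  have j11 := (j1 11 (by omega)).trans i11
  have j12 := (j1 12 (by omega)).trans i12
  have j13 := (j1 13 (by omega)).trans i13
  rw [i16] at j16
  rw [i17] at j17
  rw [i18] at j18
  have hμ : ∀ x < 3 * m, σ₂.mem x = σ.mem x := fun x hx => (j2 x (by omega)).trans (by rw [i1])
  obtain ⟨π, hπ⟩ : ∃ π : ℕ → ℕ, ∀ j < m, σ₂.mem (3 * m + lg * m + j) = π j :=
    ⟨_, fun _ _ => rfl⟩
  have hπm : ∀ j < m, π j < m := fun j hj => by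
    rw [← hπ j hj]
    exact (j3.apply hinj hj).1
  have hlt : ∀ y < m, ∀ x < y, S.drop (σ.mem (3 * π x + 1) + len) <
      S.drop (σ.mem (3 * π y + 1) + len) := fun y hy x hx => by
    have := j3.lt hinj (by omega) hx hy
    rwa [hπ x (by omega), hπ y hy, i1] at this
  rw [i1] at hb hinj j2 j3
  refine WP.seq (wp_fillSizes (m := m) (lg := lg) (μ := σ.mem) (π := π) j10 j11 j13 j14 j15 j16 j17
    j20 (by omega) (by omega) hμ hπ hπm hb hwsS hs (by omega) (by omega)) ?_
  have hle : ∀ f : ℕ → ℕ, (∀ j < m, f j ≤ S.length) →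
      ∑ j ∈ Finset.range m, f j < B := fun f hf => by
    have h := Finset.sum_le_card_nsmul (Finset.range m) f S.length
      fun j hj => hf j (Finset.mem_range.1 hj)
    rw [Finset.card_range, smul_eq_mul] at h
    have := Nat.mul_le_mul_right S.length hm
    exact h.trans_lt (by omega)
  have hsum : ∀ j < m, decSize S len ws σ.mem π j ≤ S.length ∧
      incSize S len ws σ.mem π j ≤ S.length := fun j hj => by
    have h1 := decSize_add_incSize S len ws σ.mem π j
    have h2 := hs _ (hπm j hj)
    omega
  have hdecB := hle _ fun j hj => (hsum j hj).1
  have hincB := hle _ fun j hj => (hsum j hj).2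
  rintro σ₃ t₃ ⟨ht₃, k1, k2, k3, k4⟩
  have k10 := (k1 10 (by omega)).trans j10
  have k11 := (k1 11 (by omega)).trans j11
  have k12 := (k1 12 (by omega)).trans j12
  have k13 := (k1 13 (by omega)).trans j13
  have k14 := (k1 14 (by omega)).trans j14
  have k15 := (k1 15 (by omega)).trans j15
  have k18 := (k1 18 (by omega)).trans j18
  refine (wp_buildIndices (m := m) (lg := lg) k11 k12 k13 k14 k15 rfl k3 k4 (by omega) (by omega)
    (by omega) hdecB hincB).mono ?_
  rintro σ₄ t₄ ⟨ht₄, l1, l2, l3, l4⟩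
  refine ⟨?_, fun x hx => ?_, (l1 10 (by omega)).trans k10, (l1 11 (by omega)).trans k11,
    (l1 12 (by omega)).trans k12, (l1 13 (by omega)).trans k13, (l1 14 (by omega)).trans k14,
    (l1 15 (by omega)).trans k15, (l1 18 (by omega)).trans k18, π, fun j hj => ?_, hπm, hlt, l3, l4⟩
  · have e1 : lg * (m * (lg * (2 * L + 89) + 129) + 44) =
      lg * (m * (lg * (2 * L + 37) + 43) + 13) + 2 * (lg * (m * (lg * 26 + 43) + 13)) +
        lg * 5 := by ring
    have e2 : m * (2 * L + 70) = m * (2 * L + 33) + m * 37 := by ring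
    rw [e1, e2]
    omega
  · rw [l2 x (by omega), k2 x (by omega), hμ x hx]
  · rw [l2 _ (by omega), k2 _ (by omega), hπ j hj]

end Preprocess

/-! ### Entries of filtered and concatenated lists -/

section Lists

theorem List.getElem?_filter_range {m j : ℕ} (p : ℕ → Prop) [DecidablePred p] (hj : j < m)
    (hp : p j) : ((List.range m).filter fun x => p x)[((Finset.range j).filter p).card]? =
      some j := by
  obtain ⟨k, rfl⟩ : ∃ k, m = j + (k + 1) := ⟨m - j - 1, by omega⟩
  have h : ((Finset.range j).filter p).card = ((List.range j).filter fun x => p x).length := rfl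
  rw [h, List.range_add, List.filter_append, List.getElem?_append_right le_rfl, Nat.sub_self,
    List.range_succ_eq_map]
  simp [hp]

theorem List.getElem?_flatMap_range {β : Type*} (T : ℕ → List β) {N r i : ℕ} {v : β} (hr : r < N)
    (hi : (T r)[i]? = some v) :
    ((List.range N).flatMap T)[∑ x ∈ Finset.range r, (T x).length + i]? = some v := by
  induction N with
  | zero => omega
  | succ N ih =>
    have hlen : ∀ n, ((List.range n).flatMap T).length = ∑ x ∈ Finset.range n, (T x).length := by
      intro n
      induction n with
      | zero => simp
      | succ n ih => simp [List.range_succ, Finset.sum_range_succ] at ih ⊢; omega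
    rw [List.range_succ, List.flatMap_append]
    rcases (Nat.lt_succ_iff.1 hr).eq_or_lt with rfl | hr
    · rw [List.getElem?_append_right (by rw [hlen]; omega), hlen]
      simpa using hi
    · rw [List.getElem?_append_left, ih hr]
      exact (List.getElem?_eq_some_iff.1 (ih hr)).1

/-- `T r` is preceded by the lists `T x` with `r < x < N`. The hypothesis on `k` says so without
subtraction. -/
theorem List.getElem?_flatMap_range_reverse {β : Type*} (T : ℕ → List β) {N r i k : ℕ} {v : β}
    (hr : r < N) (hi : (T r)[i]? = some v)
    (hk : k + ∑ x ∈ Finset.range (r + 1), (T x).length =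
      ∑ x ∈ Finset.range N, (T x).length + i) :
    ((List.range N).reverse.flatMap T)[k]? = some v := by
  induction N generalizing k with
  | zero => omega
  | succ N ih =>
    rw [List.range_succ, List.reverse_append, List.reverse_singleton, List.singleton_append,
      List.flatMap_cons]
    have hi' := (List.getElem?_eq_some_iff.1 hi).1
    rcases (Nat.lt_succ_iff.1 hr).eq_or_lt with rfl | hr
    · obtain rfl : k = i := by omega
      rwa [List.getElem?_append_left hi']
    · have h := Finset.sum_range_succ (fun x => (T x).length) N
      have h' := Finset.sum_le_sum_of_subset (f := fun x => (T x).length)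
        (Finset.range_mono (show r + 1 ≤ N by omega))
      rw [List.getElem?_append_right (by omega)]
      exact ih hr (by omega)

end Lists

/-! ### From the arithmetic of sizes to the arrays `T_r` and `A_w` -/

section Answer

variable {α : Type*} [LinearOrder α] {S w : List α} {P : List Cluster} {m : ℕ} {c : ℕ → Cluster}

/-- The size of the cluster `c j`, or `0` if it does not satisfy `p`. -/
def sizeIf (p : Cluster → Bool) (c : ℕ → Cluster) (j : ℕ) : ℕ := if p (c j) then (c j).size else 0

theorem lt_sizeIf {p : Cluster → Bool} {j r : ℕ} :
    r < sizeIf p c j ↔ p (c j) = true ∧ r < (c j).size := by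
  rw [sizeIf]
  split_ifs with h <;> simp [h]

section RankArray

variable (hw : w ≠ []) (hP : IsPOR S w P) (hc : tailSort S w P = (List.range m).map c)
  (p : Cluster → Bool)

include hc in
theorem mem_of_tailSort_eq {j : ℕ} (hj : j < m) : c j ∈ P := by
  rw [← mem_tailSort (S := S) (w := w), hc]
  exact List.mem_map_of_mem (List.mem_range.2 hj)

include hw hP hc

/-- One sorted list of all clusters serves both kinds, because filtering commutes with sorting by
distinct tails. Clusters of the other kind get size `0` and drop out by themselves. -/
theorem rankArray_filter (r : ℕ) : rankArray S w (P.filter p) r =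
    ((List.range m).filter fun j => r < sizeIf p c j).map fun j => (c j).b - r * per w := by
  have hPc : ∀ C ∈ P, IsCluster S w C := fun C hC => (hP.2 C).1 hC
  rw [rankArray_eq hw (fun C hC => hPc C (List.mem_of_mem_filter hC)),
    tailSort_filter hw hPc hP.1, hc, List.filter_map, List.filter_map, List.filter_filter,
    List.map_map]
  refine congrArg₂ _ rfl (List.filter_congr fun j _ => ?_)
  simp [lt_sizeIf, Bool.and_comm, Bool.decide_and]

theorem length_rankArray_filter (r : ℕ) :
    (rankArray S w (P.filter p) r).length = countGt (sizeIf p c) m r := by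
  rw [rankArray_filter hw hP hc, List.length_map]
  rfl

theorem sum_length_rankArray_filter (r : ℕ) :
    ∑ x ∈ Finset.range r, (rankArray S w (P.filter p) x).length = rankSum (sizeIf p c) m r := by
  rw [rankSum_eq_sum_range]
  exact Finset.sum_congr rfl fun x _ => length_rankArray_filter hw hP hc p x

/-- A cluster of size `q` has an occurrence of rank `q - 1`, so no size exceeds the maximal rank
plus one. -/
theorem rankSum_maxRank : rankSum (sizeIf p c) m (maxRank S w (P.filter p) + 1) =
    ∑ j ∈ Finset.range m, sizeIf p c j := by
  refine rankSum_of_le fun j hj => ?_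
  by_contra h
  obtain ⟨h1, h2⟩ := lt_sizeIf.1 (not_le.1 h)
  have hj := mem_of_tailSort_eq hc hj
  have := le_maxRank hw ((hP.2 _).1 hj) (List.mem_filter.2 ⟨hj, h1⟩) h2
  omega

theorem lt_maxRank_succ {j r : ℕ} (hj : j < m) (hr : r < sizeIf p c j) :
    r < maxRank S w (P.filter p) + 1 := by
  have hj := mem_of_tailSort_eq hc hj
  have := le_maxRank hw ((hP.2 _).1 hj) (List.mem_filter.2 ⟨hj, (lt_sizeIf.1 hr).1⟩)
    (lt_sizeIf.1 hr).2
  omega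

theorem getElem?_rankArray_filter {j r : ℕ} (hj : j < m) (hr : r < sizeIf p c j) :
    (rankArray S w (P.filter p) r)[((Finset.range j).filter fun x => r < sizeIf p c x).card]? =
      some ((c j).b - r * per w) := by
  rw [rankArray_filter hw hP hc, List.getElem?_map, List.getElem?_filter_range _ hj hr]
  rfl

end RankArray

variable {p q : Cluster → Bool}

theorem length_sortedOcc (hw : w ≠ []) (hP : IsPOR S w P)
    (hc : tailSort S w P = (List.range m).map c) (hp : P.filter p = decClusters S w P)
    (hq : P.filter q = incClusters S w P) : (sortedOcc S w).length =
      ∑ j ∈ Finset.range m, sizeIf p c j +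
        ∑ j ∈ Finset.range m, sizeIf q c j := by
  have h : ∀ (Q : List Cluster) (N : ℕ), ((List.range N).map fun r => (rankArray S w Q r).length).sum
      = ∑ x ∈ Finset.range N, (rankArray S w Q x).length := fun Q N => rfl
  rw [sortedOcc_eq hw hP, ← hp, ← hq, List.length_append, List.length_flatMap, List.length_flatMap,
    List.map_reverse, List.sum_reverse, h, h, ← rankSum_maxRank hw hP hc,
    ← rankSum_maxRank hw hP hc, ← sum_length_rankArray_filter hw hP hc,
    ← sum_length_rankArray_filter hw hP hc]

theorem isAnswer_of_reg (hw : w ≠ []) (hP : IsPOR S w P)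
    (hc : tailSort S w P = (List.range m).map c) (hp : P.filter p = decClusters S w P)
    (hq : P.filter q = incClusters S w P) {i j : ℕ} {σ : State} (hj : j < m)
    (h0 : σ.reg 0 = (c j).b - σ.reg 1 * (c j).p) (h3 : σ.reg 3 = (c j).a)
    (h4 : σ.reg 4 = (c j).b) (h5 : σ.reg 5 = (c j).p)
    (h : (σ.reg 1 < sizeIf p c j ∧
        ((Finset.range j).filter fun x => σ.reg 1 < sizeIf p c x).card = σ.reg 2 ∧
        rankSum (sizeIf p c) m (σ.reg 1) + σ.reg 2 = i) ∨
      (σ.reg 1 < sizeIf q c j ∧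
        ((Finset.range j).filter fun x => σ.reg 1 < sizeIf q c x).card = σ.reg 2 ∧
        i + rankSum (sizeIf q c) m (σ.reg 1 + 1) =
          ∑ j ∈ Finset.range m, sizeIf p c j +
            ∑ j ∈ Finset.range m, sizeIf q c j + σ.reg 2)) :
    IsAnswer S w P i σ := by
  have hcP := mem_of_tailSort_eq hc hj
  have hC := (hP.2 _).1 hcP
  rw [hC.diff] at h0
  have hr : σ.reg 1 < (c j).size := h.elim (fun h => (lt_sizeIf.1 h.1).2)
    fun h => (lt_sizeIf.1 h.1).2
  refine ⟨?_, by rw [h0, hC.rank_b_sub hw hr], c j, h3.symm, h4.symm, h5.symm, hcP,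
    by rw [h0]; exact hC.b_sub_mem hr, ?_⟩
  · rw [sortedOcc_eq hw hP, ← hp, ← hq]
    rcases h with ⟨h1, h2, h6⟩ | ⟨h1, h2, h6⟩
    · have h7 := List.getElem?_flatMap_range (rankArray S w (P.filter p))
        (lt_maxRank_succ hw hP hc _ hj h1) (getElem?_rankArray_filter hw hP hc _ hj h1)
      rw [sum_length_rankArray_filter hw hP hc, h2, h6, ← h0] at h7
      rw [List.getElem?_append_left (List.getElem?_eq_some_iff.1 h7).1]
      exact h7
    · have hlen : ((List.range (maxRank S w (P.filter p) + 1)).flatMap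
          fun r => rankArray S w (P.filter p) r).length =
          ∑ j ∈ Finset.range m, sizeIf p c j := by
        rw [List.length_flatMap, ← rankSum_maxRank hw hP hc, ← sum_length_rankArray_filter hw hP hc]
        rfl
      have h8 := getElem?_rankArray_filter hw hP hc _ hj h1
      have h9 := rankSum_maxRank hw hP hc q
      -- Hence `i` is at least the length of the decreasing half, so the entry lies in the second
      -- part of the concatenation.
      have h10 : rankSum (sizeIf q c) m (σ.reg 1 + 1) ≤ _ :=
        rankSum_mono (sizeIf q c) m (lt_maxRank_succ hw hP hc _ hj h1)
      rw [List.getElem?_append_right (by omega), hlen, h0]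
      refine List.getElem?_flatMap_range_reverse _ (lt_maxRank_succ hw hP hc _ hj h1) h8 ?_
      rw [sum_length_rankArray_filter hw hP hc, sum_length_rankArray_filter hw hP hc]
      omega
  · rcases h with ⟨h1, h2, -⟩ | ⟨h1, h2, -⟩
    · have h3 := getElem?_rankArray_filter hw hP hc _ hj h1
      rw [h2, ← h0] at h3
      rw [← hp, ← hq]
      exact Or.inr ⟨List.mem_filter.2 ⟨hcP, (lt_sizeIf.1 h1).1⟩, h3⟩
    · have h3 := getElem?_rankArray_filter hw hP hc _ hj h1
      rw [h2, ← h0] at h3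
      rw [← hp, ← hq]
      exact Or.inl ⟨List.mem_filter.2 ⟨hcP, (lt_sizeIf.1 h1).1⟩, h3⟩

end Answer

/-! ### Bounds on the input, and the reference suffix for `w_s` -/

section DataStructure

/-- The cluster with index `c` in the memory `μ`. -/
def clusterAt (μ : ℕ → ℕ) (c : ℕ) : Cluster := ⟨μ (3 * c), μ (3 * c + 1), μ (3 * c + 2)⟩

theorem clusterAt_initState (n s e : ℕ) {P : List Cluster} {c : ℕ} (hc : c < P.length) :
    clusterAt (initState n s e P).mem c = P[c] := by
  induction P generalizing c with
  | nil => simp at hc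
  | cons C P ih =>
    rcases c with _ | c
    · rfl
    · exact ih (by simpa using hc)

variable {α : Type*} {S : List α} {s e : ℕ}

theorem length_factor (he : e < S.length) : (factor S s e).length = e + 1 - s := by
  rw [factor, List.length_take, List.length_drop]
  omega

theorem drop_eq_factor_append (he : s ≤ e) : S.drop s = factor S s e ++ S.drop (e + 1) := by
  conv_lhs => rw [← List.take_append_drop (e + 1 - s) (S.drop s)]
  rw [List.drop_drop, show s + (e + 1 - s) = e + 1 by omega, factor]

theorem drop_eq_perSuffix_append (hs : s ≤ e) (he : e < S.length) :
    S.drop (e + 1 - per (factor S s e)) = perSuffix (factor S s e) ++ S.drop (e + 1) := by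
  have hlen := length_factor (s := s) he
  have hw : factor S s e ≠ [] := by
    rw [← List.length_pos_iff]
    omega
  have hper := per_le_length hw
  rw [show e + 1 - per (factor S s e) = s + ((factor S s e).length - per (factor S s e)) by omega,
    ← List.drop_drop, drop_eq_factor_append hs, List.drop_append_of_le_length (by omega), perSuffix]

theorem IsCluster.size_le {w : List α} {C : Cluster} (hC : IsCluster S w C) (hw : w ≠ []) :
    C.size ≤ S.length := by
  have h1 := hC.occurs_b.add_length_le hw
  have h2 := List.length_pos_iff.2 hw
  have h3 := hC.b_eq
  have h4 : C.size - 1 ≤ (C.size - 1) * per w := Nat.le_mul_of_pos_right _ (per_pos w)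
  omega

/-- Different clusters have different right ends, all of them below the length of `S`. -/
theorem IsPOR.length_le {w : List α} {P : List Cluster} (hP : IsPOR S w P) (hw : w ≠ []) :
    P.length ≤ S.length := by
  have h1 : (P.map Cluster.b).Nodup := hP.1.map_on fun C hC C' hC' h =>
    ((hP.2 C).1 hC).eq_of_tail_eq ((hP.2 C').1 hC') hw (by rw [Cluster.tail, Cluster.tail, h])
  have h2 : P.map Cluster.b ⊆ List.range S.length := by
    intro b hb
    obtain ⟨C, hC, rfl⟩ := List.mem_map.1 hb
    have h1 := ((hP.2 C).1 hC).occurs_b.add_length_le hw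
    have h2 := List.length_pos_iff.2 hw
    rw [List.mem_range]
    omega
  simpa using (List.subperm_of_subset h1 h2).length_le

variable [LinearOrder α]

/-- The machine compares suffixes of the text only, and `w_s` need not be one. The suffix used
instead is `w_s` followed by more letters, which do not matter because `w_s` is not a prefix of the
tail. -/
theorem IsCluster.tail_lt_drop_iff {C : Cluster} (hC : IsCluster S (factor S s e) C) (hs : s ≤ e)
    (he : e < S.length) : C.tail S (factor S s e) < S.drop (e + 1 - per (factor S s e)) ↔
      C.tail S (factor S s e) < perSuffix (factor S s e) := by
  have hw : factor S s e ≠ [] := by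
    rw [← List.length_pos_iff, length_factor he]
    omega
  rw [drop_eq_perSuffix_append hs he]
  refine ⟨fun h => ?_, List.lt_append_of_lt _⟩
  rcases hC.tail_lt_or_lt hw with h' | h'
  · exact h'
  · exact absurd h (List.append_lt_of_lt_of_not_prefix _ h' (hC.not_perSuffix_prefix_tail hw)).asymm

theorem tailSort_eq_map {w : List α} {P : List Cluster} (hP : IsPOR S w P) (hw : w ≠ [])
    {c : ℕ → Cluster} (hc : ∀ j < P.length, c j ∈ P)
    (hlt : ∀ y < P.length, ∀ x < y, (c x).tail S w < (c y).tail S w) :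
    tailSort S w P = (List.range P.length).map c := by
  have h : ((List.range P.length).map c).Pairwise fun C C' => C.tail S w < C'.tail S w := by
    rw [List.pairwise_map]
    exact List.pairwise_lt_range.imp_of_mem fun _ hy hxy => hlt _ (List.mem_range.1 hy) _ hxy
  refine (eq_tailSort hw (fun C hC => (hP.2 C).1 hC) hP.1 ?_ h).symm
  refine (List.subperm_of_subset ?_ fun C hC => ?_).perm_of_length_le (by simp)
  · exact h.imp fun h h' => absurd h (by rw [h']; exact lt_irrefl _)
  · obtain ⟨j, hj, rfl⟩ := List.mem_map.1 hC
    exact hc j (List.mem_range.1 hj)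

theorem sum_range_lt {f : ℕ → ℕ} {m n B : ℕ} (hf : ∀ j < m, f j ≤ n) (hm : m ≤ n) (hB : n * n < B) :
    ∑ j ∈ Finset.range m, f j < B := by
  have h := Finset.sum_le_card_nsmul (Finset.range m) f n fun j hj => hf j (Finset.mem_range.1 hj)
  rw [Finset.card_range, smul_eq_mul] at h
  exact (h.trans (Nat.mul_le_mul_right _ hm)).trans_lt hB

end DataStructure

/-! ### Running times and the data structure -/

section Main

variable {α : Type*} [LinearOrder α] {S : List α} {s e : ℕ} {P : List Cluster}

theorem preprocess_time_le (κ : ℕ) {m l : ℕ} (hm : 0 < m) (hl : 0 < l) :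
    l * (m * (l * (2 * (κ * l) + 89) + 129) + 44) + m * (2 * (κ * l) + 70) + 100 ≤
      (4 * κ + 432) * (m * l ^ 3) := by
  have h1 : m * l ≤ m * l ^ 3 := Nat.mul_le_mul_left _ (Nat.le_self_pow (by omega) l)
  have h2 : m * l ^ 2 ≤ m * l ^ 3 := Nat.mul_le_mul_left _ (Nat.pow_le_pow_right hl (by omega))
  have h3 : m ≤ m * l := Nat.le_mul_of_pos_right _ hl
  have h4 : l ≤ m * l := Nat.le_mul_of_pos_left _ hm
  have h5 : κ * (m * l) ≤ κ * (m * l ^ 3) := Nat.mul_le_mul_left _ h1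
  calc _ = 2 * (κ * (m * l ^ 3)) + 89 * (m * l ^ 2) + 129 * (m * l) + 44 * l +
        2 * (κ * (m * l)) + 70 * m + 100 := by ring
    -- Every monomial is at most `m * l ^ 3`, with `4 = 2 + 2` and `432 = 89 + 129 + 44 + 70 + 100`.
    _ ≤ 4 * (κ * (m * l ^ 3)) + 432 * (m * l ^ 3) := by omega
    _ = _ := by ring

theorem query_time_le (κ : ℕ) {l : ℕ} (hl : 0 < l) :
    l * (l * 44 + 97) + 100 ≤ (4 * κ + 432) * l ^ 3 := by
  have h1 : l ≤ l ^ 3 := Nat.le_self_pow (by omega) l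
  have h2 : l ^ 2 ≤ l ^ 3 := Nat.pow_le_pow_right hl (by omega)
  calc _ = 44 * l ^ 2 + 97 * l + 100 := by ring
    _ ≤ 432 * l ^ 3 := by omega
    _ ≤ _ := Nat.mul_le_mul_right _ (by omega)

set_option maxHeartbeats 1000000 in
theorem exists_dataStructure (hse : s ≤ e) (he : e < S.length) (hP : IsPOR S (factor S s e) P)
    (κ : ℕ) : ∃ (Valid : State → Prop) (σ₀ : State) (t₀ : ℕ),
      Exec S ((S.length + 1) ^ 6) (κ * (Nat.log 2 S.length + 1)) .preprocess
        (initState S.length s e P) σ₀ t₀ ∧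
      t₀ ≤ (4 * κ + 432) * (P.length * (Nat.log 2 S.length + 1) ^ 3) ∧
      Valid σ₀ ∧
      ∀ σ : State, Valid σ → ∀ i < (sortedOcc S (factor S s e)).length,
        ∃ (σ' : State) (t : ℕ),
          Exec S ((S.length + 1) ^ 6) (κ * (Nat.log 2 S.length + 1)) .query
            (σ.setReg 0 i) σ' t ∧
          t ≤ (4 * κ + 432) * (Nat.log 2 S.length + 1) ^ 3 ∧
          Valid σ' ∧
          IsAnswer S (factor S s e) P i σ' := by
  have hlen := length_factor (s := s) he
  have hw : factor S s e ≠ [] := by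
    rw [← List.length_pos_iff]
    omega
  have hn : 0 < S.length := by omega
  have hS : S ≠ [] := List.length_pos_iff.1 hn
  have hper := per_le_length hw
  have hm := hP.length_le hw
  -- The word occurs at `s`, so there is a first cluster from which the period can be read.
  have hm0 : 0 < P.length := by
    obtain ⟨C, hC, -⟩ := exists_isCluster hw (S := S) (i := s) (List.take_prefix _ _)
    exact List.length_pos_of_mem ((hP.2 C).2 hC)
  have hB : 16 * (S.length * S.length) + 16 * S.length + 16 ≤ (S.length + 1) ^ 6 := by
    -- As `S` is not empty, four of the six factors `n + 1` pay for the constant `16`, and the other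
    -- two for the quadratic bound.
    have h1 : 2 ^ 4 ≤ (S.length + 1) ^ 4 := Nat.pow_le_pow_left (by omega) 4
    have h2 := Nat.mul_le_mul_right ((S.length + 1) ^ 2) h1
    rw [← pow_add] at h2
    refine le_trans ?_ h2
    nlinarith
  obtain ⟨lg, hlg⟩ : ∃ lg, Nat.log 2 S.length + 1 = lg := ⟨_, rfl⟩
  have hlg2 : S.length < 2 ^ lg := hlg ▸ Nat.lt_pow_succ_log_self (by omega) _
  have hlg3 : 2 ^ lg ≤ 2 * S.length := by
    rw [← hlg, pow_succ]
    have := Nat.pow_log_le_self 2 hn.ne'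
    omega
  have hlgn : lg ≤ S.length := by
    have := Nat.log_lt_self 2 hn.ne'
    omega
  have hlm : lg * P.length ≤ S.length * S.length := Nat.mul_le_mul hlgn hm
  have hat : ∀ c < P.length, clusterAt (initState S.length s e P).mem c ∈ P := fun c hc => by
    rw [clusterAt_initState _ _ _ hc]
    exact List.getElem_mem hc
  have hcl := fun c hc => (hP.2 _).1 (hat c hc)
  have hb : ∀ c < P.length, (clusterAt (initState S.length s e P).mem c).b +
      (factor S s e).length ≤ S.length := fun c hc => (hcl c hc).occurs_b.add_length_le hw
  have hp : ∀ c < P.length, (clusterAt (initState S.length s e P).mem c).p = per (factor S s e) :=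
    fun c hc => (hcl c hc).diff
  have hs : ∀ c < P.length, (clusterAt (initState S.length s e P).mem c).size ≤ S.length :=
    fun c hc => (hcl c hc).size_le hw
  have hinj : Set.InjOn (fun c => (clusterAt (initState S.length s e P).mem c).tail S (factor S s e))
      (Set.Iio P.length) := by
    intro c hc c' hc' h
    have h' := (hcl c hc).eq_of_tail_eq (hcl c' hc') hw h
    rw [clusterAt_initState _ _ _ hc, clusterAt_initState _ _ _ hc'] at h'
    exact (hP.1.getElem_inj_iff).1 h'
  generalize hμ : (initState S.length s e P).mem = μ at *
  obtain ⟨σ₀, t₀, hpre, ht₀, r1, r10, r11, r12, r13, r14, r15, r18, π, q1, q2, q3, q4, q5⟩ :=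
    wp_preprocess (S := S) (B := (S.length + 1) ^ 6) (L := κ * lg)
      (σ := initState S.length s e P) (m := P.length) (lg := lg) (s := s) (e := e)
      (len := (factor S s e).length) (ws := e + 1 - per (factor S s e)) rfl rfl rfl rfl hS hlg.symm
      hlen.symm (by rw [← hp 0 hm0, hμ]; rfl) (by omega) he (by rw [hμ]; exact hb)
      (by rw [hμ]; exact hinj) (by rw [hμ]; exact hs) hm hB
  rw [hμ] at r1 q3 q4 q5
  have hc := tailSort_eq_map hP hw (c := fun j => clusterAt μ (π j)) (fun j hj => hat _ (q2 j hj)) q3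
  let p : Cluster → Bool := fun C => decide (C.tail S (factor S s e) <
    S.drop (e + 1 - per (factor S s e)))
  let q : Cluster → Bool := fun C => !p C
  have hpP : P.filter p = decClusters S (factor S s e) P := by
    refine List.filter_congr fun C hC => ?_
    simp only [p, ((hP.2 C).1 hC).tail_lt_drop_iff hse he]
  -- No tail equals `w_s`, so the clusters that are not decreasing are the increasing ones.
  have hqP : P.filter q = incClusters S (factor S s e) P := by
    refine List.filter_congr fun C hC => ?_
    simp only [q, p, ((hP.2 C).1 hC).tail_lt_drop_iff hse he]
    rcases ((hP.2 C).1 hC).tail_lt_or_lt hw with h | h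
    · simp [h, h.le]
    · simp [h, h.asymm]
  have hdec : decSize S (factor S s e).length (e + 1 - per (factor S s e)) μ π =
      sizeIf p fun j => clusterAt μ (π j) := by
    funext j
    simp only [decSize, sizeIf, p, decide_eq_true_eq]
    rfl
  have hinc : incSize S (factor S s e).length (e + 1 - per (factor S s e)) μ π =
      sizeIf q fun j => clusterAt μ (π j) := by
    funext j
    simp only [incSize, sizeIf, q, p, Bool.not_eq_true', decide_eq_false_iff_not, ite_not]
    rfl
  rw [hdec] at q4
  rw [hinc] at q5
  have hsize : ∀ (p : Cluster → Bool), ∀ j < P.length,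
      sizeIf p (fun j => clusterAt μ (π j)) j ≤ S.length := fun p j hj => by
    rw [sizeIf]
    split_ifs
    · exact hs _ (q2 j hj)
    · omega
  rw [hlg]
  -- A query leaves the memory and the registers `10` to `18` as they were, and it relies on nothing
  -- else apart from its input in register `0`.
  refine ⟨fun σ => σ.mem = σ₀.mem ∧ ∀ x, 10 ≤ x → x < 19 → σ.reg x = σ₀.reg x, σ₀, t₀, hpre, ?_,
    ⟨rfl, fun _ _ _ => rfl⟩, ?_⟩
  · exact ht₀.trans (preprocess_time_le κ hm0 (by omega))
  · rintro σ ⟨v1, v2⟩ i hi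
    rw [length_sortedOcc hw hP hc hpP hqP] at hi
    have hpB := sum_range_lt (hsize p) hm (Nat.lt_succ_self _)
    have hqB := sum_range_lt (hsize q) hm (Nat.lt_succ_self _)
    have hreg : ∀ x, 10 ≤ x → x < 19 → (σ.setReg 0 i).reg x = σ₀.reg x := fun x hx hx' => by
      rw [State.setReg_reg, if_neg (by omega), v2 x hx hx']
    obtain ⟨σ', t, hq, ht, u1, u2, j, hj, u3, u4, u5, u6, u7, u8⟩ :=
      wp_query (S := S) (B := (S.length + 1) ^ 6) (L := κ * lg) (σ := σ.setReg 0 i) (lg := lg)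
        (m := P.length) (n := S.length) (i := i) (π := π)
        (by rw [State.setReg_mem, v1]; exact q4) (by rw [State.setReg_mem, v1]; exact q5)
        (by omega) hlg2 (hsize p) (hsize q) (by rw [State.setReg_mem, v1]; exact q1) q2
        (fun c hc => by
          rw [State.setReg_mem, v1, r1 _ (by omega)]
          have := hp c hc
          simp only [clusterAt] at this
          omega)
        (fun c hc => by
          rw [State.setReg_mem, v1, r1 _ (by omega)]
          have := hb c hc
          simp only [clusterAt] at this
          omega)
        (by simp) (by rw [hreg 10 (by omega) (by omega), r10])
        (by rw [hreg 11 (by omega) (by omega), r11]) (by rw [hreg 12 (by omega) (by omega), r12])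
        (by rw [hreg 13 (by omega) (by omega), r13]) (by rw [hreg 14 (by omega) (by omega), r14])
        (by rw [hreg 15 (by omega) (by omega), r15]) (by rw [hreg 18 (by omega) (by omega), r18])
        hi (by omega) (by omega) (by omega) (by omega) (by omega) (by omega) (by omega)
        (hpB.trans (by omega)) (hqB.trans (by omega))
    have hπj := q2 j hj
    rw [State.setReg_mem, v1] at u1
    rw [State.setReg_mem, v1, r1 _ (by omega), r1 _ (by omega)] at u4
    rw [State.setReg_mem, v1, r1 _ (by omega)] at u5 u6 u7
    refine ⟨σ', t, hq, ?_, ⟨u1, fun x hx hx' => (u2 x hx hx').trans (hreg x hx hx')⟩,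
      isAnswer_of_reg hw hP hc hpP hqP hj u4 u5 u6 u7 (u8.imp (fun h => h.2) fun h => h.2)⟩
    exact ht.trans (query_time_le κ (by omega))

end Main

theorem theoremt :
    -- the structure of the array `A_w`
    (∀ (α : Type*) [LinearOrder α] (S : List α) (s e : ℕ) (P : List Cluster),
      s ≤ e → e < S.length → IsPOR S (factor S s e) P →
        sortedOcc S (factor S s e) =
          ((List.range (maxRank S (factor S s e) (decClusters S (factor S s e) P) + 1)).flatMap
            fun r => rankArray S (factor S s e) (decClusters S (factor S s e) P) r) ++
          ((List.range (maxRank S (factor S s e) (incClusters S (factor S s e) P) + 1)).reverse.flatMap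
            fun r => rankArray S (factor S s e) (incClusters S (factor S s e) P) r)) ∧
    -- the data structure: words hold numbers below `(n + 1) ^ d`, and `κ` is the constant in the
    -- cost `O(log n)` of an access to the text
    ∃ (pre qry : Cmd) (d k : ℕ), ∀ κ : ℕ, ∃ c : ℕ,
      ∀ (α : Type*) [LinearOrder α] (S : List α) (s e : ℕ) (P : List Cluster),
      s ≤ e → e < S.length → IsPOR S (factor S s e) P →
      ∃ (Valid : State → Prop) (σ₀ : State) (t₀ : ℕ),
        Exec S ((S.length + 1) ^ d) (κ * (Nat.log 2 S.length + 1)) pre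
          (initState S.length s e P) σ₀ t₀ ∧
        t₀ ≤ c * (P.length * (Nat.log 2 S.length + 1) ^ k) ∧
        Valid σ₀ ∧
        -- every query leaves the machine ready for further queries
        ∀ σ : State, Valid σ → ∀ i < (sortedOcc S (factor S s e)).length,
          ∃ (σ' : State) (t : ℕ),
            Exec S ((S.length + 1) ^ d) (κ * (Nat.log 2 S.length + 1)) qry
              (σ.setReg 0 i) σ' t ∧
            t ≤ c * (Nat.log 2 S.length + 1) ^ 3 ∧
            Valid σ' ∧
            IsAnswer S (factor S s e) P i σ' := by
  refine ⟨fun α _ S s e P hse he hP => ?_, .preprocess, .query, 6, 3, fun κ => ⟨4 * κ + 432,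
    fun α _ S s e P hse he hP => exists_dataStructure hse he hP κ⟩⟩
  refine sortedOcc_eq ?_ hP
  rw [← List.length_pos_iff, length_factor he]
  omega
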